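/- All graphs are finite, simple and undirected. A graph $G$ is a \emph{blow-up} of a graph $H$ on the vertex set $[h]$ if $V(G)$ can be partitioned into (possibly empty) sets $V_1,\dots,V_h$ such that, for all $i,j\in[h]$ and all $u\in V_i$, $v\in V_j$, the pair $uv$ is an edge of $G$ if and only if $ij$ is an edge of $H$. $G$ is a \emph{blow-up collection} of $H$ if $V(G)$ can be partitioned into sets with no edges of $G$ between different sets, each of which induces a blow-up of $H$. A \emph{minimal witness} against $H$ is a set $S$ of vertices of a graph $G$ such that the induced subgraph $G|_S$ is not a blow-up collection of $H$, but $G|_{S'}$ is one for every proper subset $S'\subsetneq S$. A graph $G$ on $N\ge 1$ vertices is \emph{$\epsilon$-far} from a graph property $\Pi$ if at least $\epsilon N^2$ edges must be added or deleted to turn $G$ into a graph on the same vertices in $\Pi$. A \emph{non-adaptive $\epsilon$-tester} (with two-sided error) for $\Pi$ making $q$ queries is a randomized algorithm that chooses $q$ vertex pairs in advance, learns for each whether it is an edge of $G$, and then accepts with probability $>2/3$ if $G\in\Pi$, and rejects with probability $>2/3$ if $G$ is $\epsilon$-far from $\Pi$. \textbf{Theorem (Non-Adaptive Tester).} Let $H$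 be a graph with $h$ vertices and maximum degree $\Delta$. The sizes of minimal witnesses against $H$ have a maximum $W=W(H)$, and $W<h^2$ if $h\ge 3$. For every constant $c>1$ there is a constant $C=C(H,c)$ such that for every $\epsilon>0$ and every $N\ge1$ there is a non-adaptive $\epsilon$-tester (with two-sided error) for the property of graphs on $N$ vertices of having maximum degree at most $c\epsilon N$ and being a blow-up collection of $H$, that makes at most $$C\left(\epsilon^{-2+1/(\Delta+2)}+\epsilon^{-2+2/W}\right)$$ queries (a number of queries that does not depend on $N$). In particular, if $H$ is the simple $t$-cycle with $t\ge 8$, then at most $C(t,c)\,\epsilon^{-2+2/t}$ queries suffice. -/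

import Mathlib

open scoped symmDiff

/-- `G` is a blow-up of `H`: the vertices of `G` are partitioned into clusters indexed by the
vertices of `H` (`f v` is the index of the cluster of `v`; clusters may be empty), and two
vertices of `G` are adjacent exactly when the indices of their clusters are adjacent in `H`. -/
def IsBlowUp {U V : Type*} (H : SimpleGraph U) (G : SimpleGraph V) : Prop :=
  ∃ f : V → U, ∀ u v : V, G.Adj u v ↔ H.Adj (f u) (f v)

/-- `G` is a blow-up collection of `H`: the vertices of `G` are partitioned into `k` parts, for
some `k` (`p v` is the index of the part of `v`), such that every part induces a blow-up of `H`
and no edge of `G` joins two different parts. -/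
def IsBlowUpCollection {U V : Type*} (H : SimpleGraph U) (G : SimpleGraph V) : Prop :=
  ∃ (k : ℕ) (p : V → Fin k),
    (∀ i : Fin k, IsBlowUp H (G.induce {v | p v = i})) ∧
    ∀ u v : V, p u ≠ p v → ¬ G.Adj u v

/-- `S` is a minimal witness in `G` against being a blow-up collection of `H`. -/
def IsMinimalWitness {U V : Type*} (H : SimpleGraph U) (G : SimpleGraph V) (S : Set V) : Prop :=
  ¬ IsBlowUpCollection H (G.induce S) ∧
    ∀ S' : Set V, S' ⊂ S → IsBlowUpCollection H (G.induce S')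

/-- The sizes of the minimal witnesses (in finite graphs) against being a blow-up collection
of `H`. -/
def minimalWitnessSizes {U : Type*} (H : SimpleGraph U) : Set ℕ :=
  {n | ∃ (N : ℕ) (G : SimpleGraph (Fin N)) (S : Set (Fin N)),
    IsMinimalWitness H G S ∧ S.ncard = n}

/-- The graphs on `N` vertices that have maximum degree at most `d` and are blow-up
collections of `H`. -/
def lowDegreeBlowUpCollections {U : Type*} (H : SimpleGraph U) (N : ℕ) (d : ℝ) :
    Set (SimpleGraph (Fin N)) :=
  {G | (∀ v, ((G.neighborSet v).ncard : ℝ) ≤ d) ∧ IsBlowUpCollection H G}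

/-- The number of edges that have to be added to or deleted from `G` to obtain `G'`. -/
noncomputable def editDistance {N : ℕ} (G G' : SimpleGraph (Fin N)) : ℕ :=
  (G.edgeSet ∆ G'.edgeSet).ncard

/-- `G` is `ε`-far from the property `P`: at least `ε * N ^ 2` edges must be added or deleted
to turn `G` into a graph in `P`. -/
def IsFarFrom {N : ℕ} (ε : ℝ) (P : Set (SimpleGraph (Fin N))) (G : SimpleGraph (Fin N)) : Prop :=
  ∀ G' ∈ P, ε * (N : ℝ) ^ 2 ≤ (editDistance G G' : ℝ)

/-- A randomized non-adaptive algorithm that makes `q` queries to the adjacency oracle of a graph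
on `N` vertices. It draws a random seed; the seed alone determines all the queries, and the seed
and the vector of answers determine the output (`true` for accept, `false` for reject). -/
structure NonAdaptiveAlgorithm (N q : ℕ) where
  /-- The possible outcomes of the random choices. -/
  Seed : Type
  /-- The distribution of the random choices. -/
  coin : PMF Seed
  /-- The queried vertex pairs. -/
  query : Seed → Fin q → Fin N × Fin N
  /-- The output, computed from the seed and the answers. -/
  output : Seed → (Fin q → Bool) → Bool

open Classical in
/-- The distribution of the output of the algorithm `A` on the input graph `G`. -/
noncomputable def NonAdaptiveAlgorithm.run {N q : ℕ} (A : NonAdaptiveAlgorithm N q)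
    (G : SimpleGraph (Fin N)) : PMF Bool :=
  A.coin.map fun s => A.output s fun i => decide (G.Adj (A.query s i).1 (A.query s i).2)

/-- `A` is an `ε`-tester, with two-sided error, for the property `P`. -/
def NonAdaptiveAlgorithm.IsTester {N q : ℕ} (A : NonAdaptiveAlgorithm N q) (ε : ℝ)
    (P : Set (SimpleGraph (Fin N))) : Prop :=
  (∀ G ∈ P, 2 / 3 < A.run G true) ∧
    ∀ G : SimpleGraph (Fin N), IsFarFrom ε P G → 2 / 3 < A.run G false

/-- With at most `Q ε` non-adaptive queries, whatever the number `N ≥ 1` of vertices, one can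
`ε`-test the combined property of having maximum degree at most `c * ε * N` and being a blow-up
collection of `H`, for every `ε > 0`. -/
def HasNonAdaptiveTesters {U : Type*} (H : SimpleGraph U) (c : ℝ) (Q : ℝ → ℝ) : Prop :=
  ∀ ε : ℝ, 0 < ε → ∃ q : ℕ, (q : ℝ) ≤ Q ε ∧
    ∀ N : ℕ, 1 ≤ N → ∃ A : NonAdaptiveAlgorithm N q,
      A.IsTester ε (lowDegreeBlowUpCollections H N (c * ε * N))

/-! Witness sizes. A minimal witness is connected and has no twins, since otherwise labellings of
proper subsets could be merged or copied to the whole set. A connected twin-free set that induces a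
collection embeds injectively into `H`, so it has at most h vertices. A connected proper subset of a
connected twin-free set extends inside it by one or two vertices (`exists_extension`); applied to a
maximal proper connected twin-free subset this yields W ≤ h + 2 (`MinimalOn.card_le`), which is
below h² for h ≥ 3. For the t-cycle with t ≥ 8, a witness with more than t vertices would be a full
cycle or an induced path on t - 1 vertices plus at most two vertices, and exchanging vertices rules
this out (`MinimalOn.card_le_of_cycleGraph`).

Removal. The same extensions give a robust statement with polynomial constants. Let d = cεN and let
all degrees be at most about d. If every connected twin-free collection met on the way has order d
single or order d² pair extensions, growing them yields many bad lists, hence about N d^(u-1)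
minimal witnesses of some size u. Otherwise some set T has few extensions, and the vertices that
copy vertices of T form a part that is almost a blow-up and almost separated, so it can be split off
cheaply. Hence few witnesses imply closeness to a collection (`exists_close_collection`), and its
degrees can be lowered to ⌊d⌋ at small cost (`exists_lowDegree_collection`).

Testing. With θ = ε^(-1/4), five degree tests at the scales d θ^j, j ≤ 4, use about θ^6 = ε^(-3/2)
queries and detect excessive degrees unless these carry few edges. A second test queries all pairs
in a random sample of W blocks of about ε^(-1+1/W) vertices, so about ε^(-2+2/W) queries, and
rejects if the sample is not a collection; a second moment bound (`card_missing_le`) shows that it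
finds one of many witnesses. A far graph either fails a degree test, or keeps many witnesses after
its high-degree vertices are isolated (`exists_isTester`). For ε ≤ 1 the term ε^(-3/2) is dominated
by both claimed bounds. -/

namespace BlowUp
open scoped Classical

/-! ### Connected twin-free sets and the size of minimal witnesses. -/

section

variable {U V : Type*}

/-- The vertices of `S` induce a blow-up collection of `H` in `G`: `p` gives the part and `f` the
cluster of each vertex. -/
def CollectionOn (H : SimpleGraph U) (G : SimpleGraph V) (S : Finset V) : Prop :=
  ∃ (p : V → ℕ) (f : V → U), ∀ u ∈ S, ∀ v ∈ S, G.Adj u v ↔ p u = p v ∧ H.Adj (f u) (f v)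

/-- Every proper nonempty subset of the nonempty set `S` is joined to the rest of `S`. -/
def ConnectedOn (G : SimpleGraph V) (S : Finset V) : Prop :=
  S.Nonempty ∧ ∀ A ⊆ S, A.Nonempty → A ≠ S → ∃ a ∈ A, ∃ b ∈ S, b ∉ A ∧ G.Adj a b

/-- No two vertices of `S` have the same neighbours in `S`. -/
def TwinFreeOn (G : SimpleGraph V) (S : Finset V) : Prop :=
  ∀ x ∈ S, ∀ y ∈ S, (∀ z ∈ S, G.Adj x z ↔ G.Adj y z) → x = y

/-- `S` is a minimal set that does not induce a blow-up collection of `H`. -/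
def MinimalOn (H : SimpleGraph U) (G : SimpleGraph V) (S : Finset V) : Prop :=
  ¬ CollectionOn H G S ∧ ∀ S' ⊂ S, CollectionOn H G S'

/-- Part labels in ℕ, rather than in some `Fin k`, can be merged by arithmetic; finiteness of `V`
bounds the labels in use. -/
theorem isBlowUpCollection_iff [Finite V] {H : SimpleGraph U} {G : SimpleGraph V} :
    IsBlowUpCollection H G ↔
      ∃ (p : V → ℕ) (f : V → U), ∀ u v, G.Adj u v ↔ p u = p v ∧ H.Adj (f u) (f v) := by
  constructor
  · rintro ⟨k, p, hp, hcross⟩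
    choose f hf using hp
    refine ⟨fun v => p v, fun v => f (p v) ⟨v, rfl⟩, fun u v => ?_⟩
    by_cases h : p u = p v
    · have key := hf (p v) ⟨u, h⟩ ⟨v, rfl⟩
      -- Each `f i` lives on its own part, so the cluster of `u` must be transported along `p u = p
      -- v`.
      have e : ∀ i (hi : p u = i), f (p u) ⟨u, rfl⟩ = f i ⟨u, hi⟩ := by
        rintro i rfl
        rfl
      simp only [SimpleGraph.comap_adj, Function.Embedding.subtype_apply] at key
      simp only [e (p v) h, ← key, h, true_and]
    · have h' : ((p u : ℕ) = p v) ↔ False := by simpa [Fin.ext_iff] using h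
      simp only [h', false_and, iff_false]
      exact hcross u v h
  · rintro ⟨p, f, h⟩
    obtain ⟨k, hk⟩ := (Set.finite_range p).bddAbove
    have hk' : ∀ v, p v < k + 1 := fun v => Nat.lt_succ_of_le (hk ⟨v, rfl⟩)
    refine ⟨k + 1, fun v => ⟨p v, hk' v⟩, fun i => ⟨fun v => f v, ?_⟩, fun u v huv hadj => ?_⟩
    · rintro ⟨u, hu⟩ ⟨v, hv⟩
      have : p u = p v := by
        have := hu.trans hv.symm
        simpa [Fin.ext_iff] using this
      simp [h u v, this]
    · exact huv (by simpa [Fin.ext_iff] using ((h u v).1 hadj).1)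

theorem isBlowUpCollection_induce_iff [Nonempty U] {H : SimpleGraph U} {G : SimpleGraph V}
    {S : Finset V} : IsBlowUpCollection H (G.induce (S : Set V)) ↔ CollectionOn H G S := by
  rw [isBlowUpCollection_iff]
  constructor
  · rintro ⟨p, f, h⟩
    refine ⟨fun v => if hv : v ∈ S then p ⟨v, hv⟩ else 0,
      fun v => if hv : v ∈ S then f ⟨v, hv⟩ else Classical.arbitrary U, fun u hu v hv => ?_⟩
    have := h ⟨u, hu⟩ ⟨v, hv⟩
    simpa [hu, hv] using this
  · rintro ⟨p, f, h⟩
    exact ⟨fun v => p v, fun v => f v, fun u v => h u u.2 v v.2⟩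

theorem CollectionOn.mono {H : SimpleGraph U} {G : SimpleGraph V} {S T : Finset V}
    (h : CollectionOn H G S) (hT : T ⊆ S) : CollectionOn H G T := by
  obtain ⟨p, f, h⟩ := h
  exact ⟨p, f, fun u hu v hv => h u (hT hu) v (hT hv)⟩

theorem CollectionOn.congr {H : SimpleGraph U} {G G' : SimpleGraph V} {S : Finset V}
    (hG : ∀ u ∈ S, ∀ v ∈ S, G.Adj u v ↔ G'.Adj u v) (h : CollectionOn H G S) :
    CollectionOn H G' S := by
  obtain ⟨p, f, h⟩ := h
  exact ⟨p, f, fun u hu v hv => (hG u hu v hv).symm.trans (h u hu v hv)⟩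

theorem collectionOn_empty [Nonempty U] {H : SimpleGraph U} {G : SimpleGraph V} :
    CollectionOn H G ∅ :=
  ⟨fun _ => 0, fun _ => Classical.arbitrary U, by simp⟩

theorem isMinimalWitness_coe_iff [Nonempty U] {H : SimpleGraph U} {G : SimpleGraph V}
    {S : Finset V} : IsMinimalWitness H G (S : Set V) ↔ MinimalOn H G S := by
  unfold IsMinimalWitness MinimalOn
  rw [isBlowUpCollection_induce_iff]
  refine and_congr_right fun _ => ⟨fun h S' hS' => ?_, fun h S' hS' => ?_⟩
  · exact isBlowUpCollection_induce_iff.1 (h S' (by exact_mod_cast hS'))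
  · lift S' to Finset V using S.finite_toSet.subset hS'.subset
    exact isBlowUpCollection_induce_iff.2 (h S' (by exact_mod_cast hS'))

/-- No edge leaves a part, so a connected set lies in a single part and the part labels can be
dropped. -/
theorem CollectionOn.exists_blowUp {H : SimpleGraph U} {G : SimpleGraph V} {S : Finset V}
    (h : CollectionOn H G S) (hS : ConnectedOn G S) :
    ∃ f : V → U, ∀ u ∈ S, ∀ v ∈ S, G.Adj u v ↔ H.Adj (f u) (f v) := by
  obtain ⟨p, f, h⟩ := h
  obtain ⟨v₀, hv₀⟩ := hS.1
  have hall : S.filter (fun v => p v = p v₀) = S := by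
    by_contra hne
    obtain ⟨a, ha, b, hb, hbA, hab⟩ := hS.2 _ (Finset.filter_subset _ _)
      ⟨v₀, by simp [hv₀]⟩ hne
    simp only [Finset.mem_filter] at ha hbA
    exact hbA ⟨hb, by rw [← ((h a ha.1 b hb).1 hab).1, ha.2]⟩
  have hp : ∀ v ∈ S, p v = p v₀ := fun v hv => by
    rw [← hall] at hv
    exact (Finset.mem_filter.1 hv).2
  exact ⟨f, fun u hu v hv => by simp [h u hu v hv, hp u hu, hp v hv]⟩

/-- Vertices in the same cluster are twins. -/
theorem TwinFreeOn.injOn {H : SimpleGraph U} {G : SimpleGraph V} {S : Finset V}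
    (hS : TwinFreeOn G S) {f : V → U} (hf : ∀ u ∈ S, ∀ v ∈ S, G.Adj u v ↔ H.Adj (f u) (f v)) :
    Set.InjOn f S := fun x hx y hy hxy =>
  hS x hx y hy fun z hz => by rw [hf x hx z hz, hf y hy z hz, hxy]

theorem card_le_of_twinFreeOn [Fintype U] {H : SimpleGraph U} {G : SimpleGraph V} {S : Finset V}
    (h : CollectionOn H G S) (hc : ConnectedOn G S) (ht : TwinFreeOn G S) :
    S.card ≤ Fintype.card U := by
  obtain ⟨f, hf⟩ := h.exists_blowUp hc
  rw [← Finset.card_image_of_injOn (ht.injOn hf)]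
  exact Finset.card_le_univ _

theorem MinimalOn.nonempty [Nonempty U] {H : SimpleGraph U} {G : SimpleGraph V} {S : Finset V}
    (h : MinimalOn H G S) : S.Nonempty := by
  rw [Finset.nonempty_iff_ne_empty]
  rintro rfl
  exact h.1 collectionOn_empty

/-- If no edge crossed the cut, collections on its two sides, which exist by minimality, would
combine to one on `S`. -/
theorem MinimalOn.connectedOn [Nonempty U] {H : SimpleGraph U} {G : SimpleGraph V} {S : Finset V}
    (h : MinimalOn H G S) : ConnectedOn G S := by
  refine ⟨h.nonempty, fun A hA hne hAS => ?_⟩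
  by_contra! hcut
  obtain ⟨p, f, hpf⟩ := h.2 A (hA.ssubset_of_ne hAS)
  obtain ⟨p', f', hpf'⟩ := h.2 (S \ A) (Finset.sdiff_ssubset hA hne)
  -- Even and odd labels keep the parts of the two sides disjoint.
  refine h.1 ⟨fun v => if v ∈ A then 2 * p v else 2 * p' v + 1,
    fun v => if v ∈ A then f v else f' v, fun u hu v hv => ?_⟩
  by_cases huA : u ∈ A <;> by_cases hvA : v ∈ A
  · simp [huA, hvA, hpf u huA v hvA]
  · simp only [huA, hvA, if_true, if_false]
    refine ⟨fun hadj => (hcut u huA v hv hvA hadj).elim, fun h => by omega⟩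
  · simp only [huA, hvA, if_true, if_false]
    refine ⟨fun hadj => (hcut v hvA u hu huA hadj.symm).elim, fun h => by omega⟩
  · simp [huA, hvA, hpf' u (by simp [hu, huA]) v (by simp [hv, hvA])]

/-- A labelling of `S` without one of two twins extends to `S` by giving both the same label. -/
theorem MinimalOn.twinFreeOn {H : SimpleGraph U} {G : SimpleGraph V} {S : Finset V}
    (h : MinimalOn H G S) : TwinFreeOn G S := by
  intro x hx y hy hxy
  by_contra hne
  obtain ⟨p, f, hpf⟩ := h.2 (S.erase x) (Finset.erase_ssubset hx)
  have hr : ∀ v ∈ S, (if v = x then y else v) ∈ S.erase x := fun v hv => by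
    split_ifs with hvx
    · simp [hy, Ne.symm hne]
    · simp [hv, hvx]
  have hadj : ∀ v ∈ S, ∀ w ∈ S, G.Adj v w ↔ G.Adj (if v = x then y else v) w := fun v _ w hw => by
    split_ifs with hvx
    · rw [hvx, hxy w hw]
    · rfl
  refine h.1 ⟨fun v => p (if v = x then y else v), fun v => f (if v = x then y else v),
    fun u hu v hv => ?_⟩
  rw [hadj u hu v hv, G.adj_comm, hadj v hv _ (Finset.mem_of_mem_erase (hr u hu)), G.adj_comm]
  exact hpf _ (hr u hu) _ (hr v hv)

theorem exists_minimalOn_subset {H : SimpleGraph U} {G : SimpleGraph V} {S : Finset V}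
    (h : ¬ CollectionOn H G S) : ∃ M ⊆ S, MinimalOn H G M := by
  induction S using Finset.strongInduction with
  | H S ih =>
    by_cases hS : ∀ S' ⊂ S, CollectionOn H G S'
    · exact ⟨S, subset_rfl, h, hS⟩
    · push Not at hS
      obtain ⟨S', hS', hn⟩ := hS
      obtain ⟨M, hM, hmin⟩ := ih S' hS' hn
      exact ⟨M, hM.trans hS'.subset, hmin⟩

theorem connectedOn_singleton (G : SimpleGraph V) (v : V) : ConnectedOn G {v} := by
  refine ⟨Finset.singleton_nonempty v, fun A hA hne hAS => ?_⟩
  rcases Finset.subset_singleton_iff.1 hA with rfl | rfl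
  · simp at hne
  · exact (hAS rfl).elim

theorem ConnectedOn.insert {G : SimpleGraph V} {T : Finset V} (hT : ConnectedOn G T) {x z : V}
    (hz : z ∈ T) (hxz : G.Adj x z) : ConnectedOn G (insert x T) := by
  refine ⟨Finset.insert_nonempty _ _, fun A hA hne hAS => ?_⟩
  by_cases hTA : T ⊆ A
  · have hxA : x ∉ A := fun hx => hAS (hA.antisymm (Finset.insert_subset hx hTA))
    exact ⟨z, hTA hz, x, Finset.mem_insert_self _ _, hxA, hxz.symm⟩
  · by_cases hne' : (A ∩ T).Nonempty
    · obtain ⟨a, ha, b, hb, hbA, hab⟩ := hT.2 (A ∩ T) Finset.inter_subset_right hne'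
        (fun h => hTA (Finset.inter_eq_right.1 h))
      refine ⟨a, (Finset.mem_inter.1 ha).1, b, Finset.mem_insert_of_mem hb, fun h => hbA ?_, hab⟩
      exact Finset.mem_inter.2 ⟨h, hb⟩
    · rw [Finset.not_nonempty_iff_eq_empty] at hne'
      obtain ⟨a, ha⟩ := hne
      have hnot : ∀ b ∈ T, b ∉ A := fun b hb hbA => by
        have : b ∈ A ∩ T := Finset.mem_inter.2 ⟨hbA, hb⟩
        simp [hne'] at this
      have hax : a = x := by
        rcases Finset.mem_insert.1 (hA ha) with h | h
        · exact h
        · exact (hnot a h ha).elim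
      exact ⟨a, ha, z, Finset.mem_insert_of_mem hz, hnot z hz, hax ▸ hxz⟩

theorem ConnectedOn.exists_adj {G : SimpleGraph V} {T : Finset V} (hT : ConnectedOn G T)
    (h2 : 2 ≤ T.card) {y : V} (hy : y ∈ T) : ∃ z ∈ T, G.Adj y z := by
  obtain ⟨a, ha, b, hb, -, hab⟩ := hT.2 {y} (by simpa using hy) (Finset.singleton_nonempty y)
    (fun h => by rw [← h] at h2; simp at h2)
  rw [Finset.mem_singleton] at ha
  exact ⟨b, hb, ha ▸ hab⟩

theorem connectedOn_pair {G : SimpleGraph V} {v x : V} (h : G.Adj x v) :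
    ConnectedOn G {x, v} := (connectedOn_singleton G v).insert (Finset.mem_singleton_self v) h

theorem twinFreeOn_pair {G : SimpleGraph V} {v x : V} (h : G.Adj x v) : TwinFreeOn G {x, v} := by
  intro a ha b hb hab
  simp only [Finset.mem_insert, Finset.mem_singleton] at ha hb
  have h1 := hab x (by simp)
  have h2 := hab v (by simp)
  rcases ha with rfl | rfl <;> rcases hb with rfl | rfl <;> simp_all [G.adj_comm]

section Extension

variable {G : SimpleGraph V} {T : Finset V} {x x' y y' z : V}

theorem TwinFreeOn.insert (hT : TwinFreeOn G T)
    (hx : ∀ y ∈ T, ¬ ∀ z ∈ T, G.Adj x z ↔ G.Adj y z) : TwinFreeOn G (insert x T) := by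
  intro a ha b hb hab
  have hab' : ∀ z ∈ T, G.Adj a z ↔ G.Adj b z := fun z hz => hab z (Finset.mem_insert_of_mem hz)
  rcases Finset.mem_insert.1 ha with rfl | ha' <;> rcases Finset.mem_insert.1 hb with rfl | hb'
  · rfl
  · exact (hx b hb' hab').elim
  · exact (hx a ha' fun z hz => (hab' z hz).symm).elim
  · exact hT a ha' b hb' hab'

/-- If `x` and `x'` have the same neighbours in `T` as `y` and `y'`, but the adjacency of `x` and
`x'` differs from that of `y` and `y'`, then `T` can be extended by `x` and `x'`. -/
theorem extend_pair (hc : ConnectedOn G T) (hT : TwinFreeOn G T) (h2 : 2 ≤ T.card)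
    (hy : y ∈ T) (hy' : y' ∈ T) (hx : ∀ z ∈ T, G.Adj x z ↔ G.Adj y z)
    (hx' : ∀ z ∈ T, G.Adj x' z ↔ G.Adj y' z) (hne : ¬ (G.Adj x x' ↔ G.Adj y y')) :
    x ∉ T ∧ x' ∉ insert x T ∧ ConnectedOn G (insert x' (insert x T)) ∧
      TwinFreeOn G (insert x' (insert x T)) := by
  have hyx' : G.Adj y x' ↔ G.Adj y y' := by rw [G.adj_comm, hx' y hy, G.adj_comm]
  have hxy' : G.Adj x y' ↔ G.Adj y y' := hx y' hy'
  have hxT : x ∉ T := fun h => by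
    have := hT x h y hy hx
    subst this
    exact hne hyx'
  have hx'T : x' ∉ T := fun h => by
    have := hT x' h y' hy' hx'
    subst this
    exact hne hxy'
  have hxx' : x' ≠ x := by
    rintro rfl
    have : y = y' := hT y hy y' hy' fun z hz => by rw [← hx z hz, hx' z hz]
    subst this
    simp at hne
  obtain ⟨z, hz, hyz⟩ := hc.exists_adj h2 hy
  obtain ⟨z', hz', hyz'⟩ := hc.exists_adj h2 hy'
  refine ⟨hxT, by simp [hxx', hx'T],
    (hc.insert hz ((hx z hz).2 hyz)).insert (Finset.mem_insert_of_mem hz') ((hx' z' hz').2 hyz'),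
    ?_⟩
  intro a ha b hb hab
  have habT : ∀ z ∈ T, G.Adj a z ↔ G.Adj b z := fun z hz =>
    hab z (Finset.mem_insert_of_mem (Finset.mem_insert_of_mem hz))
  have habx := hab x (by simp)
  have habx' := hab x' (by simp)
  -- Inside the twin-free `T` only `y` can imitate `x`, and `x'` separates `x` from `y`. The next
  -- two claims are analogous.
  have aux : ∀ b ∈ T, (∀ z ∈ T, G.Adj x z ↔ G.Adj b z) → ¬ (G.Adj x x' ↔ G.Adj b x') :=
    fun b hb h h' => by
      have := hT b hb y hy fun z hz => by rw [← h z hz, hx z hz]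
      subst this
      exact hne (h'.trans hyx')
  have aux' : ∀ b ∈ T, (∀ z ∈ T, G.Adj x' z ↔ G.Adj b z) → ¬ (G.Adj x' x ↔ G.Adj b x) :=
    fun b hb h h' => by
      have := hT b hb y' hy' fun z hz => by rw [← h z hz, hx' z hz]
      subst this
      rw [G.adj_comm x' x, G.adj_comm b x] at h'
      exact hne (h'.trans hxy')
  have aux'' : (∀ z ∈ T, G.Adj x z ↔ G.Adj x' z) → (G.Adj x x ↔ G.Adj x' x) → False :=
    fun h h' => by
      have := hT y hy y' hy' fun z hz => by rw [← hx z hz, h z hz, hx' z hz]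
      subst this
      rw [G.adj_comm x' x] at h'
      exact hne (by simpa using h'.symm)
  simp only [Finset.mem_insert] at ha hb
  rcases ha with rfl | rfl | ha <;> rcases hb with rfl | rfl | hb
  · rfl
  · exact (aux'' (fun z hz => (habT z hz).symm) habx.symm).elim
  · exact (aux' b hb habT habx).elim
  · exact (aux'' habT habx).elim
  · rfl
  · exact (aux b hb habT habx').elim
  · exact (aux' a ha (fun z hz => (habT z hz).symm) habx.symm).elim
  · exact (aux a ha (fun z hz => (habT z hz).symm) habx'.symm).elim
  · exact hT a ha b hb habT

/-- If `x` has the same neighbours in `T` as `y`, and `z` is a neighbour of `x` without neighbours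
in `T`, then `T` can be extended by `x` and `z`. -/
theorem extend_pendant (hc : ConnectedOn G T) (hT : TwinFreeOn G T) (h2 : 2 ≤ T.card)
    (hy : y ∈ T) (hx : ∀ w ∈ T, G.Adj x w ↔ G.Adj y w) (hxz : G.Adj x z)
    (hz : ∀ w ∈ T, ¬ G.Adj z w) :
    x ∉ T ∧ z ∉ insert x T ∧ ConnectedOn G (insert z (insert x T)) ∧
      TwinFreeOn G (insert z (insert x T)) := by
  have hxT : x ∉ T := fun h => hz x h hxz.symm
  have hzT : z ∉ T := fun h => by
    obtain ⟨w, hw, hzw⟩ := hc.exists_adj h2 h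
    exact hz w hw hzw
  obtain ⟨w, hw, hyw⟩ := hc.exists_adj h2 hy
  refine ⟨hxT, by simp [hzT, hxz.ne'],
    (hc.insert hw ((hx w hw).2 hyw)).insert (Finset.mem_insert_self _ _) hxz.symm, ?_⟩
  have auxz : ∀ b ∈ insert x T, ∃ w ∈ T, G.Adj b w := fun b hb => by
    rcases Finset.mem_insert.1 hb with rfl | hb
    · exact ⟨w, hw, (hx w hw).2 hyw⟩
    · exact hc.exists_adj h2 hb
  have auxx : ∀ b ∈ T, (∀ w ∈ T, G.Adj x w ↔ G.Adj b w) → ¬ (G.Adj x z ↔ G.Adj b z) :=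
    fun b hb _ h' => hz b hb (h'.1 hxz).symm
  intro a ha b hb hab
  have habT : ∀ z ∈ T, G.Adj a z ↔ G.Adj b z := fun z hz =>
    hab z (Finset.mem_insert_of_mem (Finset.mem_insert_of_mem hz))
  have habz := hab z (by simp)
  rcases Finset.mem_insert.1 ha with rfl | ha' <;> rcases Finset.mem_insert.1 hb with rfl | hb'
  · rfl
  · obtain ⟨w, hw, hbw⟩ := auxz b hb'
    exact (hz w hw ((habT w hw).2 hbw)).elim
  · obtain ⟨w, hw, haw⟩ := auxz a ha'
    exact (hz w hw ((habT w hw).1 haw)).elim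
  · rcases Finset.mem_insert.1 ha' with rfl | ha'' <;>
      rcases Finset.mem_insert.1 hb' with rfl | hb''
    · rfl
    · exact (auxx b hb'' habT habz).elim
    · exact (auxx a ha'' (fun w hw => (habT w hw).symm) habz.symm).elim
    · exact hT a ha'' b hb'' habT

/-- A connected proper subset of a connected twin-free set can be extended inside it
in one of three ways. -/
theorem exists_extension {S : Finset V} (hcS : ConnectedOn G S) (hS : TwinFreeOn G S)
    (hTS : T ⊂ S) (hc : ConnectedOn G T) :
    (∃ x ∈ S, (∃ z ∈ T, G.Adj x z) ∧ ∀ y ∈ T, ¬ ∀ z ∈ T, G.Adj x z ↔ G.Adj y z) ∨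
    (∃ x ∈ S, ∃ x' ∈ S, ∃ y ∈ T, ∃ y' ∈ T, (∀ z ∈ T, G.Adj x z ↔ G.Adj y z) ∧
      (∀ z ∈ T, G.Adj x' z ↔ G.Adj y' z) ∧ ¬ (G.Adj x x' ↔ G.Adj y y')) ∨
    (∃ x ∈ S, ∃ z ∈ S, ∃ y ∈ T, (∀ w ∈ T, G.Adj x w ↔ G.Adj y w) ∧ G.Adj x z ∧
      ∀ w ∈ T, ¬ G.Adj z w) := by
  by_contra! hcon
  obtain ⟨h1, h2', h3⟩ := hcon
  -- `P` collects the vertices that copy some vertex of `T`. Without single and pendant extensions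
  -- no edge leaves `P`, so `P` is all of `S`.
  set P := S.filter (fun x => ∃ y ∈ T, ∀ z ∈ T, G.Adj x z ↔ G.Adj y z) with hP
  have hTP : T ⊆ P := fun y hy =>
    Finset.mem_filter.2 ⟨hTS.subset hy, y, hy, fun _ _ => Iff.rfl⟩
  have hPS : P = S := by
    by_contra hne
    obtain ⟨a, ha, b, hb, hbP, hab⟩ := hcS.2 P (Finset.filter_subset _ _) (hc.1.mono hTP) hne
    obtain ⟨haS, y, hy, hay⟩ := Finset.mem_filter.1 ha
    obtain ⟨w, hw, hbw⟩ := h3 a haS b hb y hy hay hab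
    obtain ⟨y', hy', h⟩ := h1 b hb ⟨w, hw, hbw⟩
    exact hbP (Finset.mem_filter.2 ⟨hb, y', hy', h⟩)
  obtain ⟨x, hxS, hxT⟩ := Finset.exists_of_ssubset hTS
  obtain ⟨y, hy, hxy⟩ := (Finset.mem_filter.1 (hPS ▸ hxS)).2
  -- Every `z` in `S` copies some `y'`, and without pair extensions `x` and `y` agree on it. So a
  -- vertex outside `T` would be a twin of `y`.
  refine hxT (hS x hxS y (hTS.subset hy) (fun z hz => ?_) ▸ hy)
  obtain ⟨y', hy', hzy'⟩ := (Finset.mem_filter.1 (hPS ▸ hz)).2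
  rw [G.adj_comm y z, hzy' y hy]
  rw [G.adj_comm y' y]
  exact h2' x hxS z hz y hy y' hy' hxy hzy'

end Extension

theorem ConnectedOn.exists_edge {G : SimpleGraph V} {S : Finset V} (hS : ConnectedOn G S)
    (h2 : 2 ≤ S.card) : ∃ x ∈ S, ∃ v ∈ S, G.Adj x v := by
  obtain ⟨v, hv⟩ := hS.1
  obtain ⟨z, hz, h⟩ := hS.exists_adj h2 hv
  exact ⟨v, hv, z, hz, h⟩

/-- A minimal witness with at least three vertices has a proper connected twin-free subset to
which no further proper extension is possible. -/
theorem MinimalOn.exists_maximal [Nonempty U] {H : SimpleGraph U} {G : SimpleGraph V}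
    {S : Finset V} (h : MinimalOn H G S) (h3 : 3 ≤ S.card) :
    ∃ T ⊂ S, ConnectedOn G T ∧ TwinFreeOn G T ∧ 2 ≤ T.card ∧
      ∀ T' ⊆ S, ConnectedOn G T' → TwinFreeOn G T' → T ⊂ T' → T' = S := by
  obtain ⟨x, hx, v, hv, hxv⟩ := h.connectedOn.exists_edge (by omega)
  obtain ⟨T, hT, hmax⟩ := Finset.exists_max_image
    (S.powerset.filter fun T => T ≠ S ∧ ConnectedOn G T ∧ TwinFreeOn G T ∧ 2 ≤ T.card)
    Finset.card ⟨{x, v}, by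
      have h2 : ({x, v} : Finset V).card = 2 := Finset.card_pair hxv.ne
      simp only [Finset.mem_filter, Finset.mem_powerset]
      refine ⟨by simp [Finset.insert_subset_iff, hx, hv], ?_, connectedOn_pair hxv,
        twinFreeOn_pair hxv, h2.ge⟩
      rintro rfl
      omega⟩
  simp only [Finset.mem_filter, Finset.mem_powerset] at hT hmax
  refine ⟨T, hT.1.ssubset_of_ne hT.2.1, hT.2.2.1, hT.2.2.2.1, hT.2.2.2.2, ?_⟩
  intro T' hT' hc ht hlt
  by_contra hne
  have := Finset.card_lt_card hlt
  have h' := hmax T' ⟨hT', hne, hc, ht, by omega⟩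
  omega

/-- A maximal proper connected twin-free subset `T` induces a collection, hence has at most h
vertices; its extension by one or two vertices must already be `S`. -/
theorem MinimalOn.card_le [Nonempty U] [Fintype U] {H : SimpleGraph U} {G : SimpleGraph V}
    {S : Finset V} (h : MinimalOn H G S) : S.card ≤ Fintype.card U + 2 := by
  by_cases h3 : S.card ≤ 2
  · omega
  obtain ⟨T, hTS, hc, ht, h2, hmax⟩ := h.exists_maximal (by omega)
  have hTU := card_le_of_twinFreeOn (h.2 T hTS) hc ht
  have key : ∀ x z : V, x ∉ T → z ∉ insert x T → x ∈ S → z ∈ S →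
      ConnectedOn G (insert z (insert x T)) → TwinFreeOn G (insert z (insert x T)) →
      S.card ≤ T.card + 2 := fun x z hx hz hxS hzS hc' ht' => by
    have hsub : insert z (insert x T) ⊆ S := by
      simp [Finset.insert_subset_iff, hxS, hzS, hTS.subset]
    rw [← hmax _ hsub hc' ht' (((Finset.ssubset_insert hx)).trans (Finset.ssubset_insert hz)),
      Finset.card_insert_of_notMem hz, Finset.card_insert_of_notMem hx]
  rcases exists_extension h.connectedOn h.twinFreeOn hTS hc with
    ⟨x, hx, ⟨z, hz, hxz⟩, hne⟩ | ⟨x, hx, x', hx', y, hy, y', hy', hxy, hxy', hne⟩ |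
    ⟨x, hx, z, hz, y, hy, hxy, hxz, hzT⟩
  · have hxT : x ∉ T := fun h => hne x h fun _ _ => Iff.rfl
    rw [← hmax _ (Finset.insert_subset hx hTS.subset) (hc.insert hz hxz) (ht.insert hne)
      (Finset.ssubset_insert hxT), Finset.card_insert_of_notMem hxT]
    omega
  · obtain ⟨ha, hb, hc', ht'⟩ := extend_pair hc ht h2 hy hy' hxy hxy' hne
    have := key x x' ha hb hx hx' hc' ht'
    omega
  · obtain ⟨ha, hb, hc', ht'⟩ := extend_pendant hc ht h2 hy hxy hxz hzT
    have := key x z ha hb hx hz hc' ht'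
    omega

/-- The complete graph on more vertices than `H` contains a minimal witness. -/
theorem minimalWitnessSizes_nonempty [Nonempty U] [Fintype U] (H : SimpleGraph U) :
    (minimalWitnessSizes H).Nonempty := by
  set n := Fintype.card U + 1 with hn
  have hbad : ¬ CollectionOn H (⊤ : SimpleGraph (Fin n)) Finset.univ := by
    rintro ⟨p, f, h⟩
    have hinj : Function.Injective f := fun a b hab => by
      by_contra hne
      have := ((h a (Finset.mem_univ _) b (Finset.mem_univ _)).1 hne).2
      rw [hab] at this
      exact H.irrefl this
    have := Fintype.card_le_of_injective f hinj
    simp [hn] at this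
  obtain ⟨M, -, hM⟩ := exists_minimalOn_subset hbad
  exact ⟨M.card, n, ⊤, M, isMinimalWitness_coe_iff.2 hM, Set.ncard_coe_finset M⟩

theorem exists_minimalOn_of_mem [Nonempty U] {H : SimpleGraph U} {n : ℕ}
    (hn : n ∈ minimalWitnessSizes H) :
    ∃ (N : ℕ) (G : SimpleGraph (Fin N)) (S : Finset (Fin N)), MinimalOn H G S ∧ S.card = n := by
  obtain ⟨N, G, S, hS, rfl⟩ := hn
  lift S to Finset (Fin N) using S.toFinite
  exact ⟨N, G, S, isMinimalWitness_coe_iff.1 hS, (Set.ncard_coe_finset S).symm⟩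

theorem exists_isGreatest_minimalWitnessSizes [Nonempty U] [Fintype U] (H : SimpleGraph U) :
    ∃ W ≤ Fintype.card U + 2, IsGreatest (minimalWitnessSizes H) W := by
  have hle : ∀ n ∈ minimalWitnessSizes H, n ≤ Fintype.card U + 2 := fun n hn => by
    obtain ⟨N, G, S, hS, rfl⟩ := exists_minimalOn_of_mem hn
    exact hS.card_le
  have hmem := Nat.sSup_mem (minimalWitnessSizes_nonempty H) ⟨_, hle⟩
  exact ⟨_, hle _ hmem, hmem, fun n hn => le_csSup ⟨_, hle⟩ hn⟩

end

/-! ### Induced paths and full cycles inside a witness against a cycle. -/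

section

variable {U V : Type*}

theorem ConnectedOn.image {G : SimpleGraph V} {T : Finset V} (hT : ConnectedOn G T) {e : V → V}
    (he : ∀ a ∈ T, ∀ b ∈ T, G.Adj (e a) (e b) ↔ G.Adj a b) : ConnectedOn G (T.image e) := by
  refine ⟨hT.1.image e, fun A hA hne hAT => ?_⟩
  obtain ⟨a, ha, b, hb, hbA, hab⟩ := hT.2 (T.filter fun v => e v ∈ A) (Finset.filter_subset _ _)
    (by
      obtain ⟨a, ha⟩ := hne
      obtain ⟨v, hv, rfl⟩ := Finset.mem_image.1 (hA ha)
      exact ⟨v, Finset.mem_filter.2 ⟨hv, ha⟩⟩)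
    (fun h => hAT (hA.antisymm fun w hw => by
      obtain ⟨v, hv, rfl⟩ := Finset.mem_image.1 hw
      rw [← h] at hv
      exact (Finset.mem_filter.1 hv).2))
  rw [Finset.mem_filter] at ha hbA
  exact ⟨e a, ha.2, e b, Finset.mem_image_of_mem e hb, fun h => hbA ⟨hb, h⟩,
    (he a ha.1 b hb).2 hab⟩

theorem TwinFreeOn.image {G : SimpleGraph V} {T : Finset V} (hT : TwinFreeOn G T) {e : V → V}
    (he : ∀ a ∈ T, ∀ b ∈ T, G.Adj (e a) (e b) ↔ G.Adj a b) : TwinFreeOn G (T.image e) := by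
  intro x hx y hy hxy
  obtain ⟨a, ha, rfl⟩ := Finset.mem_image.1 hx
  obtain ⟨b, hb, rfl⟩ := Finset.mem_image.1 hy
  rw [hT a ha b hb fun z hz => by
    rw [← he a ha z hz, ← he b hb z hz, hxy _ (Finset.mem_image_of_mem e hz)]]

/-- Coordinates on the cycle counted from a base point `c` turn adjacency into arithmetic of natural
numbers. -/
theorem cycleGraph_adj_add {t : ℕ} [NeZero t] (ht : 3 ≤ t) (c : Fin t) {i j : ℕ} (hi : i < t)
    (hj : j < t) : (SimpleGraph.cycleGraph t).Adj (c + Fin.ofNat t i) (c + Fin.ofNat t j) ↔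
      i + 1 = j ∨ j + 1 = i ∨ (i = 0 ∧ j + 1 = t) ∨ (j = 0 ∧ i + 1 = t) := by
  have aux : ∀ i j : ℕ, i < t → j < t →
      ((Fin.ofNat t i - Fin.ofNat t j).val = 1 ↔ j + 1 = i ∨ (i = 0 ∧ j + 1 = t)) := by
    intro i j hi hj
    rw [Fin.sub_def]
    simp only [Fin.val_ofNat, Nat.mod_eq_of_lt hi, Nat.mod_eq_of_lt hj]
    rcases le_or_gt j i with h | h
    · have : t - j + i = (i - j) + t := by omega
      rw [this, Nat.add_mod_right, Nat.mod_eq_of_lt (by omega)]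
      omega
    · rw [Nat.mod_eq_of_lt (by omega)]
      omega
  rw [SimpleGraph.cycleGraph_adj', add_sub_add_left_eq_sub, add_sub_add_left_eq_sub,
    aux i j hi hj, aux j i hj hi]
  omega

/-- `p 0, …, p n` are the vertices of an induced path of `G`. -/
structure IsPathMap (G : SimpleGraph V) (n : ℕ) (p : ℕ → V) : Prop where
  inj : ∀ i ≤ n, ∀ j ≤ n, p i = p j → i = j
  adj : ∀ i ≤ n, ∀ j ≤ n, G.Adj (p i) (p j) ↔ i + 1 = j ∨ j + 1 = i

theorem IsPathMap.connectedOn {G : SimpleGraph V} {n : ℕ} {p : ℕ → V} (h : IsPathMap G n p) :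
    ConnectedOn G ((Finset.range (n + 1)).image p) := by
  suffices ∀ m ≤ n, ConnectedOn G ((Finset.range (m + 1)).image p) from this n le_rfl
  intro m
  induction m with
  | zero => intro _; simpa using connectedOn_singleton G (p 0)
  | succ m ih =>
    intro hm
    rw [Finset.range_add_one, Finset.image_insert]
    exact (ih (by omega)).insert (Finset.mem_image_of_mem p (Finset.self_mem_range_succ m))
      ((h.adj _ hm _ (by omega)).2 (by omega))

theorem IsPathMap.card {G : SimpleGraph V} {n : ℕ} {p : ℕ → V} (h : IsPathMap G n p) :
    ((Finset.range (n + 1)).image p).card = n + 1 := by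
  rw [Finset.card_image_of_injOn, Finset.card_range]
  intro i hi j hj hij
  simp only [Finset.coe_range, Set.mem_Iio] at hi hj
  exact h.inj i (by omega) j (by omega) hij

theorem IsPathMap.mem_image {n : ℕ} {p : ℕ → V} {v : V} :
    v ∈ (Finset.range (n + 1)).image p ↔ ∃ i ≤ n, p i = v := by
  simp

/-- The bound on `n` excludes the path with three vertices, whose ends are twins. -/
theorem IsPathMap.twinFreeOn {G : SimpleGraph V} {n : ℕ} {p : ℕ → V} (h : IsPathMap G n p)
    (hn : 3 ≤ n) : TwinFreeOn G ((Finset.range (n + 1)).image p) := by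
  intro x hx y hy hxy
  obtain ⟨i, hi, rfl⟩ := mem_image.1 hx
  obtain ⟨j, hj, rfl⟩ := mem_image.1 hy
  have key : ∀ k ≤ n, (i + 1 = k ∨ k + 1 = i) ↔ (j + 1 = k ∨ k + 1 = j) := fun k hk => by
    rw [← h.adj i hi k hk, ← h.adj j hj k hk, hxy _ (mem_image.2 ⟨k, hk, rfl⟩)]
  congr 1
  have h1 := key (i - 1) (by omega)
  have h2 := key (j - 1) (by omega)
  rcases Nat.lt_or_ge i n with hi' | hi'
  · have h3 := key (i + 1) (by omega)
    rcases Nat.lt_or_ge j n with hj' | hj'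
    · have h4 := key (j + 1) (by omega)
      omega
    · omega
  · rcases Nat.lt_or_ge j n with hj' | hj'
    · have h4 := key (j + 1) (by omega)
      omega
    · omega

section Cycle

variable {t : ℕ} {G : SimpleGraph V} {S : Finset V}

/-- Cutting the cycle at cluster `c` leaves a path through the remaining clusters. Cluster `c` may
be empty or not: a set of t - 1 vertices gives the former, a full cycle the latter, where the vertex
`q` in it sees exactly the two ends. -/
theorem exists_isPathMap [NeZero t] (ht : 3 ≤ t) {T : Finset V} {f : V → Fin t}
    (hf : ∀ u ∈ T, ∀ v ∈ T, G.Adj u v ↔ (SimpleGraph.cycleGraph t).Adj (f u) (f v))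
    (hinj : Set.InjOn f T) (c : Fin t) (hc : ∀ d, d ≠ c → ∃ v ∈ T, f v = d) :
    ∃ p : ℕ → V, IsPathMap G (t - 2) p ∧
      (Finset.range (t - 2 + 1)).image p = T.filter (fun v => f v ≠ c) ∧
      (∀ v ∈ T, f v = c + Fin.ofNat t 1 → p 0 = v) ∧
      ∀ q ∈ T, f q = c → ∀ k ≤ t - 2, G.Adj q (p k) ↔ k = 0 ∨ k = t - 2 := by
  have hofNat : ∀ i j : ℕ, i < t → j < t → c + Fin.ofNat t i = c + Fin.ofNat t j → i = j := by
    intro i j hi hj h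
    have := congrArg Fin.val (add_left_cancel h)
    simpa [Fin.val_ofNat, Nat.mod_eq_of_lt hi, Nat.mod_eq_of_lt hj] using this
  have hc0 : c + Fin.ofNat t 0 = c := by simp
  have hne : ∀ i, i ≤ t - 2 → c + Fin.ofNat t (i + 1) ≠ c := fun i hi h => by
    have := hofNat (i + 1) 0 (by omega) (by omega) (h.trans hc0.symm)
    omega
  have hex : ∀ i : ℕ, ∃ v, i ≤ t - 2 → v ∈ T ∧ f v = c + Fin.ofNat t (i + 1) := fun i => by
    by_cases hi : i ≤ t - 2
    · obtain ⟨v, hv⟩ := hc _ (hne i hi)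
      exact ⟨v, fun _ => hv⟩
    · obtain ⟨v, hv⟩ := hc _ (hne 0 (by omega))
      exact ⟨v, fun h => (hi h).elim⟩
  choose p hp using hex
  refine ⟨p, ⟨fun i hi j hj hij => ?_, fun i hi j hj => ?_⟩, ?_, fun v hv hvc => ?_,
    fun q hq hqc k hk => ?_⟩
  · have := hofNat (i + 1) (j + 1) (by omega) (by omega) (by rw [← (hp i hi).2, ← (hp j hj).2, hij])
    omega
  · rw [hf _ (hp i hi).1 _ (hp j hj).1, (hp i hi).2, (hp j hj).2,
      cycleGraph_adj_add ht c (by omega) (by omega)]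
    omega
  · ext v
    rw [IsPathMap.mem_image, Finset.mem_filter]
    constructor
    · rintro ⟨i, hi, rfl⟩
      exact ⟨(hp i hi).1, (hp i hi).2 ▸ hne i hi⟩
    · rintro ⟨hv, hvc⟩
      have hval : f v = c + Fin.ofNat t (f v - c).val := by
        rw [Fin.ofNat_val_eq_self, add_sub_cancel]
      have hpos : (f v - c).val ≠ 0 := fun h => hvc (by rw [hval, h, hc0])
      have hlt := (f v - c).isLt
      refine ⟨(f v - c).val - 1, by omega, ?_⟩
      have h' := hp ((f v - c).val - 1) (by omega)
      refine hinj h'.1 hv ?_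
      rw [h'.2, hval]
      congr 2
      rw [add_sub_cancel_left]
      simp only [Fin.val_ofNat]
      rw [Nat.mod_eq_of_lt hlt]
      omega
  · refine hinj (hp 0 (by omega)).1 hv ?_
    rw [(hp 0 (by omega)).2, hvc]
  · rw [hf _ hq _ (hp k hk).1, hqc, (hp k hk).2]
    have := cycleGraph_adj_add ht c (i := 0) (j := k + 1) (by omega) (by omega)
    rw [hc0] at this
    rw [this]
    omega

/-- The injection into the t-cycle is a bijection, so each vertex inherits degree two. -/
theorem card_filter_adj_eq_two (ht : 3 ≤ t) {R : Finset V}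
    (hcol : CollectionOn (SimpleGraph.cycleGraph t) G R) (hc : ConnectedOn G R)
    (htw : TwinFreeOn G R) (hcard : R.card = t) {v : V} (hv : v ∈ R) :
    (R.filter (G.Adj v)).card = 2 := by
  obtain ⟨f, hf⟩ := hcol.exists_blowUp hc
  have hinj := htw.injOn hf
  have himg : R.image f = Finset.univ :=
    Finset.eq_univ_of_card _ (by rw [Finset.card_image_of_injOn hinj, hcard, Fintype.card_fin])
  obtain ⟨s, rfl⟩ : ∃ s, t = s + 3 := ⟨t - 3, by omega⟩
  have h2 : ((SimpleGraph.cycleGraph (s + 3)).neighborFinset (f v)).card = 2 := by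
    rw [SimpleGraph.card_neighborFinset_eq_degree, SimpleGraph.cycleGraph_degree_three_le]
  rw [← h2, ← Finset.card_image_of_injOn (hinj.mono (s₁ := (R.filter (G.Adj v) : Finset V))
    (by intro x; simp +contextual))]
  congr 1
  ext d
  simp only [Finset.mem_image, Finset.mem_filter, SimpleGraph.mem_neighborFinset]
  constructor
  · rintro ⟨a, ⟨ha, hva⟩, rfl⟩
    exact (hf v hv a ha).1 hva
  · intro hd
    obtain ⟨a, ha, rfl⟩ := Finset.mem_image.1 (himg ▸ Finset.mem_univ d)
    exact ⟨a, ⟨ha, (hf v hv a ha).2 hd⟩, rfl⟩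

/-- The path together with `z` has only t vertices, so it is a proper subset of `S` and induces a
collection. If `z` has a neighbour on the path and copies no path vertex, the union is connected and
twin-free, hence a t-cycle that `z` closes up. This restriction is the source of all later
contradictions for cycles. -/
theorem MinimalOn.path_neighbors (ht : 8 ≤ t)
    (h : MinimalOn (SimpleGraph.cycleGraph t) G S) (hS : t < S.card) {p : ℕ → V}
    (hp : IsPathMap G (t - 2) p) (hpS : ∀ i ≤ t - 2, p i ∈ S) {z : V} (hz : z ∈ S)
    (hzp : ∀ i ≤ t - 2, p i ≠ z) :
    (∀ k ≤ t - 2, ¬ G.Adj z (p k)) ∨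
    (∃ l ≤ t - 2, ∀ k ≤ t - 2, G.Adj z (p k) ↔ l + 1 = k ∨ k + 1 = l) ∨
    (∀ k ≤ t - 2, G.Adj z (p k) ↔ k = 0 ∨ k = t - 2) := by
  by_contra! hcon
  obtain ⟨⟨k₀, hk₀, hzk₀⟩, htwin, hends⟩ := hcon
  set T := (Finset.range (t - 2 + 1)).image p with hT
  have hzT : z ∉ T := fun h => by
    obtain ⟨i, hi, h⟩ := IsPathMap.mem_image.1 h
    exact hzp i hi h
  have hmem : ∀ k ≤ t - 2, p k ∈ T := fun k hk => IsPathMap.mem_image.2 ⟨k, hk, rfl⟩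
  have hcard : (insert z T).card = t := by
    rw [Finset.card_insert_of_notMem hzT, hp.card]
    omega
  have hsub : insert z T ⊆ S := by
    refine Finset.insert_subset hz fun v hv => ?_
    obtain ⟨i, hi, rfl⟩ := IsPathMap.mem_image.1 hv
    exact hpS i hi
  have hss : insert z T ⊂ S := hsub.ssubset_of_ne fun he => by rw [← he] at hS; omega
  have hc : ConnectedOn G (insert z T) := hp.connectedOn.insert (hmem k₀ hk₀) hzk₀
  have htf : TwinFreeOn G (insert z T) := by
    refine (hp.twinFreeOn (by omega)).insert fun y hy hzy => ?_
    obtain ⟨l, hl, rfl⟩ := IsPathMap.mem_image.1 hy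
    obtain ⟨k, hk, hne⟩ := htwin l hl
    have := (hzy (p k) (hmem k hk)).trans (hp.adj l hl k hk)
    tauto
  have hdeg := fun v hv => card_filter_adj_eq_two (v := v) (by omega) (h.2 _ hss) hc htf hcard hv
  -- A path vertex with at most one neighbour on the path needs `z` as its second neighbour.
  have hend : ∀ k ≤ t - 2, ∀ m ≤ t - 2, (∀ j ≤ t - 2, G.Adj (p k) (p j) → j = m) →
      G.Adj z (p k) := by
    intro k hk m hm hone
    by_contra hnadj
    have hsub' : (insert z T).filter (G.Adj (p k)) ⊆ {p m} := by
      intro v hv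
      obtain ⟨hv, hkv⟩ := Finset.mem_filter.1 hv
      rcases Finset.mem_insert.1 hv with rfl | hv
      · exact (hnadj hkv.symm).elim
      · obtain ⟨j, hj, rfl⟩ := IsPathMap.mem_image.1 hv
        simp [hone j hj hkv]
    have := Finset.card_le_card hsub'
    rw [hdeg (p k) (Finset.mem_insert_of_mem (hmem k hk)), Finset.card_singleton] at this
    omega
  have hz0 : G.Adj z (p 0) := hend 0 (by omega) 1 (by omega) fun j hj hadj => by
    rw [hp.adj 0 (by omega) j hj] at hadj
    omega
  have hzn : G.Adj z (p (t - 2)) := hend (t - 2) le_rfl (t - 3) (by omega) fun j hj hadj => by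
    rw [hp.adj _ le_rfl j hj] at hadj
    omega
  have hpair : ({p 0, p (t - 2)} : Finset V) = (insert z T).filter (G.Adj z) := by
    refine Finset.eq_of_subset_of_card_le ?_ ?_
    · intro v hv
      simp only [Finset.mem_insert, Finset.mem_singleton] at hv
      rcases hv with rfl | rfl
      · exact Finset.mem_filter.2 ⟨Finset.mem_insert_of_mem (hmem 0 (by omega)), hz0⟩
      · exact Finset.mem_filter.2 ⟨Finset.mem_insert_of_mem (hmem _ le_rfl), hzn⟩
    · rw [hdeg z (Finset.mem_insert_self _ _), Finset.card_pair]
      intro he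
      have := hp.inj 0 (by omega) _ le_rfl he
      omega
  obtain ⟨k, hk, hne⟩ := hends
  have hiff : G.Adj z (p k) ↔ k = 0 ∨ k = t - 2 := by
    constructor
    · intro hadj
      have : p k ∈ ({p 0, p (t - 2)} : Finset V) := by
        rw [hpair]
        exact Finset.mem_filter.2 ⟨Finset.mem_insert_of_mem (hmem k hk), hadj⟩
      simp only [Finset.mem_insert, Finset.mem_singleton] at this
      exact this.imp (hp.inj k hk 0 (by omega)) (hp.inj k hk _ le_rfl)
    · rintro (rfl | rfl) <;> assumption
  tauto

end Cycle

end

/-! ### Exchanging vertices of an induced path. -/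

section

variable {U V : Type*}

section Cycle

variable {t : ℕ} {G : SimpleGraph V} {S : Finset V}

/-- A vertex with a single neighbour on the path must copy an end, so that neighbour is next to an
end. -/
theorem path_arith₁ {n i : ℕ} (hn : 6 ≤ n) (hi : i ≤ n)
    (h : (∀ k ≤ n, ¬ k = i) ∨ (∃ l ≤ n, ∀ k ≤ n, k = i ↔ l + 1 = k ∨ k + 1 = l) ∨
      (∀ k ≤ n, k = i ↔ k = 0 ∨ k = n)) : i = 1 ∨ i + 1 = n := by
  rcases h with h | ⟨l, hl, h⟩ | h
  · exact (h i hi rfl).elim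
  · have h1 := h (l - 1) (by omega)
    rcases Nat.lt_or_ge l n with hl' | hl'
    · have h2 := h (l + 1) (by omega)
      omega
    · omega
  · have h1 := h 0 (by omega)
    have h2 := h n le_rfl
    omega

/-- `E` is the neighbourhood of position `j` with the membership of `i` flipped. For `E` to be
admissible, up to reversal, either j = 0 and the flip leaves nothing or {1, 3}, or j = 2 and it
leaves {1}; the two ends alone never occur. -/
theorem path_arith₂ {n i j : ℕ} (hn : 6 ≤ n) (hi : i ≤ n) (hj : j ≤ n) {E : ℕ → Prop}
    (hE : ∀ k ≤ n, E k ↔ ¬ ((k = i) ↔ (j + 1 = k ∨ k + 1 = j)))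
    (h : (∀ k ≤ n, ¬ E k) ∨ (∃ l ≤ n, ∀ k ≤ n, E k ↔ l + 1 = k ∨ k + 1 = l) ∨
      (∀ k ≤ n, E k ↔ k = 0 ∨ k = n)) :
    (j = 0 ∧ (i = 1 ∨ i = 3)) ∨ (j = 2 ∧ i = 3) ∨ (j = n ∧ (i + 1 = n ∨ i + 3 = n)) ∨
      (j + 2 = n ∧ i + 3 = n) := by
  rcases h with h | ⟨l, hl, h⟩ | h
  · have h' : ∀ k ≤ n, (k = i) ↔ (j + 1 = k ∨ k + 1 = j) := fun k hk => by
      have := h k hk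
      rw [hE k hk] at this
      tauto
    have h1 := h' (j - 1) (by omega)
    rcases Nat.lt_or_ge j n with hj' | hj'
    · have h2 := h' (j + 1) (by omega)
      omega
    · omega
  · have h' : ∀ k ≤ n, ¬ ((k = i) ↔ (j + 1 = k ∨ k + 1 = j)) ↔ (l + 1 = k ∨ k + 1 = l) :=
      fun k hk => (hE k hk).symm.trans (h k hk)
    have h1 := h' (j - 1) (by omega)
    have h2 := h' (l - 1) (by omega)
    have h3 := h' i hi
    have h4 := h' (j + 1)
    have h5 := h' (l + 1)
    clear h' h hE
    grind
  · have h' : ∀ k ≤ n, ¬ ((k = i) ↔ (j + 1 = k ∨ k + 1 = j)) ↔ (k = 0 ∨ k = n) :=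
      fun k hk => (hE k hk).symm.trans (h k hk)
    have h1 := h' (j - 1) (by omega)
    have h2 := h' 0 (by omega)
    have h3 := h' n le_rfl
    have h5 := h' i hi
    rcases Nat.lt_or_ge j n with hj' | hj'
    · have h4 := h' (j + 1) (by omega)
      omega
    · omega

/-- Replacing a vertex of an induced path by a vertex with the same neighbours on it. -/
theorem IsPathMap.update {n : ℕ} {p : ℕ → V} (hp : IsPathMap G n p) {i : ℕ} (hi : i ≤ n) {x : V}
    (hx : ∀ k ≤ n, p k ≠ x) (hxi : ∀ k ≤ n, G.Adj x (p k) ↔ i + 1 = k ∨ k + 1 = i) :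
    IsPathMap G n (Function.update p i x) := by
  refine ⟨fun a ha b hb hab => ?_, fun a ha b hb => ?_⟩
  · by_cases hai : a = i <;> by_cases hbi : b = i
    · omega
    · subst hai
      simp only [Function.update_self, Function.update_of_ne hbi] at hab
      exact (hx b hb hab.symm).elim
    · subst hbi
      simp only [Function.update_self, Function.update_of_ne hai] at hab
      exact (hx a ha hab).elim
    · simp only [Function.update_of_ne hai, Function.update_of_ne hbi] at hab
      exact hp.inj a ha b hb hab
  · by_cases hai : a = i <;> by_cases hbi : b = i
    · subst hai hbi
      simp
    · subst hai
      simp only [Function.update_self, Function.update_of_ne hbi]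
      rw [hxi b hb]
    · subst hbi
      simp only [Function.update_self, Function.update_of_ne hai]
      rw [G.adj_comm, hxi a ha]
      omega
    · simp only [Function.update_of_ne hai, Function.update_of_ne hbi]
      exact hp.adj a ha b hb

/-- A shifted path: `z`, `x`, followed by `p 2, …, p n`. -/
theorem IsPathMap.update_update {n : ℕ} {p : ℕ → V} (hp : IsPathMap G n p) {x z : V} (hn : 3 ≤ n)
    (hx : ∀ k ≤ n, p k ≠ x) (hz : ∀ k ≤ n, p k ≠ z) (hxi : ∀ k ≤ n, G.Adj x (p k) ↔ k = 0 ∨ k = 2)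
    (hzk : ∀ k ≤ n, ¬ G.Adj z (p k)) (hxz : G.Adj x z) :
    IsPathMap G n (Function.update (Function.update p 1 x) 0 z) := by
  have h1 := hp.update (i := 1) (by omega) hx fun k hk => by rw [hxi k hk]; omega
  refine ⟨fun a ha b hb hab => ?_, fun a ha b hb => ?_⟩
  · have hz' : ∀ k ≤ n, Function.update p 1 x k ≠ z := fun k hk => by
      by_cases hk1 : k = 1
      · rw [hk1, Function.update_self]
        exact hxz.ne
      · rw [Function.update_of_ne hk1]
        exact hz k hk
    by_cases ha0 : a = 0 <;> by_cases hb0 : b = 0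
    · omega
    · subst ha0
      simp only [Function.update_self, Function.update_of_ne hb0] at hab
      exact (hz' b hb hab.symm).elim
    · subst hb0
      simp only [Function.update_self, Function.update_of_ne ha0] at hab
      exact (hz' a ha hab).elim
    · rw [Function.update_of_ne ha0, Function.update_of_ne hb0] at hab
      exact h1.inj a ha b hb hab
  · have hz' : ∀ k ≤ n, k ≠ 0 → (G.Adj z (Function.update p 1 x k) ↔ k = 1) := fun k hk h0 => by
      by_cases hk1 : k = 1
      · simp [hk1, hxz.symm]
      · rw [Function.update_of_ne hk1]
        simp [hzk k hk, hk1]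
    by_cases ha0 : a = 0 <;> by_cases hb0 : b = 0
    · subst ha0 hb0
      simp
    · subst ha0
      rw [Function.update_self, Function.update_of_ne hb0, hz' b hb hb0]
      omega
    · subst hb0
      rw [Function.update_self, Function.update_of_ne ha0, G.adj_comm, hz' a ha ha0]
      omega
    · rw [Function.update_of_ne ha0, Function.update_of_ne hb0]
      exact h1.adj a ha b hb

theorem IsPathMap.reverse {n : ℕ} {p : ℕ → V} (hp : IsPathMap G n p) :
    IsPathMap G n (fun k => p (n - k)) := by
  refine ⟨fun a ha b hb hab => ?_, fun a ha b hb => ?_⟩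
  · have := hp.inj _ (by omega) _ (by omega) hab
    omega
  · rw [hp.adj _ (by omega) _ (by omega)]
    omega

/-- Rerouting the path as z, x, p 2, … frees `p 1`, which then sees only position 2. That is not
next to an end of so long a path. -/
theorem MinimalOn.path_pendant_one (ht : 8 ≤ t)
    (h : MinimalOn (SimpleGraph.cycleGraph t) G S) (hS : t < S.card) {p : ℕ → V}
    (hp : IsPathMap G (t - 2) p) (hpS : ∀ i ≤ t - 2, p i ∈ S) {x z : V} (hxS : x ∈ S) (hzS : z ∈ S)
    (hx : ∀ k ≤ t - 2, p k ≠ x) (hz : ∀ k ≤ t - 2, p k ≠ z)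
    (hxi : ∀ k ≤ t - 2, G.Adj x (p k) ↔ 1 + 1 = k ∨ k + 1 = 1)
    (hzk : ∀ k ≤ t - 2, ¬ G.Adj z (p k)) (hxz : G.Adj x z) : False := by
  have hp' := hp.update_update (by omega) hx hz (fun k hk => by rw [hxi k hk]; omega) hzk hxz
  have hval : ∀ k, Function.update (Function.update p 1 x) 0 z k =
      if k = 0 then z else if k = 1 then x else p k := fun k => by
    simp [Function.update_apply]
  have hne : ∀ i ≤ t - 2, Function.update (Function.update p 1 x) 0 z i ≠ p 1 := fun i hi => by
    rw [hval]
    split_ifs with h0 h1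
    · exact (hz 1 (by omega)).symm
    · exact (hx 1 (by omega)).symm
    · intro he
      exact h1 (hp.inj i hi 1 (by omega) he)
  have key := h.path_neighbors ht hS hp' (fun i hi => by
    rw [hval]
    split_ifs
    exacts [hzS, hxS, hpS i hi]) (hpS 1 (by omega)) hne
  have hiff : ∀ k ≤ t - 2, G.Adj (p 1) (Function.update (Function.update p 1 x) 0 z k) ↔ k = 2 := by
    intro k hk
    rw [hval]
    split_ifs with h0 h1
    · rw [G.adj_comm]
      simp only [hzk 1 (by omega), false_iff]
      omega
    · rw [G.adj_comm, hxi 1 (by omega)]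
      omega
    · rw [hp.adj 1 (by omega) k hk]
      omega
  have := path_arith₁ (n := t - 2) (i := 2) (by omega) (by omega) (by
    rcases key with h | ⟨l, hl, h⟩ | h
    · exact Or.inl fun k hk => by rw [← hiff k hk]; exact h k hk
    · exact Or.inr (Or.inl ⟨l, hl, fun k hk => by rw [← hiff k hk]; exact h k hk⟩)
    · exact Or.inr (Or.inr fun k hk => by rw [← hiff k hk]; exact h k hk))
  omega

/-- After `x` replaces `p i`, the vertex `z` sees only position `i`, so `i` is next to an end;
reversing the path reduces to i = 1. -/
theorem MinimalOn.path_pendant (ht : 8 ≤ t)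
    (h : MinimalOn (SimpleGraph.cycleGraph t) G S) (hS : t < S.card) {p : ℕ → V}
    (hp : IsPathMap G (t - 2) p) (hpS : ∀ i ≤ t - 2, p i ∈ S) {x z : V} (hxS : x ∈ S) (hzS : z ∈ S)
    (hx : ∀ k ≤ t - 2, p k ≠ x) (hz : ∀ k ≤ t - 2, p k ≠ z) {i : ℕ} (hi : i ≤ t - 2)
    (hxi : ∀ k ≤ t - 2, G.Adj x (p k) ↔ i + 1 = k ∨ k + 1 = i)
    (hzk : ∀ k ≤ t - 2, ¬ G.Adj z (p k)) (hxz : G.Adj x z) : False := by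
  have hp' := hp.update hi hx hxi
  have hiff : ∀ k ≤ t - 2, G.Adj z (Function.update p i x k) ↔ k = i := fun k hk => by
    by_cases hki : k = i
    · simp [hki, hxz.symm]
    · rw [Function.update_of_ne hki]
      simp [hki, hzk k hk]
  have key := h.path_neighbors ht hS hp' (fun k hk => by
    rw [Function.update_apply]
    split_ifs
    exacts [hxS, hpS k hk]) hzS (fun k hk => by
    rw [Function.update_apply]
    split_ifs
    exacts [hxz.ne, hz k hk])
  have := path_arith₁ (n := t - 2) (i := i) (by omega) hi (by
    rcases key with h | ⟨l, hl, h⟩ | h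
    · exact Or.inl fun k hk => by rw [← hiff k hk]; exact h k hk
    · exact Or.inr (Or.inl ⟨l, hl, fun k hk => by rw [← hiff k hk]; exact h k hk⟩)
    · exact Or.inr (Or.inr fun k hk => by rw [← hiff k hk]; exact h k hk))
  rcases this with rfl | hi'
  · exact h.path_pendant_one ht hS hp hpS hxS hzS hx hz hxi hzk hxz
  · refine h.path_pendant_one ht hS hp.reverse (fun k hk => hpS _ (by omega)) hxS hzS
      (fun k hk => hx _ (by omega)) (fun k hk => hz _ (by omega)) (fun k hk => ?_)
      (fun k hk => hzk _ (by omega)) hxz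
    rw [hxi _ (by omega)]
    omega

/-- After `x` replaces `p i`, the neighbourhood of `z` is that of position `j` flipped at `i`, which
leaves few possibilities for (i, j). -/
theorem MinimalOn.path_pair (ht : 8 ≤ t)
    (h : MinimalOn (SimpleGraph.cycleGraph t) G S) (hS : t < S.card) {p : ℕ → V}
    (hp : IsPathMap G (t - 2) p) (hpS : ∀ i ≤ t - 2, p i ∈ S) {x z : V} (hxS : x ∈ S) (hzS : z ∈ S)
    (hx : ∀ k ≤ t - 2, p k ≠ x) (hz : ∀ k ≤ t - 2, p k ≠ z) (hne : x ≠ z) {i j : ℕ}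
    (hi : i ≤ t - 2) (hj : j ≤ t - 2)
    (hxi : ∀ k ≤ t - 2, G.Adj x (p k) ↔ i + 1 = k ∨ k + 1 = i)
    (hzj : ∀ k ≤ t - 2, G.Adj z (p k) ↔ j + 1 = k ∨ k + 1 = j)
    (hxz : ¬ (G.Adj x z ↔ i + 1 = j ∨ j + 1 = i)) : False := by
  have aux : ∀ {x z : V} {i j : ℕ}, x ∈ S → z ∈ S → (∀ k ≤ t - 2, p k ≠ x) →
      (∀ k ≤ t - 2, p k ≠ z) → x ≠ z → i ≤ t - 2 → j ≤ t - 2 →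
      (∀ k ≤ t - 2, G.Adj x (p k) ↔ i + 1 = k ∨ k + 1 = i) →
      (∀ k ≤ t - 2, G.Adj z (p k) ↔ j + 1 = k ∨ k + 1 = j) →
      ¬ (G.Adj x z ↔ i + 1 = j ∨ j + 1 = i) →
      (j = 0 ∧ (i = 1 ∨ i = 3)) ∨ (j = 2 ∧ i = 3) ∨
        (j = t - 2 ∧ (i + 1 = t - 2 ∨ i + 3 = t - 2)) ∨ (j + 2 = t - 2 ∧ i + 3 = t - 2) := by
    intro x z i j hxS hzS hx hz hne hi hj hxi hzj hxz
    have key := h.path_neighbors ht hS (hp.update hi hx hxi) (fun k hk => by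
      rw [Function.update_apply]
      split_ifs
      exacts [hxS, hpS k hk]) hzS (fun k hk => by
      rw [Function.update_apply]
      split_ifs
      exacts [hne, hz k hk])
    refine path_arith₂ (by omega) hi hj (fun k hk => ?_) key
    by_cases hki : k = i
    · subst hki
      rw [Function.update_self, G.adj_comm z x]
      rw [or_comm (a := j + 1 = k)]
      simp only [true_iff]
      exact not_iff_not.1 (by rw [not_not]; exact not_iff.1 hxz)
    · rw [Function.update_of_ne hki, hzj k hk]
      simp only [hki, false_iff, not_not]
  have h1 := aux hxS hzS hx hz hne hi hj hxi hzj hxz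
  -- The roles of `x` and `z` are symmetric, and since t - 2 ≥ 6 no pair (i, j) is possible in both
  -- orders.
  have h2 := aux hzS hxS hz hx hne.symm hj hi hzj hxi (by
    rw [G.adj_comm, or_comm]
    exact hxz)
  omega

end Cycle

end

/-! ### Witnesses against a long cycle have at most t vertices. -/

section

variable {U V : Type*}

section Cycle

variable {t : ℕ} {G : SimpleGraph V} {S T : Finset V}

theorem card_filter_adj_replace {T : Finset V} {x y z : V} (hx : x ∉ T) (hy : y ∈ T) :
    ((insert x (T.erase y)).filter (G.Adj z)).card + (if G.Adj z y then 1 else 0) =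
      (T.filter (G.Adj z)).card + (if G.Adj z x then 1 else 0) := by
  have hx' : x ∉ T.erase y := fun h => hx (Finset.mem_of_mem_erase h)
  rw [Finset.card_filter, Finset.card_filter, Finset.sum_insert hx', add_assoc,
    Finset.sum_erase_add _ _ hy, add_comm]

theorem image_replace {T : Finset V} {x y : V} (hy : y ∈ T) :
    T.image (fun v => if v = y then x else v) = insert x (T.erase y) := by
  ext v
  simp only [Finset.mem_image, Finset.mem_insert, Finset.mem_erase]
  constructor
  · rintro ⟨a, ha, rfl⟩
    split_ifs with h <;> simp_all
  · rintro (rfl | ⟨h, hv⟩)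
    · exact ⟨y, hy, by simp⟩
    · exact ⟨v, hv, by simp [h]⟩

theorem adj_replace {T : Finset V} {x y : V} (hxy : ∀ w ∈ T, G.Adj x w ↔ G.Adj y w) :
    ∀ a ∈ T, ∀ b ∈ T, G.Adj (if a = y then x else a) (if b = y then x else b) ↔ G.Adj a b := by
  intro a ha b hb
  split_ifs with h1 h2 h2
  · simp [h1, h2]
  · rw [h1, hxy b hb]
  · rw [h2, G.adj_comm, hxy a ha, G.adj_comm]
  · rfl

/-- A vertex set inducing the full cycle, together with two further vertices. -/
theorem MinimalOn.false_of_cycle_add_two (ht : 3 ≤ t)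
    (h : MinimalOn (SimpleGraph.cycleGraph t) G S) (hS : S.card = t + 2) (hT : T ⊆ S)
    (hTc : ConnectedOn G T) (hTt : TwinFreeOn G T) (hcard : T.card = t) {x y z : V} (hxS : x ∈ S)
    (hzS : z ∈ S) (hxT : x ∉ T) (hzT : z ∉ T) (hxz : x ≠ z) (hy : y ∈ T)
    (hxy : ∀ w ∈ T, G.Adj x w ↔ G.Adj y w)
    (hz : ((T.filter (G.Adj z)).card = 2 ∧ ¬ (G.Adj z x ↔ G.Adj z y)) ∨
      ((T.filter (G.Adj z)).card = 0 ∧ G.Adj z x)) : False := by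
  -- Exchanging `y` for its copy `x` gives another t-cycle, on which `z` has one neighbour more or
  -- fewer: 1 or 3 instead of 2, or 1 instead of 0.
  set T₁ := insert x (T.erase y) with hT₁
  have hcard₁ : T₁.card = t := by
    rw [hT₁, Finset.card_insert_of_notMem (fun h => hxT (Finset.mem_of_mem_erase h)),
      Finset.card_erase_of_mem hy, hcard]
    omega
  have hc₁ : ConnectedOn G T₁ := by
    rw [hT₁, ← image_replace hy]
    exact hTc.image (adj_replace hxy)
  have ht₁ : TwinFreeOn G T₁ := by
    rw [hT₁, ← image_replace hy]
    exact hTt.image (adj_replace hxy)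
  have hcount := card_filter_adj_replace (G := G) (z := z) hxT hy
  rw [← hT₁] at hcount
  have hne : (T₁.filter (G.Adj z)).card ≠ 2 ∧ (T₁.filter (G.Adj z)).card ≠ 0 := by
    rcases hz with ⟨h2, hxor⟩ | ⟨h0, hadj⟩
    · by_cases h1 : G.Adj z x <;> by_cases h2 : G.Adj z y <;> simp [h1, h2] at hcount hxor <;> omega
    · have : ¬ G.Adj z y := fun hzy => by
        have : y ∈ T.filter (G.Adj z) := Finset.mem_filter.2 ⟨hy, hzy⟩
        rw [Finset.card_eq_zero.1 h0] at this
        simp at this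
      simp only [hadj, this, if_true, if_false] at hcount
      omega
  have hsub₁ : T₁ ⊆ S := Finset.insert_subset hxS ((Finset.erase_subset _ _).trans hT)
  have hzT₁ : z ∉ T₁ := by
    simp [hT₁, hxz.symm, hzT]
  obtain ⟨w, hw⟩ := Finset.card_pos.1 (Nat.pos_of_ne_zero hne.2)
  rw [Finset.mem_filter] at hw
  have hR : insert z T₁ ⊂ S := by
    refine (Finset.insert_subset hzS hsub₁).ssubset_of_ne fun he => ?_
    rw [← he, Finset.card_insert_of_notMem hzT₁] at hS
    omega
  have hRc := hc₁.insert hw.1 hw.2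
  obtain ⟨g, hg⟩ := (h.2 _ hR).exists_blowUp hRc
  have hg₁ : ∀ u ∈ T₁, ∀ v ∈ T₁, G.Adj u v ↔ (SimpleGraph.cycleGraph t).Adj (g u) (g v) :=
    fun u hu v hv => hg u (Finset.mem_insert_of_mem hu) v (Finset.mem_insert_of_mem hv)
  have himg : T₁.image g = Finset.univ := Finset.eq_univ_of_card _ (by
    rw [Finset.card_image_of_injOn (ht₁.injOn hg₁), hcard₁, Fintype.card_fin])
  -- All t clusters are occupied by `T₁`, so `z` shares a cluster with some `b` and must have two
  -- neighbours on `T₁`, like `b`.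
  obtain ⟨b, hb, hbz⟩ := Finset.mem_image.1 (himg ▸ Finset.mem_univ (g z))
  have heq : T₁.filter (G.Adj z) = T₁.filter (G.Adj b) := Finset.filter_congr fun v hv => by
    rw [hg z (Finset.mem_insert_self _ _) v (Finset.mem_insert_of_mem hv), ← hbz, ← hg₁ b hb v hv]
  refine hne.1 ?_
  rw [heq]
  exact card_filter_adj_eq_two ht (h.2 _ ((Finset.ssubset_insert hzT₁).trans hR)) hc₁ ht₁ hcard₁ hb

/-- A triangle would be a proper connected subset, hence a blow-up of a cycle of length at least 4,
which is triangle-free. -/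
theorem MinimalOn.false_of_triangle (ht : 4 ≤ t)
    (h : MinimalOn (SimpleGraph.cycleGraph t) G S) (hS : t < S.card) {x y z : V} (hx : x ∈ S)
    (hy : y ∈ S) (hz : z ∈ S) (hxy : G.Adj x y) (hyz : G.Adj y z) (hxz : G.Adj x z) : False := by
  have hR : insert x {y, z} ⊂ S := by
    refine (Finset.ssubset_iff_subset_ne.2 ⟨by simp [Finset.insert_subset_iff, hx, hy, hz], ?_⟩)
    rintro rfl
    have := Finset.card_le_three (a := x) (b := y) (c := z)
    omega
  obtain ⟨g, hg⟩ := (h.2 _ hR).exists_blowUp ((connectedOn_pair hyz).insert (z := y) (by simp) hxy)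
  have h1 := (hg x (by simp) y (by simp)).1 hxy
  have h2 := (hg y (by simp) z (by simp)).1 hyz
  have h3 := (hg x (by simp) z (by simp)).1 hxz
  have : NeZero t := ⟨by omega⟩
  have e : ∀ d : Fin t, d = 0 + Fin.ofNat t d.val := fun d => by
    rw [Fin.ofNat_val_eq_self, zero_add]
  rw [e (g x), e (g y), cycleGraph_adj_add (by omega) 0 (g x).isLt (g y).isLt] at h1
  rw [e (g y), e (g z), cycleGraph_adj_add (by omega) 0 (g y).isLt (g z).isLt] at h2
  rw [e (g x), e (g z), cycleGraph_adj_add (by omega) 0 (g x).isLt (g z).isLt] at h3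
  omega

/-- A vertex set inducing the full cycle, together with one further vertex. -/
theorem MinimalOn.false_of_cycle_add_one (ht : 8 ≤ t)
    (h : MinimalOn (SimpleGraph.cycleGraph t) G S) (hS : t < S.card) (hT : T ⊂ S)
    (hTc : ConnectedOn G T) (hTt : TwinFreeOn G T) (hcard : T.card = t) {x z : V} (hxS : x ∈ S)
    (hz : z ∈ T) (hxz : G.Adj x z) (hx : ∀ y ∈ T, ¬ ∀ z ∈ T, G.Adj x z ↔ G.Adj y z) : False := by
  have : NeZero t := ⟨by omega⟩
  obtain ⟨f, hf⟩ := (h.2 _ hT).exists_blowUp hTc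
  have hinj := hTt.injOn hf
  have himg : T.image f = Finset.univ := Finset.eq_univ_of_card _ (by
    rw [Finset.card_image_of_injOn hinj, hcard, Fintype.card_fin])
  have hsurj : ∀ d, ∃ v ∈ T, f v = d := fun d =>
    Finset.mem_image.1 (himg ▸ Finset.mem_univ d)
  -- The cut is at a cycle neighbour `q` of `z`, so the path starts at `z`. As `x` is adjacent to
  -- `z`, the only options left are that `x` copies `p 1` or `q`.
  obtain ⟨p, hp, hpT, hp0, hq⟩ := exists_isPathMap (by omega) hf hinj (f z - Fin.ofNat t 1)
    fun d _ => hsurj d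
  obtain ⟨q, hqT, hqc⟩ := hsurj (f z - Fin.ofNat t 1)
  have hpz := hp0 z hz (by rw [sub_add_cancel])
  have hqp := hq q hqT hqc
  have hxT : x ∉ T := fun hxT => hx x hxT fun _ _ => Iff.rfl
  have hmem : ∀ i ≤ t - 2, p i ∈ T := fun i hi => by
    have : p i ∈ (Finset.range (t - 2 + 1)).image p := IsPathMap.mem_image.2 ⟨i, hi, rfl⟩
    rw [hpT] at this
    exact (Finset.mem_filter.1 this).1
  have hcover : ∀ v ∈ T, v = q ∨ ∃ i ≤ t - 2, p i = v := fun v hv => by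
    by_cases hvc : f v = f z - Fin.ofNat t 1
    · exact Or.inl (hinj hv hqT (hvc.trans hqc.symm))
    · right
      rw [← IsPathMap.mem_image, hpT]
      exact Finset.mem_filter.2 ⟨hv, hvc⟩
  have hqz : G.Adj q z := hpz ▸ (hqp 0 (by omega)).2 (Or.inl rfl)
  have hxq : ¬ G.Adj x q := fun hxq =>
    h.false_of_triangle (by omega) hS hxS (hT.subset hqT) (hT.subset hz) hxq hqz hxz
  rcases h.path_neighbors ht hS hp (fun i hi => hT.subset (hmem i hi)) hxS
    (fun i hi he => hxT (he ▸ hmem i hi)) with h1 | ⟨l, hl, h1⟩ | h1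
  · exact h1 0 (by omega) (hpz ▸ hxz)
  · have hl1 : l = 1 := by
      have := (h1 0 (by omega)).1 (hpz ▸ hxz)
      omega
    subst hl1
    refine hx (p 1) (hmem 1 (by omega)) fun v hv => ?_
    rcases hcover v hv with rfl | ⟨i, hi, rfl⟩
    · simp only [hxq, false_iff]
      rw [G.adj_comm, hqp 1 (by omega)]
      omega
    · rw [h1 i hi, hp.adj 1 (by omega) i hi]
  · refine hx q hqT fun v hv => ?_
    rcases hcover v hv with rfl | ⟨i, hi, rfl⟩
    · simp [hxq]
    · rw [h1 i hi, hqp i hi]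

/-- The injection into the cycle misses exactly one cluster, and the cycle is cut there. -/
theorem exists_isPathMap_of_card (ht : 8 ≤ t) (hcol : CollectionOn (SimpleGraph.cycleGraph t) G T)
    (hTc : ConnectedOn G T) (hTt : TwinFreeOn G T) (hcard : T.card + 1 = t) :
    ∃ p, IsPathMap G (t - 2) p ∧ (Finset.range (t - 2 + 1)).image p = T := by
  have : NeZero t := ⟨by omega⟩
  obtain ⟨f, hf⟩ := hcol.exists_blowUp hTc
  have hinj := hTt.injOn hf
  obtain ⟨c, hc⟩ : ∃ c, (T.image f)ᶜ = {c} := by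
    rw [← Finset.card_eq_one, Finset.card_compl, Finset.card_image_of_injOn hinj, Fintype.card_fin]
    omega
  have hc' : ∀ d, d ∈ T.image f ↔ d ≠ c := fun d => by
    rw [← not_iff_not, ← Finset.mem_compl, hc]
    simp
  obtain ⟨p, hp, hpT, -⟩ := exists_isPathMap (by omega) hf hinj c fun d hd =>
    Finset.mem_image.1 ((hc' d).2 hd)
  refine ⟨p, hp, hpT.trans (Finset.filter_true_of_mem fun v hv => ?_)⟩
  exact (hc' _).1 (Finset.mem_image_of_mem f hv)

/-- A maximal proper `T` has at most t vertices and lacks at most two vertices of `S`, so it has t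
or t - 1: a full cycle or a path. Each kind of extension is contradicted in both cases, except that
a single extension can only come from a full cycle. -/
theorem MinimalOn.card_le_of_cycleGraph (ht : 8 ≤ t)
    (h : MinimalOn (SimpleGraph.cycleGraph t) G S) : S.card ≤ t := by
  have : NeZero t := ⟨by omega⟩
  by_contra! hS
  obtain ⟨T, hTS, hc, htw, h2, hmax⟩ := h.exists_maximal (by omega)
  have hTt : T.card ≤ t := by simpa using card_le_of_twinFreeOn (h.2 T hTS) hc htw
  have hcol := h.2 T hTS
  have hS2 : ∀ x z : V, x ∉ T → z ∉ insert x T → x ∈ S → z ∈ S →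
      ConnectedOn G (insert z (insert x T)) → TwinFreeOn G (insert z (insert x T)) →
      S.card = T.card + 2 := fun x z hx hz hxS hzS hc' ht' => by
    have hsub : insert z (insert x T) ⊆ S := by
      simp [Finset.insert_subset_iff, hxS, hzS, hTS.subset]
    rw [← hmax _ hsub hc' ht' (((Finset.ssubset_insert hx)).trans (Finset.ssubset_insert hz)),
      Finset.card_insert_of_notMem hz, Finset.card_insert_of_notMem hx]
  rcases exists_extension h.connectedOn h.twinFreeOn hTS hc with
    ⟨x, hx, ⟨z, hz, hxz⟩, hne⟩ | ⟨x, hx, x', hx', y, hy, y', hy', hxy, hxy', hne⟩ |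
    ⟨x, hx, z, hz, y, hy, hxy, hxz, hzT⟩
  · have hxT : x ∉ T := fun h => hne x h fun _ _ => Iff.rfl
    have hcard : S.card = T.card + 1 := by
      rw [← hmax _ (Finset.insert_subset hx hTS.subset) (hc.insert hz hxz) (htw.insert hne)
        (Finset.ssubset_insert hxT), Finset.card_insert_of_notMem hxT]
    exact h.false_of_cycle_add_one ht hS hTS hc htw (by omega) hx hz hxz hne
  · obtain ⟨ha, hb, hc', ht'⟩ := extend_pair hc htw h2 hy hy' hxy hxy' hne
    have hcard := hS2 x x' ha hb hx hx' hc' ht'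
    simp only [Finset.mem_insert, not_or] at hb
    by_cases hTc : T.card = t
    · refine h.false_of_cycle_add_two (by omega) (by omega) hTS.subset hc htw hTc hx hx' ha hb.2
        (Ne.symm hb.1) hy hxy (Or.inl ⟨?_, ?_⟩)
      · rw [Finset.filter_congr hxy']
        exact card_filter_adj_eq_two (by omega) hcol hc htw hTc hy'
      · rw [G.adj_comm x' x, hxy' y hy, G.adj_comm y' y]
        exact hne
    · obtain ⟨p, hp, rfl⟩ := exists_isPathMap_of_card ht hcol hc htw (by omega)
      obtain ⟨i, hi, rfl⟩ := IsPathMap.mem_image.1 hy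
      obtain ⟨j, hj, rfl⟩ := IsPathMap.mem_image.1 hy'
      have hmem : ∀ k ≤ t - 2, p k ∈ (Finset.range (t - 2 + 1)).image p := fun k hk =>
        IsPathMap.mem_image.2 ⟨k, hk, rfl⟩
      refine h.path_pair ht hS hp (fun k hk => hTS.subset (hmem k hk)) hx hx'
        (fun k hk he => ha (he ▸ hmem k hk)) (fun k hk he => hb.2 (he ▸ hmem k hk))
        (Ne.symm hb.1) hi hj (fun k hk => ?_) (fun k hk => ?_) ?_
      · rw [hxy _ (hmem k hk), hp.adj i hi k hk]
      · rw [hxy' _ (hmem k hk), hp.adj j hj k hk]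
      · rw [← hp.adj i hi j hj]
        exact hne
  · obtain ⟨ha, hb, hc', ht'⟩ := extend_pendant hc htw h2 hy hxy hxz hzT
    have hcard := hS2 x z ha hb hx hz hc' ht'
    simp only [Finset.mem_insert, not_or] at hb
    by_cases hTc : T.card = t
    · refine h.false_of_cycle_add_two (by omega) (by omega) hTS.subset hc htw hTc hx hz ha hb.2
        (Ne.symm hb.1) hy hxy (Or.inr ⟨?_, hxz.symm⟩)
      rw [Finset.card_eq_zero]
      exact Finset.filter_false_of_mem hzT
    · obtain ⟨p, hp, rfl⟩ := exists_isPathMap_of_card ht hcol hc htw (by omega)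
      obtain ⟨i, hi, rfl⟩ := IsPathMap.mem_image.1 hy
      have hmem : ∀ k ≤ t - 2, p k ∈ (Finset.range (t - 2 + 1)).image p := fun k hk =>
        IsPathMap.mem_image.2 ⟨k, hk, rfl⟩
      refine h.path_pendant ht hS hp (fun k hk => hTS.subset (hmem k hk)) hx hz
        (fun k hk he => ha (he ▸ hmem k hk)) (fun k hk he => hb.2 (he ▸ hmem k hk))
        hi (fun k hk => ?_) (fun k hk => hzT _ (hmem k hk)) hxz
      rw [hxy _ (hmem k hk), hp.adj i hi k hk]

end Cycle

end

/-! ### Counting connected tuples, minimal witnesses and bad lists. -/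

section

variable {U V : Type*}

section Counting

variable [Fintype V]

/-- The number of neighbours of `v`. -/
noncomputable def deg (G : SimpleGraph V) (v : V) : ℕ := (Finset.univ.filter (G.Adj v)).card

/-- The injective tuples of vertices that form a connected set. -/
def IsConnectedTuple (G : SimpleGraph V) {w : ℕ} (f : Fin w → V) : Prop :=
  Function.Injective f ∧ ConnectedOn G (Finset.univ.image f)

/-- The tuples enumerating minimal witnesses. -/
noncomputable def minimalTuples (H : SimpleGraph U) (G : SimpleGraph V) (u : ℕ) :
    Finset (Fin u → V) :=
  Finset.univ.filter fun f => Function.Injective f ∧ MinimalOn H G (Finset.univ.image f)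

/-- A connected tuple has an edge from a prescribed position to a free one. There are at most w²
such pairs of positions and `m` neighbours to put in the free one, and then one position fewer is
free. -/
theorem card_connectedTuple_le {G : SimpleGraph V} {m : ℝ} (hm : 0 ≤ m)
    (hdeg : ∀ v, (deg G v : ℝ) ≤ m) {w : ℕ} {K : Finset (Fin w)} (hK : K.Nonempty)
    (g : Fin w → V) :
    ((Finset.univ.filter fun f : Fin w → V =>
      IsConnectedTuple G f ∧ ∀ k ∈ K, f k = g k).card : ℝ) ≤ ((w : ℝ) ^ 2 * m) ^ (w - K.card) := by
  induction hn : w - K.card generalizing K g with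
  | zero =>
    have hKu : K = Finset.univ := by
      have := K.card_le_univ
      rw [Fintype.card_fin] at this
      exact Finset.eq_univ_of_card _ (by rw [Fintype.card_fin]; omega)
    rw [pow_zero]
    norm_cast
    rw [Finset.card_le_one]
    intro a ha b hb
    simp only [Finset.mem_filter, hKu, Finset.mem_univ, true_and, forall_const] at ha hb
    funext k
    rw [ha.2, hb.2]
  | succ n ih =>
    set I := Finset.univ.filter fun q : Fin w × Fin w => q.1 ∈ K ∧ q.2 ∉ K with hI
    have hsub : (Finset.univ.filter fun f : Fin w → V =>
        IsConnectedTuple G f ∧ ∀ k ∈ K, f k = g k) ⊆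
        I.biUnion fun q => (Finset.univ.filter (G.Adj (g q.1))).biUnion fun x =>
          Finset.univ.filter fun f : Fin w → V => IsConnectedTuple G f ∧
            ∀ k ∈ insert q.2 K, f k = Function.update g q.2 x k := by
      intro f hf
      simp only [Finset.mem_filter, Finset.mem_univ, true_and] at hf
      obtain ⟨hf, hfg⟩ := hf
      obtain ⟨a, ha, b, hb, hba, hab⟩ := hf.2.2 (K.image f)
        (Finset.image_subset_image (Finset.subset_univ K)) (hK.image f) (fun h => by
          have h1 := congrArg Finset.card h
          rw [Finset.card_image_of_injective _ hf.1, Finset.card_image_of_injective _ hf.1,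
            Finset.card_univ, Fintype.card_fin] at h1
          omega)
      obtain ⟨k, hk, rfl⟩ := Finset.mem_image.1 ha
      obtain ⟨k', -, rfl⟩ := Finset.mem_image.1 hb
      have hk' : k' ∉ K := fun h => hba (Finset.mem_image_of_mem f h)
      simp only [Finset.mem_biUnion, Finset.mem_filter, Finset.mem_univ, true_and, hI]
      refine ⟨(k, k'), ⟨hk, hk'⟩, f k', ?_, hf, fun j hj => ?_⟩
      · rw [← hfg k hk]
        exact hab
      · rcases Finset.mem_insert.1 hj with rfl | hj
        · simp
        · rw [Function.update_of_ne (fun h : j = k' => hk' (h ▸ hj)), hfg j hj]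
    refine (Nat.cast_le.2 (Finset.card_le_card hsub)).trans ?_
    refine (Nat.cast_le.2 Finset.card_biUnion_le).trans ?_
    rw [Nat.cast_sum]
    have hterm : ∀ q ∈ I, (((Finset.univ.filter (G.Adj (g q.1))).biUnion fun x =>
          Finset.univ.filter fun f : Fin w → V => IsConnectedTuple G f ∧
            ∀ k ∈ insert q.2 K, f k = Function.update g q.2 x k).card : ℝ) ≤
        m * ((w : ℝ) ^ 2 * m) ^ n := by
      intro q hq
      simp only [hI, Finset.mem_filter, Finset.mem_univ, true_and] at hq
      refine (Nat.cast_le.2 Finset.card_biUnion_le).trans ?_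
      rw [Nat.cast_sum]
      refine (Finset.sum_le_card_nsmul _ _ (((w : ℝ) ^ 2 * m) ^ n) fun x _ => ?_).trans ?_
      · refine ih (Finset.insert_nonempty _ _) _ ?_
        rw [Finset.card_insert_of_notMem hq.2]
        omega
      · rw [nsmul_eq_mul]
        exact mul_le_mul_of_nonneg_right (hdeg _) (by positivity)
    refine (Finset.sum_le_card_nsmul _ _ _ hterm).trans ?_
    rw [nsmul_eq_mul, pow_succ' ((w : ℝ) ^ 2 * m)]
    have hIc : (I.card : ℝ) ≤ (w : ℝ) ^ 2 := by
      have := I.card_le_univ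
      rw [Fintype.card_prod, Fintype.card_fin] at this
      rw [sq]
      exact_mod_cast this
    calc (I.card : ℝ) * (m * ((w : ℝ) ^ 2 * m) ^ n)
        ≤ (w : ℝ) ^ 2 * (m * ((w : ℝ) ^ 2 * m) ^ n) :=
          mul_le_mul_of_nonneg_right hIc (by positivity)
      _ = _ := by ring

/-- The vertices in the list form a connected set that is not a blow-up collection. -/
def IsBad (H : SimpleGraph U) (G : SimpleGraph V) (l : List V) : Prop :=
  l.Nodup ∧ ConnectedOn G l.toFinset ∧ ¬ CollectionOn H G l.toFinset

/-- The number of bad lists that extend `l` by at most `r` vertices, where an extension by `i`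
vertices is counted with the weight `d ^ (-i)`. -/
noncomputable def badWeight (H : SimpleGraph U) (G : SimpleGraph V) (d : ℝ) : ℕ → List V → ℝ
  | 0, l => if IsBad H G l then 1 else 0
  | r + 1, l => (if IsBad H G l then 1 else 0) + (∑ x, badWeight H G d r (x :: l)) / d

theorem badWeight_nonneg (H : SimpleGraph U) (G : SimpleGraph V) {d : ℝ} (hd : 0 ≤ d) (r : ℕ)
    (l : List V) : 0 ≤ badWeight H G d r l := by
  induction r generalizing l with
  | zero => rw [badWeight]; split_ifs <;> norm_num
  | succ r ih =>
    rw [badWeight]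
    have := Finset.sum_nonneg fun x (_ : x ∈ Finset.univ) => ih (x :: l)
    split_ifs <;> positivity

theorem one_le_badWeight {H : SimpleGraph U} {G : SimpleGraph V} {d : ℝ} (hd : 0 ≤ d) (r : ℕ)
    {l : List V} (hl : IsBad H G l) : 1 ≤ badWeight H G d r l := by
  cases r with
  | zero => rw [badWeight, if_pos hl]
  | succ r =>
    rw [badWeight, if_pos hl]
    have := Finset.sum_nonneg fun x (_ : x ∈ Finset.univ) => badWeight_nonneg H G hd r (x :: l)
    have : 0 ≤ (∑ x, badWeight H G d r (x :: l)) / d := by positivity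
    linarith

/-- The recursive form suits the lower bound, obtained by growing lists; this form suits the upper
bound, obtained by counting tuples. -/
theorem badWeight_eq_sum (H : SimpleGraph U) (G : SimpleGraph V) (d : ℝ) (r : ℕ) (l : List V) :
    badWeight H G d r l = ∑ i ∈ Finset.range (r + 1),
      ((Finset.univ.filter fun f : Fin i → V => IsBad H G (List.ofFn f ++ l)).card : ℝ) / d ^ i := by
  induction r generalizing l with
  | zero =>
    simp only [badWeight, zero_add, Finset.range_one, Finset.sum_singleton, pow_zero, div_one,
      List.ofFn_zero, List.nil_append]
    split_ifs with h <;> simp [h]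
  | succ r ih =>
    rw [badWeight, Finset.sum_range_succ', add_comm]
    congr 1
    · simp_rw [ih]
      rw [Finset.sum_comm, Finset.sum_div]
      refine Finset.sum_congr rfl fun i _ => ?_
      rw [← Finset.sum_div, div_div, pow_succ]
      congr 1
      rw [← Nat.cast_sum]
      norm_cast
      simp_rw [Finset.card_filter]
      -- The vertex adjoined first stands next to `l`, so it is the last entry of the tuple.
      rw [← (Fin.snocEquiv fun _ : Fin (i + 1) => V).sum_comp, Fintype.sum_prod_type]
      refine Finset.sum_congr rfl fun x _ => Finset.sum_congr rfl fun f _ => ?_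
      have : List.ofFn f ++ x :: l =
          List.ofFn ((Fin.snocEquiv fun _ : Fin (i + 1) => V) (x, f)) ++ l := by
        rw [List.ofFn_succ']
        simp [Fin.snocEquiv]
      rw [this]
    · simp only [List.ofFn_zero, List.nil_append, pow_zero, div_one]
      split_ifs with h <;> simp [h]

/-- Each bad list contains a minimal witness at some set `K` of positions, and the other positions
complete it to a connected tuple. -/
theorem card_bad_le [Nonempty U] {H : SimpleGraph U} {G : SimpleGraph V} {m : ℝ} (hm : 0 ≤ m)
    (hdeg : ∀ v, (deg G v : ℝ) ≤ m) (w : ℕ) :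
    ((Finset.univ.filter fun f : Fin w → V => IsBad H G (List.ofFn f)).card : ℝ) ≤
      ∑ K : Finset (Fin w) with K.Nonempty,
        ((minimalTuples H G K.card).card : ℝ) * ((w : ℝ) ^ 2 * m) ^ (w - K.card) := by
  have hsub : (Finset.univ.filter fun f : Fin w → V => IsBad H G (List.ofFn f)) ⊆
      (Finset.univ.filter fun K : Finset (Fin w) => K.Nonempty).biUnion fun K =>
        (minimalTuples H G K.card).biUnion fun g =>
          Finset.univ.filter fun f : Fin w → V => IsConnectedTuple G f ∧
            f ∘ (K.orderEmbOfFin rfl) = g := by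
    intro f hf
    simp only [Finset.mem_filter, Finset.mem_univ, true_and] at hf
    obtain ⟨hnd, hc, hcol⟩ := hf
    have himg : (List.ofFn f).toFinset = Finset.univ.image f := by
      ext v
      simp [List.mem_ofFn]
    rw [himg] at hc hcol
    obtain ⟨M, hM, hmin⟩ := exists_minimalOn_subset hcol
    set K := Finset.univ.filter fun k => f k ∈ M with hK
    have hKM : K.image f = M := by
      ext v
      simp only [hK, Finset.mem_image, Finset.mem_filter, Finset.mem_univ, true_and]
      constructor
      · rintro ⟨k, hk, rfl⟩
        exact hk
      · intro hv
        obtain ⟨k, -, rfl⟩ := Finset.mem_image.1 (hM hv)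
        exact ⟨k, hv, rfl⟩
    have hinj : Function.Injective f := List.nodup_ofFn.1 hnd
    have hKM' : Finset.univ.image (f ∘ K.orderEmbOfFin rfl) = M := by
      rw [← Finset.image_image, Finset.image_orderEmbOfFin_univ, hKM]
    simp only [Finset.mem_biUnion, Finset.mem_filter, Finset.mem_univ, true_and]
    refine ⟨K, ?_, f ∘ K.orderEmbOfFin rfl, ?_, ⟨hinj, hc⟩, rfl⟩
    · rw [← Finset.image_nonempty (f := f), hKM]
      exact hmin.nonempty
    · rw [minimalTuples, Finset.mem_filter, hKM']
      exact ⟨Finset.mem_univ _, hinj.comp (K.orderEmbOfFin rfl).injective, hmin⟩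
  refine (Nat.cast_le.2 (Finset.card_le_card hsub)).trans ?_
  refine (Nat.cast_le.2 Finset.card_biUnion_le).trans ?_
  rw [Nat.cast_sum]
  refine Finset.sum_le_sum fun K hK => ?_
  refine (Nat.cast_le.2 Finset.card_biUnion_le).trans ?_
  rw [Nat.cast_sum, ← nsmul_eq_mul]
  refine Finset.sum_le_card_nsmul _ _ _ fun g _ => ?_
  -- One completion `f₀` serves as the prescribed values on `K`.
  rcases (Finset.univ.filter fun f : Fin w → V => IsConnectedTuple G f ∧
      f ∘ (K.orderEmbOfFin rfl) = g).eq_empty_or_nonempty with he | ⟨f₀, hf₀⟩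
  · rw [he, Finset.card_empty, Nat.cast_zero]
    positivity
  · rw [Finset.mem_filter] at hf₀
    refine (Nat.cast_le.2 (Finset.card_le_card ?_)).trans
      (card_connectedTuple_le hm hdeg (Finset.mem_filter.1 hK).2 f₀)
    intro f hf
    simp only [Finset.mem_filter, Finset.mem_univ, true_and] at hf ⊢
    refine ⟨hf.1, fun k hk => ?_⟩
    obtain ⟨i, rfl⟩ : ∃ i, K.orderEmbOfFin rfl i = k := by
      rw [← Finset.image_orderEmbOfFin_univ K rfl] at hk
      obtain ⟨i, -, hi⟩ := Finset.mem_image.1 hk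
      exact ⟨i, hi⟩
    exact congrFun (hf.2.trans hf₀.2.2.symm) i

/-- A witness on k positions contributes d^(k-1) N and its completion d^(w-k), so after division by
d^w exactly one factor 1/d survives for every `w`. -/
theorem badWeight_nil_le [Nonempty U] {H : SimpleGraph U} {G : SimpleGraph V} {d γ : ℝ}
    (hd : 0 < d) (hγ : 0 ≤ γ) (hdeg : ∀ v, (deg G v : ℝ) ≤ 2 * d)
    (hmin : ∀ u, 1 ≤ u → ((minimalTuples H G u).card : ℝ) ≤ γ * Fintype.card V * d ^ (u - 1))
    (R : ℕ) : badWeight H G d R [] ≤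
      (∑ w ∈ Finset.range (R + 1), (4 * (w : ℝ) ^ 2) ^ w) * (γ * Fintype.card V / d) := by
  rw [badWeight_eq_sum, Finset.sum_mul]
  refine Finset.sum_le_sum fun w _ => ?_
  simp only [List.append_nil]
  rw [div_le_iff₀ (by positivity)]
  refine (card_bad_le (by positivity) hdeg w).trans ?_
  rcases Nat.eq_zero_or_pos w with rfl | hw
  · have : (Finset.univ.filter fun K : Finset (Fin 0) => K.Nonempty) = ∅ := by
      simp [Finset.eq_empty_of_isEmpty]
    rw [this, Finset.sum_empty]
    positivity
  have hw1 : (1 : ℝ) ≤ w := by exact_mod_cast hw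
  have hterm : ∀ K ∈ Finset.univ.filter (fun K : Finset (Fin w) => K.Nonempty),
      ((minimalTuples H G K.card).card : ℝ) * ((w : ℝ) ^ 2 * (2 * d)) ^ (w - K.card) ≤
        γ * Fintype.card V * (2 * (w : ℝ) ^ 2) ^ w * d ^ (w - 1) := by
    intro K hK
    have hK1 : 1 ≤ K.card := Finset.card_pos.2 (Finset.mem_filter.1 hK).2
    have hKw : K.card ≤ w := by simpa using K.card_le_univ
    calc ((minimalTuples H G K.card).card : ℝ) * ((w : ℝ) ^ 2 * (2 * d)) ^ (w - K.card)
        ≤ (γ * Fintype.card V * d ^ (K.card - 1)) * ((w : ℝ) ^ 2 * (2 * d)) ^ (w - K.card) :=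
          mul_le_mul_of_nonneg_right (hmin _ hK1) (by positivity)
      _ = γ * Fintype.card V * (2 * (w : ℝ) ^ 2) ^ (w - K.card) *
          (d ^ (K.card - 1) * d ^ (w - K.card)) := by
          rw [show (w : ℝ) ^ 2 * (2 * d) = (2 * (w : ℝ) ^ 2) * d by ring, mul_pow]
          ring
      _ = γ * Fintype.card V * (2 * (w : ℝ) ^ 2) ^ (w - K.card) * d ^ (w - 1) := by
          rw [← pow_add]
          congr 2
          omega
      _ ≤ _ := by
          have : (2 * (w : ℝ) ^ 2) ^ (w - K.card) ≤ (2 * (w : ℝ) ^ 2) ^ w :=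
            pow_le_pow_right₀ (by nlinarith) (Nat.sub_le _ _)
          gcongr
  refine (Finset.sum_le_card_nsmul _ _ _ hterm).trans ?_
  rw [nsmul_eq_mul]
  have hcard : (((Finset.univ.filter fun K : Finset (Fin w) => K.Nonempty).card : ℕ) : ℝ) ≤
      2 ^ w := by
    have : (Finset.univ.filter fun K : Finset (Fin w) => K.Nonempty).card ≤ 2 ^ w := by
      refine (Finset.card_le_univ _).trans ?_
      simp
    exact_mod_cast this
  calc _ ≤ (2 : ℝ) ^ w * (γ * Fintype.card V * (2 * (w : ℝ) ^ 2) ^ w * d ^ (w - 1)) :=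
        mul_le_mul_of_nonneg_right hcard (by positivity)
    _ = (4 * (w : ℝ) ^ 2) ^ w * (γ * Fintype.card V * d ^ (w - 1)) := by
        rw [show (4 : ℝ) * (w : ℝ) ^ 2 = 2 * (2 * (w : ℝ) ^ 2) by ring, mul_pow 2 (2 * _)]
        ring
    _ = _ := by
        obtain ⟨n, rfl⟩ : ∃ n, w = n + 1 := ⟨w - 1, by omega⟩
        rw [Nat.add_sub_cancel, pow_succ d]
        field_simp

end Counting

end

/-! ### Few bad lists imply closeness to a collection. -/

section

variable {U V : Type*}

section Structure

variable {H : SimpleGraph U} {G : SimpleGraph V}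

/-- The vertices of `X` that extend `T` as in `TwinFreeOn.insert`. -/
noncomputable def singleExtensions (G : SimpleGraph V) (X T : Finset V) : Finset V :=
  X.filter fun x => (∃ z ∈ T, G.Adj x z) ∧ ∀ y ∈ T, ¬ ∀ z ∈ T, G.Adj x z ↔ G.Adj y z

/-- The pairs of vertices of `X` that extend `T` as in `extend_pair` or `extend_pendant`. -/
noncomputable def pairExtensions (G : SimpleGraph V) (X T : Finset V) : Finset (V × V) :=
  (X ×ˢ X).filter fun q => ∃ y ∈ T, (∀ z ∈ T, G.Adj q.1 z ↔ G.Adj y z) ∧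
    ((∃ y' ∈ T, (∀ z ∈ T, G.Adj q.2 z ↔ G.Adj y' z) ∧ ¬ (G.Adj q.1 q.2 ↔ G.Adj y y')) ∨
      (G.Adj q.1 q.2 ∧ ∀ w ∈ T, ¬ G.Adj q.2 w))

theorem mem_singleExtensions {X T : Finset V} {x : V} : x ∈ singleExtensions G X T ↔
    x ∈ X ∧ (∃ z ∈ T, G.Adj x z) ∧ ∀ y ∈ T, ¬ ∀ z ∈ T, G.Adj x z ↔ G.Adj y z :=
  Finset.mem_filter

theorem mem_pairExtensions {X T : Finset V} {q : V × V} : q ∈ pairExtensions G X T ↔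
    q ∈ X ×ˢ X ∧ ∃ y ∈ T, (∀ z ∈ T, G.Adj q.1 z ↔ G.Adj y z) ∧
    ((∃ y' ∈ T, (∀ z ∈ T, G.Adj q.2 z ↔ G.Adj y' z) ∧ ¬ (G.Adj q.1 q.2 ↔ G.Adj y y')) ∨
      (G.Adj q.1 q.2 ∧ ∀ w ∈ T, ¬ G.Adj q.2 w)) :=
  Finset.mem_filter

/-- `P` induces almost a blow-up of `H`, and almost no edge joins it to the rest of `X`. -/
def IsAlmostPart (H : SimpleGraph U) (G : SimpleGraph V) (X P : Finset V) (f : V → U) (b : ℝ) :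
    Prop :=
  (((P ×ˢ P).filter fun q => ¬ (G.Adj q.1 q.2 ↔ H.Adj (f q.1) (f q.2))).card : ℝ) ≤ b * P.card ∧
    (((P ×ˢ (X \ P)).filter fun q => G.Adj q.1 q.2).card : ℝ) ≤ b * P.card

variable [Fintype V]

/-- Take the vertices that copy a vertex of `T`, with inherited clusters. A wrong pair inside is a
pair extension; an edge leaving `P` is a pendant pair or ends in a single extension. All of these
are scarce. -/
theorem exists_almostPart [Nonempty U] {d κ : ℝ} (hd : 0 < d) (hκ : 0 < κ) (hκ1 : κ ≤ 1)
    (hdeg : ∀ v, (deg G v : ℝ) ≤ 2 * d) {X T : Finset V}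
    (hX : ∀ v ∈ X, κ * d < ((X.filter (G.Adj v)).card : ℝ)) (hTX : T ⊆ X)
    (hT : ConnectedOn G T) (hcol : CollectionOn H G T) (hA : ((singleExtensions G X T).card : ℝ) < κ ^ 2 / 6 * d)
    (hB : ((pairExtensions G X T).card : ℝ) < κ ^ 2 / 6 * d ^ 2) :
    ∃ P ⊆ X, P.Nonempty ∧ ∃ f, IsAlmostPart H G X P f (κ * d) := by
  obtain ⟨g, hg⟩ := hcol.exists_blowUp hT
  set P := X.filter fun x => ∃ y ∈ T, ∀ z ∈ T, G.Adj x z ↔ G.Adj y z with hP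
  have hex : ∀ x, ∃ y, x ∈ P → y ∈ T ∧ ∀ z ∈ T, G.Adj x z ↔ G.Adj y z := fun x => by
    by_cases hx : x ∈ P
    · obtain ⟨y, hy⟩ := (Finset.mem_filter.1 hx).2
      exact ⟨y, fun _ => hy⟩
    · exact ⟨x, fun h => (hx h).elim⟩
  choose y hy using hex
  have hTP : T ⊆ P := fun v hv => Finset.mem_filter.2 ⟨hTX hv, v, hv, fun _ _ => Iff.rfl⟩
  obtain ⟨v, hv⟩ := hT.1
  -- The neighbours of a vertex of `T` within `X` are in `P` or are single extensions, so `P` is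
  -- large.
  have hcard : κ / 2 * d ≤ P.card := by
    have hsub : X.filter (G.Adj v) ⊆ P ∪ singleExtensions G X T := fun x hx => by
      rw [Finset.mem_filter] at hx
      by_cases hxP : x ∈ P
      · exact Finset.mem_union_left _ hxP
      · refine Finset.mem_union_right _ (mem_singleExtensions.2 ⟨hx.1, ⟨v, hv, hx.2.symm⟩, ?_⟩)
        intro y hy h
        exact hxP (Finset.mem_filter.2 ⟨hx.1, y, hy, h⟩)
    have h1 : ((X.filter (G.Adj v)).card : ℝ) ≤ P.card + (singleExtensions G X T).card := by
      exact_mod_cast (Finset.card_le_card hsub).trans (Finset.card_union_le _ _)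
    have h3 := hX v (hTX hv)
    nlinarith [mul_pos hκ hd]
  -- Three units of κ²d²/6 fit into the budget: leaving edges use one for pendant pairs and two for
  -- the at most 2d edges at each single extension. This fixes the constant 6.
  have hbound : κ ^ 2 / 6 * d ^ 2 * 3 ≤ κ * d * P.card := by
    have := mul_le_mul_of_nonneg_left hcard (by positivity : 0 ≤ κ * d)
    nlinarith
  refine ⟨P, Finset.filter_subset _ _, hT.1.mono hTP, fun x => g (y x), ?_, ?_⟩
  · refine le_trans ?_ (hB.le.trans (le_trans ?_ hbound))
    · refine Nat.cast_le.2 (Finset.card_le_card fun q hq => ?_)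
      simp only [Finset.mem_filter, Finset.mem_product] at hq
      obtain ⟨⟨h1, h1'⟩, hne⟩ := hq
      refine mem_pairExtensions.2 ⟨Finset.mem_product.2 ⟨(Finset.mem_filter.1 h1).1,
        (Finset.mem_filter.1 h1').1⟩, y q.1, (hy _ h1).1, (hy _ h1).2, Or.inl ⟨y q.2, (hy _ h1').1,
        (hy _ h1').2, ?_⟩⟩
      rwa [hg _ (hy _ h1).1 _ (hy _ h1').1]
    · nlinarith [mul_pos (pow_pos hκ 2) (pow_pos hd 2)]
  · have hsub : ((P ×ˢ (X \ P)).filter fun q => G.Adj q.1 q.2) ⊆ pairExtensions G X T ∪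
        (singleExtensions G X T).biUnion fun z => (Finset.univ.filter (G.Adj z)).image
          fun x => (x, z) := by
      rintro ⟨x, z⟩ hq
      simp only [Finset.mem_filter, Finset.mem_product, Finset.mem_sdiff] at hq
      obtain ⟨⟨hx, hz, hzP⟩, hxz⟩ := hq
      by_cases hzT : ∀ w ∈ T, ¬ G.Adj z w
      · refine Finset.mem_union_left _ (mem_pairExtensions.2 ⟨Finset.mem_product.2
          ⟨(Finset.mem_filter.1 hx).1, hz⟩, y x, (hy _ hx).1, (hy _ hx).2, Or.inr ⟨hxz, hzT⟩⟩)
      · push Not at hzT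
        refine Finset.mem_union_right _ (Finset.mem_biUnion.2 ⟨z, mem_singleExtensions.2 ⟨hz, hzT, ?_⟩,
          Finset.mem_image.2 ⟨x, by simpa using hxz.symm, rfl⟩⟩)
        intro y hy h
        exact hzP (Finset.mem_filter.2 ⟨hz, y, hy, h⟩)
    refine (Nat.cast_le.2 ((Finset.card_le_card hsub).trans (Finset.card_union_le _ _))).trans ?_
    have h1 : (((singleExtensions G X T).biUnion fun z => (Finset.univ.filter (G.Adj z)).image
        fun x => (x, z)).card : ℝ) ≤ (singleExtensions G X T).card * (2 * d) := by
      refine (Nat.cast_le.2 Finset.card_biUnion_le).trans ?_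
      rw [Nat.cast_sum, ← nsmul_eq_mul]
      refine Finset.sum_le_card_nsmul _ _ _ fun z _ => ?_
      exact (Nat.cast_le.2 Finset.card_image_le).trans (hdeg z)
    rw [Nat.cast_add]
    have h3 := mul_le_mul_of_nonneg_right hA.le (by positivity : 0 ≤ 2 * d)
    have h4 : κ ^ 2 / 6 * d * (2 * d) = κ ^ 2 / 6 * d ^ 2 * 2 := by ring
    linarith

/-- As long as no almost part exists, a list that is a collection has order d single or order d²
pair extensions, each compensating its weight up to κ²/6. Growth stops at a bad list, before the
length exceeds h + 2. -/
theorem pow_le_badWeight [Nonempty U] [Fintype U] {d κ : ℝ} (hd : 0 < d) (hκ : 0 < κ) (hκ1 : κ ≤ 1)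
    (hdeg : ∀ v, (deg G v : ℝ) ≤ 2 * d) {X : Finset V}
    (hX : ∀ v ∈ X, κ * d < ((X.filter (G.Adj v)).card : ℝ))
    (hno : ¬ ∃ P ⊆ X, P.Nonempty ∧ ∃ f, IsAlmostPart H G X P f (κ * d)) (r : ℕ) (l : List V)
    (hlr : l.length + r = Fintype.card U + 2) (h2 : 2 ≤ l.length) (hnd : l.Nodup)
    (hlX : l.toFinset ⊆ X) (hc : ConnectedOn G l.toFinset) (ht : TwinFreeOn G l.toFinset) :
    (κ ^ 2 / 6) ^ r ≤ badWeight H G d r l := by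
  have hc1 : κ ^ 2 / 6 ≤ 1 := by nlinarith
  have hc0 : 0 < κ ^ 2 / 6 := by positivity
  induction r using Nat.strong_induction_on generalizing l with
  | _ r ih =>
    by_cases hcol : CollectionOn H G l.toFinset
    swap
    · exact (pow_le_one₀ hc0.le hc1).trans (one_le_badWeight hd.le r ⟨hnd, hc, hcol⟩)
    have hlen : l.toFinset.card = l.length := List.toFinset_card_of_nodup hnd
    have hle := card_le_of_twinFreeOn hcol hc ht
    -- The list is a twin-free connected collection, so its length is at most h and two more
    -- vertices are still allowed.
    obtain ⟨s, rfl⟩ : ∃ s, r = s + 2 := ⟨r - 2, by omega⟩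
    have hstep : ∀ s l, (∑ x, badWeight H G d s (x :: l)) / d ≤ badWeight H G d (s + 1) l := by
      intro s l
      rw [badWeight]
      split_ifs <;> linarith
    have hor : κ ^ 2 / 6 * d ≤ (singleExtensions G X l.toFinset).card ∨
        κ ^ 2 / 6 * d ^ 2 ≤ (pairExtensions G X l.toFinset).card := by
      by_contra! hlt
      exact hno (exists_almostPart hd hκ hκ1 hdeg hX hlX hc hcol hlt.1 hlt.2)
    rcases hor with hA | hB
    · refine le_trans ?_ (hstep _ _)
      rw [le_div_iff₀ hd]
      calc (κ ^ 2 / 6) ^ (s + 2) * d = (κ ^ 2 / 6 * d) * (κ ^ 2 / 6) ^ (s + 1) := by ring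
        _ ≤ (singleExtensions G X l.toFinset).card * (κ ^ 2 / 6) ^ (s + 1) := by gcongr
        _ = ∑ x ∈ singleExtensions G X l.toFinset, (κ ^ 2 / 6) ^ (s + 1) := by
            rw [Finset.sum_const, nsmul_eq_mul]
        _ ≤ ∑ x ∈ singleExtensions G X l.toFinset, badWeight H G d (s + 1) (x :: l) := by
            refine Finset.sum_le_sum fun x hx => ?_
            obtain ⟨hxX, ⟨z, hz, hxz⟩, hne⟩ := mem_singleExtensions.1 hx
            have hxl : x ∉ l := fun h =>
              hne x (List.mem_toFinset.2 h) fun _ _ => Iff.rfl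
            refine ih (s + 1) (by omega) _ (by simp only [List.length_cons]; omega)
              (by simp only [List.length_cons]; omega) (List.nodup_cons.2 ⟨hxl, hnd⟩) ?_ ?_ ?_
            · rw [List.toFinset_cons]
              exact Finset.insert_subset hxX hlX
            · rw [List.toFinset_cons]
              exact hc.insert hz hxz
            · rw [List.toFinset_cons]
              exact ht.insert hne
        _ ≤ _ := Finset.sum_le_sum_of_subset_of_nonneg (Finset.subset_univ _)
            fun x _ _ => badWeight_nonneg H G hd.le _ _
    · refine le_trans ?_ (hstep _ _)
      refine le_trans ?_ (div_le_div_of_nonneg_right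
        (Finset.sum_le_sum fun x (_ : x ∈ Finset.univ) => hstep s (x :: l)) hd.le)
      rw [← Finset.sum_div, div_div, le_div_iff₀ (by positivity)]
      calc (κ ^ 2 / 6) ^ (s + 2) * (d * d)
          = (κ ^ 2 / 6) * ((κ ^ 2 / 6 * d ^ 2) * (κ ^ 2 / 6) ^ s) := by ring
        _ ≤ 1 * ((κ ^ 2 / 6 * d ^ 2) * (κ ^ 2 / 6) ^ s) :=
            mul_le_mul_of_nonneg_right hc1 (by positivity)
        _ ≤ (pairExtensions G X l.toFinset).card * (κ ^ 2 / 6) ^ s := by rw [one_mul]; gcongr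
        _ = ∑ q ∈ pairExtensions G X l.toFinset, (κ ^ 2 / 6) ^ s := by
            rw [Finset.sum_const, nsmul_eq_mul]
        _ ≤ ∑ q ∈ pairExtensions G X l.toFinset, badWeight H G d s (q.2 :: q.1 :: l) := by
            refine Finset.sum_le_sum fun q hq => ?_
            obtain ⟨hqX, y, hy, hxy, hq⟩ := mem_pairExtensions.1 hq
            rw [Finset.mem_product] at hqX
            have key : q.1 ∉ l.toFinset ∧ q.2 ∉ insert q.1 l.toFinset ∧
                ConnectedOn G (insert q.2 (insert q.1 l.toFinset)) ∧
                TwinFreeOn G (insert q.2 (insert q.1 l.toFinset)) := by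
              rcases hq with ⟨y', hy', hxy', hne⟩ | ⟨hadj, hz⟩
              · exact extend_pair hc ht (by omega) hy hy' hxy hxy' hne
              · exact extend_pendant hc ht (by omega) hy hxy hadj hz
            obtain ⟨h1, h1', hc', ht'⟩ := key
            have hfin : (q.2 :: q.1 :: l).toFinset = insert q.2 (insert q.1 l.toFinset) := by
              rw [List.toFinset_cons, List.toFinset_cons]
            refine ih s (by omega) _ (by simp only [List.length_cons]; omega)
              (by simp only [List.length_cons]; omega) ?_ ?_ (hfin ▸ hc') (hfin ▸ ht')
            · simp only [List.nodup_cons]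
              exact ⟨by simpa using h1', by simpa using h1, hnd⟩
            · rw [hfin]
              simp [Finset.insert_subset_iff, hqX.1, hqX.2, hlX]
        _ ≤ ∑ q : V × V, badWeight H G d s (q.2 :: q.1 :: l) :=
            Finset.sum_le_sum_of_subset_of_nonneg (Finset.subset_univ _)
              fun x _ _ => badWeight_nonneg H G hd.le _ _
        _ = _ := by rw [Fintype.sum_prod_type]

/-- Growth starts from the edges inside `X`: each vertex has more than κd neighbours there, and two
adjoined vertices weigh 1/d². -/
theorem card_mul_le_badWeight [Nonempty U] [Fintype U] {d κ : ℝ} (hd : 0 < d) (hκ : 0 < κ)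
    (hκ1 : κ ≤ 1) (hdeg : ∀ v, (deg G v : ℝ) ≤ 2 * d) {X : Finset V}
    (hX : ∀ v ∈ X, κ * d < ((X.filter (G.Adj v)).card : ℝ))
    (hno : ¬ ∃ P ⊆ X, P.Nonempty ∧ ∃ f, IsAlmostPart H G X P f (κ * d)) :
    X.card * (κ ^ 2 / 6) ^ (Fintype.card U + 1) / d ≤
      badWeight H G d (Fintype.card U + 2) [] := by
  have hc1 : κ ^ 2 / 6 ≤ κ := by nlinarith
  have hstep : ∀ s l, (∑ x, badWeight H G d s (x :: l)) / d ≤ badWeight H G d (s + 1) l := by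
    intro s l
    rw [badWeight]
    split_ifs <;> linarith
  refine le_trans (div_le_div_of_nonneg_right ?_ hd.le) (hstep _ _)
  rw [← nsmul_eq_mul]
  refine le_trans (Finset.card_nsmul_le_sum X _ _ fun v hv => ?_)
    (Finset.sum_le_sum_of_subset_of_nonneg (Finset.subset_univ X)
      fun x _ _ => badWeight_nonneg H G hd.le _ _)
  refine le_trans ?_ (hstep _ _)
  rw [le_div_iff₀ hd]
  calc (κ ^ 2 / 6) ^ (Fintype.card U + 1) * d
      = (κ ^ 2 / 6) * ((κ ^ 2 / 6) ^ Fintype.card U * d) := by ring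
    _ ≤ κ * ((κ ^ 2 / 6) ^ Fintype.card U * d) := mul_le_mul_of_nonneg_right hc1 (by positivity)
    _ = (κ * d) * (κ ^ 2 / 6) ^ Fintype.card U := by ring
    _ ≤ (X.filter (G.Adj v)).card * (κ ^ 2 / 6) ^ Fintype.card U :=
        mul_le_mul_of_nonneg_right (hX v hv).le (by positivity)
    _ = (X.filter (G.Adj v)).card • (κ ^ 2 / 6) ^ Fintype.card U := by rw [nsmul_eq_mul]
    _ ≤ ∑ x ∈ X.filter (G.Adj v), badWeight H G d (Fintype.card U) [x, v] := by
        refine Finset.card_nsmul_le_sum _ _ _ fun x hx => ?_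
        obtain ⟨hxX, hvx⟩ := Finset.mem_filter.1 hx
        have hfin : [x, v].toFinset = {x, v} := by simp
        refine pow_le_badWeight hd hκ hκ1 hdeg hX hno _ _ (by simp; omega) (by simp)
          (by simp [hvx.ne']) ?_ ?_ ?_
        · simp [Finset.insert_subset_iff, hxX, hv]
        · rw [hfin]
          exact connectedOn_pair hvx.symm
        · rw [hfin]
          exact twinFreeOn_pair hvx.symm
    _ ≤ _ := Finset.sum_le_sum_of_subset_of_nonneg (Finset.subset_univ _)
        fun x _ _ => badWeight_nonneg H G hd.le _ _

/-- A graph with few bad lists is close to a blow-up collection. -/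
theorem exists_close_collection [Nonempty U] [Fintype U] {d κ : ℝ} (hd : 0 < d) (hκ : 0 < κ)
    (hκ1 : κ ≤ 1) (hdeg : ∀ v, (deg G v : ℝ) ≤ 2 * d)
    (hbad : badWeight H G d (Fintype.card U + 2) [] ≤
      κ * Fintype.card V * (κ ^ 2 / 6) ^ (Fintype.card U + 1) / d) (X : Finset V) :
    ∃ (p : V → ℕ) (f : V → U), (((X ×ˢ X).filter fun q =>
      ¬ (G.Adj q.1 q.2 ↔ p q.1 = p q.2 ∧ H.Adj (f q.1) (f q.2))).card : ℝ) ≤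
        3 * κ * d * X.card + 2 * κ * d * Fintype.card V := by
  induction X using Finset.strongInduction with
  | H X ih =>
    -- When few vertices remain, all become singleton parts, at a cost of 2d for each.
    by_cases hXc : (X.card : ℝ) ≤ κ * Fintype.card V
    · refine ⟨fun v => Fintype.equivFin V v, fun _ => Classical.arbitrary U, ?_⟩
      have hsub : ((X ×ˢ X).filter fun q => ¬ (G.Adj q.1 q.2 ↔
          ((Fintype.equivFin V q.1 : ℕ) = Fintype.equivFin V q.2 ∧
            H.Adj (Classical.arbitrary U) (Classical.arbitrary U)))) ⊆
          X.biUnion fun v => (Finset.univ.filter (G.Adj v)).image fun x => (v, x) := by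
        rintro ⟨v, x⟩ hq
        simp only [Finset.mem_filter, Finset.mem_product, SimpleGraph.irrefl, and_false, iff_false,
          not_not] at hq
        exact Finset.mem_biUnion.2 ⟨v, hq.1.1, Finset.mem_image.2 ⟨x, by simpa using hq.2, rfl⟩⟩
      refine (Nat.cast_le.2 (Finset.card_le_card hsub)).trans ?_
      refine (Nat.cast_le.2 Finset.card_biUnion_le).trans ?_
      rw [Nat.cast_sum]
      refine (Finset.sum_le_card_nsmul _ _ (2 * d) fun v _ =>
        (Nat.cast_le.2 Finset.card_image_le).trans (hdeg v)).trans ?_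
      rw [nsmul_eq_mul]
      have h1 : 0 ≤ 3 * κ * d * X.card := by positivity
      have h2 := mul_le_mul_of_nonneg_right hXc (by positivity : 0 ≤ 2 * d)
      linarith
    push Not at hXc
    have hpart : ∃ P ⊆ X, P.Nonempty ∧ ∃ f, IsAlmostPart H G X P f (κ * d) := by
      by_cases hX : ∀ v ∈ X, κ * d < ((X.filter (G.Adj v)).card : ℝ)
      · by_contra hno
        have h1 := (card_mul_le_badWeight hd hκ hκ1 hdeg hX hno).trans hbad
        rw [div_le_div_iff_of_pos_right hd] at h1
        exact absurd (le_of_mul_le_mul_right h1 (by positivity)) (not_le.2 hXc)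
      · push Not at hX
        obtain ⟨v, hv, hvd⟩ := hX
        -- A vertex with few neighbours in `X` is an almost part by itself.
        refine ⟨{v}, by simpa using hv, Finset.singleton_nonempty v,
          fun _ => Classical.arbitrary U, ?_, ?_⟩
        · have : ((({v} : Finset V) ×ˢ {v}).filter fun q : V × V => ¬ (G.Adj q.1 q.2 ↔
              H.Adj (Classical.arbitrary U) (Classical.arbitrary U))) = ∅ := by
            rw [Finset.filter_eq_empty_iff]
            rintro ⟨a, b⟩ hab
            simp only [Finset.mem_product, Finset.mem_singleton] at hab
            simp [hab.1, hab.2]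
          rw [this, Finset.card_empty, Nat.cast_zero]
          positivity
        · rw [Finset.card_singleton, Nat.cast_one, mul_one]
          refine le_trans (Nat.cast_le.2 ?_) hvd
          refine Finset.card_le_card_of_injOn Prod.snd ?_ ?_
          · rintro ⟨a, b⟩ hab
            simp only [Finset.coe_filter, Finset.mem_product, Finset.mem_singleton,
              Finset.mem_sdiff, Set.mem_ofPred_eq] at hab
            obtain ⟨⟨rfl, hb, -⟩, hadj⟩ := hab
            simpa using ⟨hb, hadj⟩
          · rintro ⟨a, b⟩ hab ⟨a', b'⟩ hab' (rfl : b = b')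
            simp only [Finset.coe_filter, Finset.mem_product, Finset.mem_singleton,
              Finset.mem_sdiff, Set.mem_ofPred_eq] at hab hab'
            rw [hab.1.1, hab'.1.1]
    obtain ⟨P, hPX, hPne, f, hin, hcross⟩ := hpart
    obtain ⟨p', f', hp'⟩ := ih (X \ P) (Finset.sdiff_ssubset hPX hPne)
    refine ⟨fun v => if v ∈ P then 0 else p' v + 1, fun v => if v ∈ P then f v else f' v, ?_⟩
    set A := (P ×ˢ P).filter fun q => ¬ (G.Adj q.1 q.2 ↔ H.Adj (f q.1) (f q.2)) with hA
    set B := (P ×ˢ (X \ P)).filter fun q => G.Adj q.1 q.2 with hB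
    set C := ((X \ P) ×ˢ (X \ P)).filter fun q =>
      ¬ (G.Adj q.1 q.2 ↔ p' q.1 = p' q.2 ∧ H.Adj (f' q.1) (f' q.2)) with hC
    have hsub : ((X ×ˢ X).filter fun q => ¬ (G.Adj q.1 q.2 ↔
        (if q.1 ∈ P then 0 else p' q.1 + 1) = (if q.2 ∈ P then 0 else p' q.2 + 1) ∧
        H.Adj (if q.1 ∈ P then f q.1 else f' q.1) (if q.2 ∈ P then f q.2 else f' q.2))) ⊆
        (A ∪ B) ∪ (B.image Prod.swap ∪ C) := by
      rintro ⟨a, b⟩ hq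
      simp only [Finset.mem_filter, Finset.mem_product] at hq
      obtain ⟨⟨ha, hb⟩, hne⟩ := hq
      by_cases haP : a ∈ P <;> by_cases hbP : b ∈ P
      · refine Finset.mem_union_left _ (Finset.mem_union_left _ ?_)
        simpa [hA, haP, hbP] using hne
      · refine Finset.mem_union_left _ (Finset.mem_union_right _ ?_)
        simpa [hB, haP, hbP, hb] using hne
      · refine Finset.mem_union_right _ (Finset.mem_union_left _ (Finset.mem_image.2 ⟨(b, a), ?_,
          rfl⟩))
        rw [G.adj_comm] at hne
        simpa [hB, haP, hbP, ha] using hne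
      · refine Finset.mem_union_right _ (Finset.mem_union_right _ ?_)
        simp only [haP, hbP, if_false, Nat.add_right_cancel_iff] at hne
        simp only [hC, Finset.mem_filter, Finset.mem_product, Finset.mem_sdiff]
        exact ⟨⟨⟨ha, haP⟩, hb, hbP⟩, hne⟩
    -- Crossing pairs occur in both orders, so a part costs 3κd per vertex.
    have hcard : ((((A ∪ B) ∪ (B.image Prod.swap ∪ C)).card : ℕ) : ℝ) ≤
        (A.card + B.card) + (B.card + C.card) := by
      have h1 := Finset.card_union_le (A ∪ B) (B.image Prod.swap ∪ C)
      have h2 := Finset.card_union_le A B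
      have h3 := Finset.card_union_le (B.image Prod.swap) C
      have h4 : (B.image Prod.swap).card ≤ B.card := Finset.card_image_le
      have : ((A ∪ B) ∪ (B.image Prod.swap ∪ C)).card ≤
        (A.card + B.card) + (B.card + C.card) := by omega
      exact_mod_cast this
    refine (Nat.cast_le.2 (Finset.card_le_card hsub)).trans (hcard.trans ?_)
    have hXP : ((X \ P).card : ℝ) = X.card - P.card := by
      rw [Finset.card_sdiff_of_subset hPX, Nat.cast_sub (Finset.card_le_card hPX)]
    rw [hXP] at hp'
    linarith

end Structure

end

/-! ### Lowering the degrees of a collection. -/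

section

variable {U V : Type*}

/-- The blow-up collection of `H` with parts given by `p` and clusters given by `f`. -/
def collectionGraph (H : SimpleGraph U) (p : V → ℕ) (f : V → U) : SimpleGraph V where
  Adj u v := p u = p v ∧ H.Adj (f u) (f v)
  symm := ⟨fun _ _ h => ⟨h.1.symm, h.2.symm⟩⟩
  loopless := ⟨fun _ h => H.irrefl h.2⟩

/-- The graph obtained from `G` by deleting all edges that meet `Z`. -/
def isolate (G : SimpleGraph V) (Z : Finset V) : SimpleGraph V where
  Adj u v := u ∉ Z ∧ v ∉ Z ∧ G.Adj u v
  symm := ⟨fun _ _ h => ⟨h.2.1, h.1, h.2.2.symm⟩⟩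
  loopless := ⟨fun _ h => G.irrefl h.2.2⟩

variable [Fintype V]

theorem isBlowUpCollection_isolate (H : SimpleGraph U) (p : V → ℕ) (f : V → U) (Z : Finset V) :
    IsBlowUpCollection H (isolate (collectionGraph H p f) Z) := by
  rw [isBlowUpCollection_iff]
  -- Every isolated vertex gets an odd label of its own, so its cluster is irrelevant.
  refine ⟨fun v => if v ∈ Z then 2 * (Fintype.equivFin V v : ℕ) + 1 else 2 * p v, f,
    fun u v => ?_⟩
  simp only [isolate, collectionGraph]
  by_cases hu : u ∈ Z <;> by_cases hv : v ∈ Z <;> simp only [hu, hv, if_true, if_false]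
  · simp only [not_true_eq_false, false_and, false_iff, not_and]
    intro he
    have : u = v := (Fintype.equivFin V).injective (Fin.ext (by omega))
    rw [this]
    exact H.irrefl
  · simp only [not_true_eq_false, false_and, false_iff, not_and]
    intro he
    omega
  · simp only [not_true_eq_false, false_and, and_false, false_iff, not_and]
    intro he
    omega
  · simp

/-- The number of ordered pairs of vertices in whose adjacency `G` and `G'` differ. -/
noncomputable def mismatch (G G' : SimpleGraph V) : ℕ :=
  (Finset.univ.filter fun q : V × V => ¬ (G.Adj q.1 q.2 ↔ G'.Adj q.1 q.2)).card

theorem mismatch_triangle (G₁ G₂ G₃ : SimpleGraph V) :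
    mismatch G₁ G₃ ≤ mismatch G₁ G₂ + mismatch G₂ G₃ := by
  refine (Finset.card_le_card ?_).trans (Finset.card_union_le _ _)
  intro q hq
  simp only [Finset.mem_filter, Finset.mem_union, Finset.mem_univ, true_and] at hq ⊢
  by_contra! h
  exact hq (h.1.trans h.2)

theorem mismatch_isolate_le (G : SimpleGraph V) (Z : Finset V) :
    mismatch G (isolate G Z) ≤ 2 * ∑ v ∈ Z, deg G v := by
  set A := Z.biUnion fun v => (Finset.univ.filter (G.Adj v)).image fun x => (v, x) with hA
  have hAc : A.card ≤ ∑ v ∈ Z, deg G v :=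
    Finset.card_biUnion_le.trans (Finset.sum_le_sum fun v _ => Finset.card_image_le)
  have hsub : (Finset.univ.filter fun q : V × V =>
      ¬ (G.Adj q.1 q.2 ↔ (isolate G Z).Adj q.1 q.2)) ⊆ A ∪ A.image Prod.swap := by
    rintro ⟨a, b⟩ hq
    have hq : ¬ (G.Adj a b ↔ a ∉ Z ∧ b ∉ Z ∧ G.Adj a b) := (Finset.mem_filter.1 hq).2
    have hadj : G.Adj a b := by tauto
    by_cases ha : a ∈ Z
    · refine Finset.mem_union_left _ (Finset.mem_biUnion.2 ⟨a, ha, ?_⟩)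
      exact Finset.mem_image.2 ⟨b, by simpa using hadj, rfl⟩
    · have hb : b ∈ Z := by tauto
      refine Finset.mem_union_right _ (Finset.mem_image.2 ⟨(b, a), Finset.mem_biUnion.2
        ⟨b, hb, Finset.mem_image.2 ⟨a, by simpa using hadj.symm, rfl⟩⟩, rfl⟩)
  have h1 := (Finset.card_le_card hsub).trans (Finset.card_union_le _ _)
  have h2 : (A.image Prod.swap).card ≤ A.card := Finset.card_image_le
  unfold mismatch
  omega

theorem deg_le_add_mismatch (G G' : SimpleGraph V) (v : V) : deg G' v ≤
    deg G v + (Finset.univ.filter fun u => ¬ (G.Adj v u ↔ G'.Adj v u)).card := by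
  refine (Finset.card_le_card ?_).trans (Finset.card_union_le _ _)
  intro u hu
  simp only [Finset.mem_filter, Finset.mem_union, Finset.mem_univ, true_and] at hu ⊢
  tauto

theorem sum_card_mismatch (G G' : SimpleGraph V) :
    ∑ v, (Finset.univ.filter fun u => ¬ (G.Adj v u ↔ G'.Adj v u)).card = mismatch G G' := by
  simp_rw [mismatch, Finset.card_filter]
  rw [Fintype.sum_prod_type]

/-- Some vertices of the large clusters can be chosen such that every vertex of degree more than
`D` is adjacent to at least `r` of them. -/
theorem exists_trim [Nonempty U] [Fintype U] (H : SimpleGraph U) (p : V → ℕ) (f : V → U) {D r : ℕ}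
    (hD : 0 < D) (hr : ∀ n, D ≤ Fintype.card U * n → r ≤ n) :
    ∃ T : Finset V, T.card * D ≤ Fintype.card U * Fintype.card V * r ∧
      ∀ v, D < deg (collectionGraph H p f) v →
        r ≤ (Finset.univ.filter ((collectionGraph H p f).Adj v) ∩ T).card := by
  set C : ℕ × U → Finset V := fun q => Finset.univ.filter fun v => (p v, f v) = q with hC
  set Q := (Finset.univ.image fun v => (p v, f v)).filter fun q =>
    D ≤ Fintype.card U * (C q).card with hQ
  have hex : ∀ q, ∃ S, q ∈ Q → S ⊆ C q ∧ S.card = r := fun q => by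
    by_cases hq : q ∈ Q
    · obtain ⟨S, hS⟩ := Finset.exists_subset_card_eq (hr _ (Finset.mem_filter.1 hq).2)
      exact ⟨S, fun _ => hS⟩
    · exact ⟨∅, fun h => (hq h).elim⟩
  choose S hS using hex
  refine ⟨Q.biUnion S, ?_, fun v hv => ?_⟩
  · have h1 : (Q.biUnion S).card ≤ Q.card * r := by
      refine Finset.card_biUnion_le.trans ?_
      rw [← smul_eq_mul]
      exact Finset.sum_le_card_nsmul _ _ _ fun q hq => (hS q hq).2.le
    have h2 : Q.card * D ≤ Fintype.card U * Fintype.card V := by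
      calc Q.card * D = ∑ _q ∈ Q, D := by rw [Finset.sum_const, smul_eq_mul]
        _ ≤ ∑ q ∈ Q, Fintype.card U * (C q).card :=
          Finset.sum_le_sum fun q hq => (Finset.mem_filter.1 hq).2
        _ ≤ ∑ q ∈ Finset.univ.image fun v => (p v, f v), Fintype.card U * (C q).card :=
          Finset.sum_le_sum_of_subset (Finset.filter_subset _ _)
        _ = Fintype.card U * Fintype.card V := by
          rw [← Finset.mul_sum, ← Finset.card_univ (α := V)]
          congr 1
          exact (Finset.card_eq_sum_card_image _ _).symm
    calc (Q.biUnion S).card * D ≤ Q.card * r * D := Nat.mul_le_mul_right _ h1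
      _ = Q.card * D * r := by ring
      _ ≤ _ := Nat.mul_le_mul_right _ h2
  · have hu : ∃ u, H.Adj (f v) u ∧ D ≤ Fintype.card U * (C (p v, u)).card := by
      by_contra! hcon
      have hsub : Finset.univ.filter ((collectionGraph H p f).Adj v) ⊆
          (Finset.univ.filter (H.Adj (f v))).biUnion fun u => C (p v, u) := by
        intro x hx
        have hx : p v = p x ∧ H.Adj (f v) (f x) := (Finset.mem_filter.1 hx).2
        refine Finset.mem_biUnion.2 ⟨f x, by simpa using hx.2, ?_⟩
        simp [hC, hx.1]
      have h1 := (Finset.card_le_card hsub).trans Finset.card_biUnion_le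
      have h2 : Fintype.card U * ∑ u ∈ Finset.univ.filter (H.Adj (f v)), (C (p v, u)).card ≤
          Fintype.card U * D := by
        rw [Finset.mul_sum]
        refine (Finset.sum_le_card_nsmul _ _ D fun u hu => (hcon u ?_).le).trans ?_
        · simpa using hu
        · rw [smul_eq_mul]
          exact Nat.mul_le_mul_right _ (Finset.card_le_univ _)
      have h3 := Nat.le_of_mul_le_mul_left h2 Fintype.card_pos
      unfold deg at hv
      omega
    obtain ⟨u, hvu, hu⟩ := hu
    have hq : (p v, u) ∈ Q := by
      refine Finset.mem_filter.2 ⟨?_, hu⟩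
      obtain ⟨x, hx⟩ : (C (p v, u)).Nonempty := by
        rw [← Finset.card_pos]
        by_contra h0
        simp only [not_lt, nonpos_iff_eq_zero] at h0
        rw [h0] at hu
        omega
      exact Finset.mem_image.2 ⟨x, Finset.mem_univ _, by simpa [hC] using hx⟩
    rw [← (hS _ hq).2]
    refine Finset.card_le_card fun x hx => Finset.mem_inter.2 ⟨?_, Finset.mem_biUnion.2 ⟨_, hq, hx⟩⟩
    have hx' := (hS _ hq).1 hx
    simp only [hC, Finset.mem_filter, Finset.mem_univ, true_and, Prod.mk.injEq] at hx'
    refine Finset.mem_filter.2 ⟨Finset.mem_univ _, hx'.1.symm, ?_⟩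
    rw [hx'.2]
    exact hvu

theorem deg_isolate_le (G : SimpleGraph V) (Z T : Finset V) (hT : T ⊆ Z) (v : V) :
    deg (isolate G Z) v + (Finset.univ.filter (G.Adj v) ∩ T).card ≤ deg G v := by
  unfold deg
  rw [← Finset.card_sdiff_add_card_inter (Finset.univ.filter (G.Adj v)) T]
  refine Nat.add_le_add_right (Finset.card_le_card fun x hx => ?_) _
  have hx : v ∉ Z ∧ x ∉ Z ∧ G.Adj v x := (Finset.mem_filter.1 hx).2
  exact Finset.mem_sdiff.2 ⟨Finset.mem_filter.2 ⟨Finset.mem_univ _, hx.2.2⟩, fun h => hx.2.1 (hT h)⟩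

theorem deg_isolate_eq_zero (G : SimpleGraph V) {Z : Finset V} {v : V} (hv : v ∈ Z) :
    deg (isolate G Z) v = 0 := by
  unfold deg
  rw [Finset.card_eq_zero, Finset.filter_eq_empty_iff]
  rintro x - ⟨h, -⟩
  exact h hv

/-- Lowering the degrees of a blow-up collection that is close to a graph of low degree. -/
theorem exists_lowDegree_collection [Nonempty U] [Fintype U] {H : SimpleGraph U}
    {G : SimpleGraph V} {p : V → ℕ} {f : V → U} {d δ η b : ℝ} (hd : 0 < d) (hη : 0 < η)
    (hη1 : η ≤ 1) (hδ : δ = η / (64 * Fintype.card U)) (hb : 0 ≤ b)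
    (hdeg : ∀ v, (deg G v : ℝ) ≤ ⌊d⌋₊ + δ * d)
    (hmis : (mismatch G (collectionGraph H p f) : ℝ) ≤ b * d * Fintype.card V) :
    ∃ G' : SimpleGraph V, IsBlowUpCollection H G' ∧ (∀ v, deg G' v ≤ ⌊d⌋₊) ∧
      (mismatch G G' : ℝ) ≤ (η / 2 + 7 * b / δ) * d * Fintype.card V := by
  set G₀ := collectionGraph H p f with hG₀
  set D := ⌊d⌋₊ with hD
  set N := Fintype.card V with hN
  set h := Fintype.card U with hh
  have hh1 : (1 : ℝ) ≤ h := by exact_mod_cast (Fintype.card_pos : 0 < Fintype.card U)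
  have hδ0 : 0 < δ := by rw [hδ]; positivity
  have hδh : δ * h = η / 64 := by
    rw [hδ]
    field_simp
  have hδ1 : δ ≤ 1 / 64 := by nlinarith
  have hDd : (D : ℝ) ≤ d := Nat.floor_le hd.le
  -- Such a vertex is incident with more than δd mismatches, so there are few of them and they are
  -- isolated outright.
  set Viol := Finset.univ.filter fun v => (D : ℝ) + 2 * δ * d < deg G₀ v with hViol
  set diff : V → ℕ := fun v => (Finset.univ.filter fun u => ¬ (G.Adj v u ↔ G₀.Adj v u)).card
    with hdiff
  have hdd : ∀ v, (deg G₀ v : ℝ) ≤ deg G v + diff v := fun v => by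
    exact_mod_cast deg_le_add_mismatch G G₀ v
  have hsumdiff : ∑ v ∈ Viol, (diff v : ℝ) ≤ b * d * N := by
    refine le_trans ?_ hmis
    rw [← sum_card_mismatch, Nat.cast_sum]
    exact Finset.sum_le_sum_of_subset_of_nonneg (Finset.subset_univ _) fun _ _ _ => by positivity
  have hViolcard : (Viol.card : ℝ) * δ ≤ b * N := by
    have h1 : (Viol.card : ℝ) * (δ * d) ≤ b * d * N := by
      refine le_trans ?_ hsumdiff
      rw [← nsmul_eq_mul]
      refine Finset.card_nsmul_le_sum _ _ _ fun v hv => ?_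
      have h1 := (Finset.mem_filter.1 hv).2
      have h2 := hdd v
      have h3 := hdeg v
      linarith
    have : (Viol.card : ℝ) * δ * d ≤ b * N * d := by linarith
    exact le_of_mul_le_mul_right this hd
  have hViolsum : ∑ v ∈ Viol, (deg G₀ v : ℝ) ≤ 3 * b / δ * d * N := by
    calc ∑ v ∈ Viol, (deg G₀ v : ℝ) ≤ ∑ v ∈ Viol, (2 * d + diff v) := by
          refine Finset.sum_le_sum fun v _ => ?_
          have h2 := hdd v
          have h3 := hdeg v
          nlinarith
      _ = Viol.card * (2 * d) + ∑ v ∈ Viol, (diff v : ℝ) := by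
          rw [Finset.sum_add_distrib, Finset.sum_const, nsmul_eq_mul]
      _ ≤ (b * N / δ) * (2 * d) + (b * N / δ) * d := by
          have h1 : (Viol.card : ℝ) ≤ b * N / δ := by rwa [le_div_iff₀ hδ0]
          have h2 : b * d * N ≤ (b * N / δ) * d := by
            rw [div_mul_eq_mul_div, le_div_iff₀ hδ0]
            have : 0 ≤ b * d * N := by positivity
            nlinarith
          have h3 := mul_le_mul_of_nonneg_right h1 (by positivity : 0 ≤ 2 * d)
          linarith
      _ = _ := by ring
  obtain ⟨T, hTc, hT⟩ : ∃ T : Finset V, (T.card : ℝ) ≤ 8 * h * δ * N ∧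
      ∀ v, v ∉ Viol → D < deg G₀ v →
        deg G₀ v ≤ D + (Finset.univ.filter (G₀.Adj v) ∩ T).card := by
    -- Degrees are integers: with 2δd < 1 a vertex outside `Viol` already has degree at most `D`.
    -- Otherwise trimming must remove ⌈2δd⌉ neighbours from each remaining offender.
    by_cases hsmall : 2 * δ * d < 1
    · refine ⟨∅, by simp only [Finset.card_empty, Nat.cast_zero]; positivity, fun v hv hDv => ?_⟩
      simp only [hViol, Finset.mem_filter, Finset.mem_univ, true_and, not_lt] at hv
      have h1 : (D : ℝ) + 1 ≤ deg G₀ v := by exact_mod_cast hDv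
      linarith
    · push Not at hsmall
      have hd32 : 32 ≤ d := by nlinarith
      have hDd' : d < D + 1 := Nat.lt_floor_add_one d
      have hD0 : 0 < D := by
        have : (0 : ℝ) < D := by linarith
        exact_mod_cast this
      have hr1 : (⌈2 * δ * d⌉₊ : ℝ) ≤ 4 * δ * d := by
        have := Nat.ceil_lt_add_one (by positivity : 0 ≤ 2 * δ * d)
        linarith
      obtain ⟨T, hTc, hT⟩ := exists_trim H p f (r := ⌈2 * δ * d⌉₊) hD0 (fun n hn => by
        have hn' : (D : ℝ) ≤ h * n := by exact_mod_cast hn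
        have h1 : 4 * δ * d * h ≤ n * h := by
          have : 4 * δ * d * h = 4 * d * (δ * h) := by ring
          rw [this, hδh]
          nlinarith
        have : (⌈2 * δ * d⌉₊ : ℝ) ≤ n := hr1.trans (le_of_mul_le_mul_right h1 (by linarith))
        exact_mod_cast this)
      refine ⟨T, ?_, fun v hv hDv => ?_⟩
      · have h1 : (T.card : ℝ) * D ≤ h * N * ⌈2 * δ * d⌉₊ := by exact_mod_cast hTc
        have h2 : (T.card : ℝ) * (d / 2) ≤ (8 * h * δ * N) * (d / 2) := by
          calc (T.card : ℝ) * (d / 2) ≤ T.card * D := by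
                refine mul_le_mul_of_nonneg_left ?_ (by positivity)
                linarith
            _ ≤ h * N * ⌈2 * δ * d⌉₊ := h1
            _ ≤ h * N * (4 * δ * d) := mul_le_mul_of_nonneg_left hr1 (by positivity)
            _ = _ := by ring
        exact le_of_mul_le_mul_right h2 (by positivity)
      · simp only [hViol, Finset.mem_filter, Finset.mem_univ, true_and, not_lt] at hv
        have h1 := hT v hDv
        have h2 : (⌈2 * δ * d⌉₊ : ℝ) ≤ (Finset.univ.filter (G₀.Adj v) ∩ T).card := by
          exact_mod_cast h1
        have h3 := Nat.le_ceil (2 * δ * d)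
        have h4 : (deg G₀ v : ℝ) ≤ D + (Finset.univ.filter (G₀.Adj v) ∩ T).card := by linarith
        exact_mod_cast h4
  refine ⟨isolate G₀ (Viol ∪ T), isBlowUpCollection_isolate H p f _, fun v => ?_, ?_⟩
  · by_cases hv : v ∈ Viol
    · rw [deg_isolate_eq_zero G₀ (Finset.mem_union_left _ hv)]
      exact Nat.zero_le _
    · have h1 := deg_isolate_le G₀ (Viol ∪ T) T Finset.subset_union_right v
      by_cases hDv : D < deg G₀ v
      · have := hT v hv hDv
        omega
      · omega
  · have h1 : (mismatch G (isolate G₀ (Viol ∪ T)) : ℝ) ≤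
        mismatch G G₀ + 2 * ∑ v ∈ Viol ∪ T, (deg G₀ v : ℝ) := by
      have h1 := mismatch_triangle G G₀ (isolate G₀ (Viol ∪ T))
      have h2 := mismatch_isolate_le G₀ (Viol ∪ T)
      have : mismatch G (isolate G₀ (Viol ∪ T)) ≤
        mismatch G G₀ + 2 * ∑ v ∈ Viol ∪ T, deg G₀ v := by omega
      exact_mod_cast this
    have h2 : ∑ v ∈ Viol ∪ T, (deg G₀ v : ℝ) ≤ ∑ v ∈ Viol, (deg G₀ v : ℝ) + T.card * (2 * d) := by
      rw [← Finset.union_sdiff_self_eq_union, Finset.sum_union Finset.disjoint_sdiff]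
      refine add_le_add le_rfl ?_
      calc ∑ v ∈ T \ Viol, (deg G₀ v : ℝ) ≤ (T \ Viol).card • (2 * d) := by
            refine Finset.sum_le_card_nsmul _ _ _ fun v hv => ?_
            have hv' := (Finset.mem_sdiff.1 hv).2
            simp only [hViol, Finset.mem_filter, Finset.mem_univ, true_and, not_lt] at hv'
            nlinarith
        _ ≤ T.card * (2 * d) := by
            rw [nsmul_eq_mul]
            refine mul_le_mul_of_nonneg_right ?_ (by positivity)
            exact Nat.cast_le.2 (Finset.card_le_card Finset.sdiff_subset)
    have h3 : (T.card : ℝ) * (2 * d) ≤ η / 4 * d * N := by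
      calc (T.card : ℝ) * (2 * d) ≤ 8 * h * δ * N * (2 * d) :=
            mul_le_mul_of_nonneg_right hTc (by positivity)
        _ = 16 * (δ * h) * d * N := by ring
        _ = _ := by rw [hδh]; ring
    have h4 : b * d * N ≤ b / δ * d * N := by
      have : b ≤ b / δ := by
        rw [le_div_iff₀ hδ0]
        nlinarith
      gcongr
    calc _ ≤ b / δ * d * N + 2 * (3 * b / δ * d * N + η / 4 * d * N) := by linarith
      _ = _ := by ring

/-- Graphs of almost low degree with few minimal witnesses are close to blow-up collections of low
degree. -/
theorem exists_close_lowDegree_collection [Nonempty U] [Fintype U] (H : SimpleGraph U) {η : ℝ}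
    (hη : 0 < η) (hη1 : η ≤ 1) : ∃ δ γ : ℝ, 0 < δ ∧ δ ≤ 1 ∧ 0 < γ ∧
      ∀ {V : Type} [Fintype V] (G : SimpleGraph V) (d : ℝ), 0 < d →
        (∀ v, (deg G v : ℝ) ≤ ⌊d⌋₊ + δ * d) →
        (∀ u, 1 ≤ u → ((minimalTuples H G u).card : ℝ) ≤ γ * Fintype.card V * d ^ (u - 1)) →
        ∃ G' : SimpleGraph V, IsBlowUpCollection H G' ∧ (∀ v, deg G' v ≤ ⌊d⌋₊) ∧
          (mismatch G G' : ℝ) ≤ η * d * Fintype.card V := by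
  set h := Fintype.card U with hh
  have hh1 : (1 : ℝ) ≤ h := by exact_mod_cast (Fintype.card_pos : 0 < Fintype.card U)
  set δ := η / (64 * h) with hδ
  have hδ0 : 0 < δ := by positivity
  have hδ1 : δ ≤ 1 := by
    rw [hδ, div_le_one (by positivity)]
    linarith
  -- Closeness 5κ is amplified by 7/δ when degrees are lowered, and 35κ/δ = η/2.
  set κ := η * δ / 70 with hκ
  have hκ0 : 0 < κ := by positivity
  have hκ1 : κ ≤ 1 := by
    have : η * δ ≤ 1 := mul_le_one₀ hη1 hδ0.le hδ1
    rw [hκ]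
    linarith
  set S := ∑ w ∈ Finset.range (h + 2 + 1), (4 * (w : ℝ) ^ 2) ^ w with hS
  have hS0 : 0 < S + 1 := by
    have : 0 ≤ S := Finset.sum_nonneg fun _ _ => by positivity
    linarith
  refine ⟨δ, κ * (κ ^ 2 / 6) ^ (h + 1) / (S + 1), hδ0, hδ1, by positivity, ?_⟩
  intro V _ G d hd hdeg hmin
  have hdeg2 : ∀ v, (deg G v : ℝ) ≤ 2 * d := fun v => by
    have h1 := hdeg v
    have h2 := Nat.floor_le hd.le
    nlinarith
  have hbad := badWeight_nil_le hd (by positivity) hdeg2 hmin (h + 2)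
  obtain ⟨p, f, hpf⟩ := exists_close_collection (H := H) hd hκ0 hκ1 hdeg2 (by
    refine hbad.trans ?_
    rw [← hS, ← mul_div_assoc]
    refine div_le_div_of_nonneg_right ?_ hd.le
    calc S * (κ * (κ ^ 2 / 6) ^ (h + 1) / (S + 1) * Fintype.card V)
        = (S / (S + 1)) * (κ * (κ ^ 2 / 6) ^ (h + 1) * Fintype.card V) := by ring
      _ ≤ 1 * (κ * (κ ^ 2 / 6) ^ (h + 1) * Fintype.card V) := by
          refine mul_le_mul_of_nonneg_right ?_ (by positivity)
          rw [div_le_one hS0]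
          linarith
      _ = _ := by ring) Finset.univ
  have hmis : (mismatch G (collectionGraph H p f) : ℝ) ≤ (5 * κ) * d * Fintype.card V := by
    rw [Finset.univ_product_univ, Finset.card_univ] at hpf
    refine le_trans (Nat.cast_le.2 (Finset.card_le_card fun q hq => ?_)) (hpf.trans (by linarith))
    exact Finset.mem_filter.2 (Finset.mem_filter.1 hq)
  obtain ⟨G', h1, h2, h3⟩ := exists_lowDegree_collection hd hη hη1 hδ (by positivity) hdeg hmis
  refine ⟨G', h1, h2, h3.trans (le_of_eq ?_)⟩
  rw [hκ]
  field_simp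
  ring

end

/-! ### Nonadaptive tests as counting statements, and Chebyshev's inequality. -/

section

/-- There is a nonadaptive test with `q` queries and a uniform seed that rejects each graph in `Y`
with probability at most `α` and accepts each graph `G` with probability at most `β G`. -/
def HasTest (N q : ℕ) (Y : Set (SimpleGraph (Fin N))) (α : ℝ) (β : SimpleGraph (Fin N) → ℝ) :
    Prop :=
  ∃ (Ω : Type) (_ : Fintype Ω) (_ : Nonempty Ω) (query : Ω → Fin q → Fin N × Fin N)
    (acc : Ω → SimpleGraph (Fin N) → Prop),
    (∀ ω G G', (∀ i, G.Adj (query ω i).1 (query ω i).2 ↔ G'.Adj (query ω i).1 (query ω i).2) →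
      acc ω G → acc ω G') ∧
    (∀ G ∈ Y, ((Finset.univ.filter fun ω => ¬ acc ω G).card : ℝ) ≤ α * Fintype.card Ω) ∧
    ∀ G, ((Finset.univ.filter fun ω => acc ω G).card : ℝ) ≤ β G * Fintype.card Ω

theorem uniform_map_decide_apply {Ω : Type} [Fintype Ω] [Nonempty Ω] (P : Ω → Prop) (b : Bool) :
    ((PMF.uniformOfFintype Ω).map fun ω => decide (P ω)) b =
      ENNReal.ofReal (((Finset.univ.filter fun ω => decide (P ω) = b).card : ℝ) /
        Fintype.card Ω) := by
  rw [PMF.map_apply, tsum_fintype]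
  simp only [PMF.uniformOfFintype_apply]
  rw [← Finset.sum_filter, Finset.sum_const, nsmul_eq_mul, ENNReal.ofReal_div_of_pos
    (by exact_mod_cast Fintype.card_pos), ENNReal.ofReal_natCast, ENNReal.ofReal_natCast,
    ENNReal.div_eq_inv_mul, mul_comm]
  congr 3
  ext ω
  simp [eq_comm]

theorem HasTest.exists_isTester {N q : ℕ} {P : Set (SimpleGraph (Fin N))} {α ε : ℝ}
    {β : SimpleGraph (Fin N) → ℝ} (h : HasTest N q P α β) (hα : α < 1 / 3)
    (hβ : ∀ G, IsFarFrom ε P G → β G < 1 / 3) :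
    ∃ A : NonAdaptiveAlgorithm N q, A.IsTester ε P := by
  obtain ⟨Ω, _, _, query, acc, hloc, hY, hF⟩ := h
  -- The output sees only answers, so it accepts if some graph with these answers is accepted; by
  -- locality of `acc` this agrees with acceptance of the input.
  refine ⟨⟨Ω, PMF.uniformOfFintype Ω, query, fun ω ans => decide (∃ G : SimpleGraph (Fin N),
    (∀ i, decide (G.Adj (query ω i).1 (query ω i).2) = ans i) ∧ acc ω G)⟩, ?_⟩
  have hpos : (0 : ℝ) < Fintype.card Ω := by exact_mod_cast Fintype.card_pos
  have hrun : ∀ G b, (NonAdaptiveAlgorithm.run (q := q) ⟨Ω, PMF.uniformOfFintype Ω, query,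
      fun ω ans => decide (∃ G : SimpleGraph (Fin N),
        (∀ i, decide (G.Adj (query ω i).1 (query ω i).2) = ans i) ∧ acc ω G)⟩ G) b =
      ENNReal.ofReal (((Finset.univ.filter fun ω => decide (acc ω G) = b).card : ℝ) /
        Fintype.card Ω) := by
    intro G b
    rw [← uniform_map_decide_apply]
    unfold NonAdaptiveAlgorithm.run
    congr 2
    funext ω
    refine decide_eq_decide.2 ⟨?_, fun h => ⟨G, fun i => rfl, h⟩⟩
    rintro ⟨G', hG', h⟩
    refine hloc ω G' G (fun i => ?_) h
    simpa using hG' i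
  have hthird : ∀ x : ℝ, 2 / 3 < x → (2 / 3 : ENNReal) < ENNReal.ofReal x := by
    intro x hx
    have : (2 / 3 : ENNReal) = ENNReal.ofReal (2 / 3) := by
      rw [ENNReal.ofReal_div_of_pos (by norm_num)]
      norm_num
    rw [this]
    exact (ENNReal.ofReal_lt_ofReal_iff (by linarith)).2 hx
  have hcompl : ∀ G, ((Finset.univ.filter fun ω => acc ω G).card : ℝ) +
      (Finset.univ.filter fun ω => ¬ acc ω G).card = Fintype.card Ω := fun G => by
    rw [← Finset.card_univ]
    exact_mod_cast Finset.card_filter_add_card_filter_not (s := Finset.univ) fun ω => acc ω G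
  refine ⟨fun G hG => ?_, fun G hG => ?_⟩
  · rw [hrun]
    refine hthird _ ?_
    simp only [decide_eq_true_eq]
    rw [lt_div_iff₀ hpos]
    have h1 := hY G hG
    have h2 := hcompl G
    nlinarith
  · rw [hrun]
    refine hthird _ ?_
    simp only [decide_eq_false_iff_not]
    rw [lt_div_iff₀ hpos]
    have h1 := hF G
    have h2 := hcompl G
    have h3 := hβ G hG
    nlinarith

theorem HasTest.mono {N q : ℕ} {Y : Set (SimpleGraph (Fin N))} {α α' : ℝ}
    {β β' : SimpleGraph (Fin N) → ℝ} (h : HasTest N q Y α β) (hα : α ≤ α') (hβ : ∀ G, β G ≤ β' G) :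
    HasTest N q Y α' β' := by
  obtain ⟨Ω, i, j, query, acc, hloc, hY, hF⟩ := h
  exact ⟨Ω, i, j, query, acc, hloc,
    fun G hG => (hY G hG).trans (mul_le_mul_of_nonneg_right hα (by positivity)),
    fun G => (hF G).trans (mul_le_mul_of_nonneg_right (hβ G) (by positivity))⟩

theorem hasTest_trivial (N : ℕ) (Y : Set (SimpleGraph (Fin N))) : HasTest N 0 Y 0 fun _ => 1 :=
  ⟨Unit, inferInstance, inferInstance, fun _ i => i.elim0, fun _ _ => True,
    fun _ _ _ _ _ => trivial, fun _ _ => by simp, fun _ => by simp⟩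

/-- Two independent runs, accepting only if both do: wrong rejections add by the union bound,
acceptances multiply. -/
theorem HasTest.and {N q q' : ℕ} {Y : Set (SimpleGraph (Fin N))} {α α' : ℝ}
    {β β' : SimpleGraph (Fin N) → ℝ} (h : HasTest N q Y α β) (h' : HasTest N q' Y α' β') :
    HasTest N (q + q') Y (α + α') fun G => β G * β' G := by
  obtain ⟨Ω, _, _, query, acc, hloc, hY, hF⟩ := h
  obtain ⟨Ω', _, _, query', acc', hloc', hY', hF'⟩ := h'
  obtain ⟨acc₀, hacc⟩ : ∃ acc₀ : Ω × Ω' → SimpleGraph (Fin N) → Prop,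
    ∀ ω G, acc₀ ω G ↔ acc ω.1 G ∧ acc' ω.2 G := ⟨_, fun _ _ => Iff.rfl⟩
  refine ⟨Ω × Ω', inferInstance, inferInstance, fun ω => Fin.append (query ω.1) (query' ω.2),
    acc₀, ?_, ?_, ?_⟩
  · intro ω G G' hGG' h
    rw [hacc] at h ⊢
    obtain ⟨h1, h2⟩ := h
    refine ⟨hloc _ _ _ (fun i => ?_) h1, hloc' _ _ _ (fun i => ?_) h2⟩
    · simpa using hGG' (Fin.castAdd q' i)
    · simpa using hGG' (Fin.natAdd q i)
  · intro G hG
    refine (Nat.cast_le.2 (Finset.card_le_card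
      (t := ((Finset.univ.filter fun ω => ¬ acc ω G) ×ˢ Finset.univ) ∪
        (Finset.univ ×ˢ (Finset.univ.filter fun ω => ¬ acc' ω G))) fun ω hω => ?_)).trans
      ((Nat.cast_le.2 (Finset.card_union_le _ _)).trans ?_)
    · have hω := (Finset.mem_filter.1 hω).2
      rw [hacc] at hω
      simp only [Finset.mem_filter, Finset.mem_univ, true_and, Finset.mem_union,
        Finset.mem_product, and_true]
      tauto
    · rw [Finset.card_product, Finset.card_product, Finset.card_univ, Finset.card_univ,
        Fintype.card_prod, Nat.cast_mul, Nat.cast_add, Nat.cast_mul, Nat.cast_mul]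
      have h3 := mul_le_mul_of_nonneg_right (hY G hG) (Nat.cast_nonneg (Fintype.card Ω'))
      have h4 := mul_le_mul_of_nonneg_left (hY' G hG) (Nat.cast_nonneg (Fintype.card Ω))
      linarith
  · intro G
    refine (Nat.cast_le.2 (Finset.card_le_card
      (t := (Finset.univ.filter fun ω => acc ω G) ×ˢ (Finset.univ.filter fun ω => acc' ω G))
      fun ω hω => ?_)).trans ?_
    · have hω := (hacc _ _).1 (Finset.mem_filter.1 hω).2
      simpa using hω
    · rw [Finset.card_product, Fintype.card_prod, Nat.cast_mul, Nat.cast_mul]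
      refine (mul_le_mul (hF G) (hF' G) (by positivity)
        ((Nat.cast_nonneg _).trans (hF G))).trans (le_of_eq ?_)
      ring

theorem HasTest.prod {N n : ℕ} {q : ℕ → ℕ} {Y : Set (SimpleGraph (Fin N))} {α : ℕ → ℝ}
    {β : ℕ → SimpleGraph (Fin N) → ℝ} (h : ∀ i < n, HasTest N (q i) Y (α i) (β i)) :
    HasTest N (∑ i ∈ Finset.range n, q i) Y (∑ i ∈ Finset.range n, α i)
      fun G => ∏ i ∈ Finset.range n, β i G := by
  induction n with
  | zero => simpa using hasTest_trivial N Y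
  | succ n ih =>
    simp_rw [Finset.sum_range_succ, Finset.prod_range_succ]
    exact (ih fun i hi => h i (by omega)).and (h n (by omega))

theorem HasTest.pow {N q : ℕ} {Y : Set (SimpleGraph (Fin N))} {α : ℝ}
    {β : SimpleGraph (Fin N) → ℝ} (h : HasTest N q Y α β) (n : ℕ) :
    HasTest N (n * q) Y (n * α) fun G => β G ^ n := by
  simpa using HasTest.prod (n := n) fun _ _ => h

section Chebyshev

variable {V : Type*} [Fintype V]

theorem sum_pi_sum (g : V → ℝ) (hg : ∑ v, g v = 0) (l : ℕ) :
    ∑ x : Fin l → V, ∑ k, g (x k) = 0 := by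
  induction l with
  | zero => simp
  | succ l ih =>
    rw [← (Fin.consEquiv fun _ : Fin (l + 1) => V).sum_comp, Fintype.sum_prod_type]
    simp only [Fin.consEquiv, Equiv.coe_fn_mk, Fin.sum_univ_succ, Fin.cons_zero, Fin.cons_succ,
      Finset.sum_add_distrib, Finset.sum_const, ih, add_zero]
    rw [← Finset.smul_sum, hg, smul_zero]

/-- Cross terms vanish because `g` has mean zero. The factor `Fintype.card V` on the left avoids an
exponent `l - 1`. -/
theorem sum_pi_sum_sq (g : V → ℝ) (hg : ∑ v, g v = 0) (l : ℕ) :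
    (∑ x : Fin l → V, (∑ k, g (x k)) ^ 2) * Fintype.card V =
      l * (∑ v, g v ^ 2) * (Fintype.card V : ℝ) ^ l := by
  induction l with
  | zero => simp
  | succ l ih =>
    rw [← (Fin.consEquiv fun _ : Fin (l + 1) => V).sum_comp, Fintype.sum_prod_type]
    simp only [Fin.consEquiv, Equiv.coe_fn_mk, Fin.sum_univ_succ, Fin.cons_zero, Fin.cons_succ,
      add_sq, Finset.sum_add_distrib, Finset.sum_const, ← Finset.mul_sum, sum_pi_sum g hg,
      mul_zero, add_zero, nsmul_eq_mul, Finset.card_univ, Fintype.card_pi_const]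
    rw [add_mul, mul_assoc, mul_assoc, mul_assoc, ih]
    push_cast
    ring

/-- Chebyshev's inequality for the number of samples in `A`. -/
theorem card_chebyshev [DecidableEq V] (A : Finset V) (l : ℕ) {s : ℝ} (hs : 0 < s)
    (hV : 0 < Fintype.card V) {S : Finset (Fin l → V)}
    (hS : ∀ x ∈ S, s ≤ |((Finset.univ.filter fun k => x k ∈ A).card : ℝ) -
      l * (A.card / Fintype.card V)|) :
    (S.card : ℝ) ≤ l * (A.card / Fintype.card V) / s ^ 2 * (Fintype.card V : ℝ) ^ l := by
  have hN : (0 : ℝ) < Fintype.card V := by exact_mod_cast hV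
  set N : ℝ := (Fintype.card V : ℝ) with hNdef
  set g : V → ℝ := fun v => (if v ∈ A then 1 else 0) - A.card / N with hg
  have hsum : ∑ v, (if v ∈ A then (1 : ℝ) else 0) = A.card := by simp
  have hg0 : ∑ v, g v = 0 := by
    simp only [hg, Finset.sum_sub_distrib, hsum, Finset.sum_const, Finset.card_univ, nsmul_eq_mul]
    rw [← hNdef]
    field_simp
    ring
  have hg2 : ∑ v, g v ^ 2 ≤ A.card := by
    have hexp : ∀ v, g v ^ 2 = (if v ∈ A then (1 : ℝ) else 0) -
        2 * (A.card / N) * (if v ∈ A then (1 : ℝ) else 0) + (A.card / N) ^ 2 := by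
      intro v
      simp only [hg]
      split_ifs <;> ring
    simp only [hexp, Finset.sum_add_distrib, Finset.sum_sub_distrib, ← Finset.mul_sum, hsum,
      Finset.sum_const, Finset.card_univ, nsmul_eq_mul]
    rw [← hNdef]
    have : N * ((A.card : ℝ) / N) ^ 2 = (A.card / N) * A.card := by
      field_simp
    rw [this]
    have : 0 ≤ (A.card : ℝ) / N * A.card := by positivity
    linarith
  have hx : ∀ x : Fin l → V, ((Finset.univ.filter fun k => x k ∈ A).card : ℝ) - l * (A.card / N) =
      ∑ k, g (x k) := by
    intro x
    simp only [hg, Finset.sum_sub_distrib, Finset.sum_const, Finset.card_univ, nsmul_eq_mul,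
      Fintype.card_fin]
    simp
  have h1 : (S.card : ℝ) * s ^ 2 ≤ ∑ x : Fin l → V, (∑ k, g (x k)) ^ 2 := by
    rw [← nsmul_eq_mul]
    refine (Finset.card_nsmul_le_sum S _ _ fun x hxS => ?_).trans
      (Finset.sum_le_sum_of_subset_of_nonneg (Finset.subset_univ S) fun _ _ _ => by positivity)
    rw [← hx, ← sq_abs (_ - _)]
    exact pow_le_pow_left₀ hs.le (hS x hxS) 2
  have h2 := sum_pi_sum_sq g hg0 l
  rw [← hNdef] at h2
  have h3 : (S.card : ℝ) * s ^ 2 * N ≤ l * A.card * N ^ l := by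
    calc (S.card : ℝ) * s ^ 2 * N ≤ _ := mul_le_mul_of_nonneg_right h1 hN.le
      _ = _ := h2
      _ ≤ _ := by gcongr
  have h4 : (l : ℝ) * (A.card / N) / s ^ 2 * N ^ l = l * A.card * N ^ l / (s ^ 2 * N) := by
    field_simp
  rw [h4, le_div_iff₀ (by positivity)]
  linarith

end Chebyshev

end

/-! ### Testing for vertices of large degree. -/

section

theorem card_filter_prod {A B : Type*} [Fintype A] [Fintype B] (P : A × B → Prop)
    [DecidablePred P] :
    (Finset.univ.filter P).card = ∑ a, (Finset.univ.filter fun b => P (a, b)).card := by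
  simp_rw [Finset.card_filter]
  rw [Fintype.sum_prod_type]

/-- The graphs on `N` vertices of maximum degree at most `D`. -/
def lowDegreeGraphs (N D : ℕ) : Set (SimpleGraph (Fin N)) := {G | ∀ v, deg G v ≤ D}

/-- Estimating the degree of a random vertex from `l` samples. -/
theorem hasTest_degree {N l D : ℕ} {d g α ρ : ℝ} (hN : 0 < N) (hl : 0 < l) (hg : 0 < g)
    (hDd : (D : ℝ) ≤ d) (hα : 4 * d * N ≤ α * l * g ^ 2) (hρ : 8 * N * (D + g) ≤ l * g ^ 2) :
    HasTest N l (lowDegreeGraphs N D) α fun G =>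
      if ρ * N ≤ ((Finset.univ.filter fun v => (D : ℝ) + g ≤ deg G v).card : ℝ) then 1 - ρ / 2
      else 1 := by
  have : Nonempty (Fin N) := ⟨⟨0, hN⟩⟩
  -- The threshold lies halfway between the expected counts for the degrees `D` and `D + g`.
  obtain ⟨acc, hacc⟩ : ∃ acc : Fin N × (Fin l → Fin N) → SimpleGraph (Fin N) → Prop,
      ∀ ω G, acc ω G ↔ ((Finset.univ.filter fun k => ω.2 k ∈
        Finset.univ.filter (G.Adj ω.1)).card : ℝ) ≤ l * (D + g / 2) / N :=
    ⟨_, fun _ _ => Iff.rfl⟩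
  have hN' : (0 : ℝ) < N := by exact_mod_cast hN
  have hl' : (0 : ℝ) < l := by exact_mod_cast hl
  have hcard : Fintype.card (Fin N) = N := Fintype.card_fin N
  have hΩ : (Fintype.card (Fin N × (Fin l → Fin N)) : ℝ) = N * (N : ℝ) ^ l := by
    simp
  refine ⟨Fin N × (Fin l → Fin N), inferInstance, inferInstance, fun ω k => (ω.1, ω.2 k), acc,
    ?_, ?_, ?_⟩
  · intro ω G G' h
    rw [hacc, hacc]
    have : (Finset.univ.filter fun k => ω.2 k ∈ Finset.univ.filter (G.Adj ω.1)) =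
        Finset.univ.filter fun k => ω.2 k ∈ Finset.univ.filter (G'.Adj ω.1) := by
      ext k
      simpa using h k
    rw [this]
    exact id
  · intro G hG
    rw [hΩ, card_filter_prod, Nat.cast_sum]
    have hv : ∀ v ∈ Finset.univ, ((Finset.univ.filter fun x => ¬ acc (v, x) G).card : ℝ) ≤
        α * (N : ℝ) ^ l := by
      intro v _
      have hdv : (deg G v : ℝ) ≤ D := by exact_mod_cast hG v
      refine (card_chebyshev (Finset.univ.filter (G.Adj v)) l (s := l * (g / 2) / N)
        (by positivity) (by rw [hcard]; exact hN) ?_).trans ?_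
      · intro x hx
        have hx' := (Finset.mem_filter.1 hx).2
        rw [hacc, not_le] at hx'
        refine le_trans ?_ (le_abs_self _)
        rw [hcard]
        have h1 : (l : ℝ) * ((deg G v : ℝ) / N) ≤ l * (D / N) := by gcongr
        have h2 : (l : ℝ) * (D + g / 2) / N = l * (D / N) + l * (g / 2) / N := by ring
        unfold deg at h1
        change _ < ((Finset.univ.filter fun k => x k ∈ Finset.univ.filter (G.Adj v)).card : ℝ) at hx'
        linarith
      · rw [hcard]
        refine mul_le_mul_of_nonneg_right ?_ (by positivity)
        change (l : ℝ) * ((deg G v : ℝ) / N) / (l * (g / 2) / N) ^ 2 ≤ α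
        have h1 : (l : ℝ) * ((deg G v : ℝ) / N) / (l * (g / 2) / N) ^ 2 =
            4 * deg G v * N / (l * g ^ 2) := by
          field_simp
          ring
        rw [h1, div_le_iff₀ (by positivity)]
        have : 4 * (deg G v : ℝ) * N ≤ 4 * d * N := by
          have := hdv.trans hDd
          gcongr
        linarith
    refine (Finset.sum_le_card_nsmul _ _ _ hv).trans (le_of_eq ?_)
    rw [Finset.card_univ, hcard, nsmul_eq_mul]
    ring
  · intro G
    set S := Finset.univ.filter fun v => (D : ℝ) + g ≤ deg G v with hS
    rw [hΩ]
    have hle : ∀ v, ((Finset.univ.filter fun x => acc (v, x) G).card : ℝ) ≤ (N : ℝ) ^ l := fun v => by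
      have := Finset.card_le_univ (Finset.univ.filter fun x => acc (v, x) G)
      rw [Fintype.card_pi_const, hcard] at this
      exact_mod_cast this
    have hhalf : ∀ v ∈ S, ((Finset.univ.filter fun x => acc (v, x) G).card : ℝ) ≤
        (N : ℝ) ^ l - (N : ℝ) ^ l / 2 := by
      intro v hv
      have hdv : (D : ℝ) + g ≤ deg G v := (Finset.mem_filter.1 hv).2
      set e : ℝ := (deg G v : ℝ) with he
      set y := e - (D + g / 2) with hy
      have hyg : g / 2 ≤ y := by linarith
      have hy0 : 0 < y := by linarith
      refine (card_chebyshev (Finset.univ.filter (G.Adj v)) l (s := l * y / N)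
        (by positivity) (by rw [hcard]; exact hN) ?_).trans ?_
      · intro x hx
        have hx' := (Finset.mem_filter.1 hx).2
        rw [hacc] at hx'
        refine le_trans ?_ (neg_le_abs _)
        rw [hcard]
        change _ ≤ -(_ - (l : ℝ) * (e / N))
        have h2 : (l : ℝ) * y / N = l * (e / N) - l * (D + g / 2) / N := by
          rw [hy]
          ring
        change ((Finset.univ.filter fun k => x k ∈ Finset.univ.filter (G.Adj v)).card : ℝ) ≤ _ at hx'
        linarith
      · rw [hcard]
        change (l : ℝ) * ((deg G v : ℝ) / N) / (l * y / N) ^ 2 * (N : ℝ) ^ l ≤ _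
        have h1 : (l : ℝ) * ((deg G v : ℝ) / N) / (l * y / N) ^ 2 = e * N / (l * y ^ 2) := by
          field_simp
          rw [he]
        have h2 : e * N / (l * y ^ 2) ≤ 1 / 2 := by
          rw [div_le_iff₀ (by positivity)]
          -- Measured in units g/2, the excess `y` is at least 1. The variance grows at most
          -- linearly and the squared deviation quadratically in it, so the degree D + g is the
          -- worst case.
          set lam := 2 * y / g with hlam
          have hyl : y = lam * (g / 2) := by
            rw [hlam]
            field_simp
          have hl1 : 1 ≤ lam := by
            rw [hlam, le_div_iff₀ hg]
            linarith
          have h3 : e ≤ lam * (D + g) := by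
            have : e = D + g / 2 + lam * (g / 2) := by rw [← hyl, hy]; ring
            have hD : (0 : ℝ) ≤ D := Nat.cast_nonneg D
            nlinarith
          have h4 : lam ≤ lam ^ 2 := by nlinarith
          have h5 : e * N ≤ lam * (D + g) * N := mul_le_mul_of_nonneg_right h3 hN'.le
          have h6 : lam * (8 * N * (D + g)) ≤ lam ^ 2 * (l * g ^ 2) :=
            mul_le_mul h4 hρ (by positivity) (by positivity)
          have h7 : (l : ℝ) * y ^ 2 = lam ^ 2 * (l * g ^ 2) / 4 := by
            rw [hyl]
            ring
          rw [h7]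
          linarith
        rw [h1]
        have h3 := mul_le_mul_of_nonneg_right h2 (by positivity : (0 : ℝ) ≤ (N : ℝ) ^ l)
        linarith
    rw [card_filter_prod, Nat.cast_sum]
    have hsum : ∑ v, ((Finset.univ.filter fun x => acc (v, x) G).card : ℝ) ≤
        ∑ v, ((N : ℝ) ^ l - if v ∈ S then (N : ℝ) ^ l / 2 else 0) := by
      refine Finset.sum_le_sum fun v _ => ?_
      split_ifs with hv
      · exact hhalf v hv
      · rw [sub_zero]
        exact hle v
    refine hsum.trans ?_
    have hval : ∑ v : Fin N, ((N : ℝ) ^ l - if v ∈ S then (N : ℝ) ^ l / 2 else 0) =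
        N * (N : ℝ) ^ l - S.card * ((N : ℝ) ^ l / 2) := by
      rw [Finset.sum_sub_distrib, Finset.sum_const, Finset.card_univ, hcard, nsmul_eq_mul,
        Finset.sum_ite_mem, Finset.univ_inter, Finset.sum_const, nsmul_eq_mul]
    rw [hval]
    dsimp only
    have hp : (0 : ℝ) ≤ (N : ℝ) ^ l := by positivity
    split_ifs with hc
    · have := mul_le_mul_of_nonneg_right hc (by positivity : (0 : ℝ) ≤ (N : ℝ) ^ l / 2)
      linarith
    · have : 0 ≤ (S.card : ℝ) * ((N : ℝ) ^ l / 2) := by positivity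
      linarith

/-- Since (1 - x)(1 + x) ≤ 1, Bernoulli's inequality bounds the power by 1 / (1 + ax). -/
theorem one_sub_pow_le {x : ℝ} (hx0 : 0 ≤ x) (hx1 : x ≤ 1) {a : ℕ} (ha : 4 ≤ a * x) :
    (1 - x) ^ a ≤ 1 / 4 := by
  have h1 : 1 + (a : ℝ) * x ≤ (1 + x) ^ a := one_add_mul_le_pow (by linarith) a
  have h2 : (1 - x) ^ a * (1 + x) ^ a ≤ 1 := by
    rw [← mul_pow]
    exact pow_le_one₀ (by nlinarith) (by nlinarith)
  have h3 : 0 ≤ (1 - x) ^ a := pow_nonneg (by linarith) a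
  nlinarith

/-- Detecting many vertices of degree at least `D + δ d θ ^ j`, where `d = c ε N` and
`D = ⌊d⌋`. -/
theorem exists_hasTest_level {c δ ρ : ℝ} (hc : 1 < c) (hδ : 0 < δ) (hδ1 : δ ≤ 1) (hρ : 0 < ρ)
    (hρ1 : ρ ≤ 1) : ∃ C : ℝ, 0 ≤ C ∧ ∀ ε θ : ℝ, 0 < ε → 1 ≤ θ → θ ^ 4 * ε = 1 → ∀ j ≤ 4, ∃ q : ℕ,
      (q : ℝ) ≤ C * θ ^ 6 ∧ ∀ N : ℕ, 1 ≤ N →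
        HasTest N q (lowDegreeGraphs N ⌊c * ε * N⌋₊) (1 / 100) fun G =>
          if ρ / θ ^ (j + 1) * N ≤ ((Finset.univ.filter fun v =>
            (⌊c * ε * N⌋₊ : ℝ) + δ * (c * ε * N) * θ ^ j ≤ deg G v).card : ℝ) then 1 / 4 else 1 := by
  set K := 3600 / (ρ * δ ^ 2) with hK
  have hK1 : 1 ≤ K := by
    rw [hK, le_div_iff₀ (by positivity)]
    have : ρ * δ ^ 2 ≤ 1 := mul_le_one₀ hρ1 (by positivity) (pow_le_one₀ hδ.le hδ1)
    linarith
  refine ⟨18 * K / ρ, by positivity, fun ε θ hε hθ hθε j hj => ?_⟩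
  have hθ0 : 0 < θ := by linarith
  have hθj : ∀ i, 1 ≤ θ ^ i := fun i => one_le_pow₀ hθ
  -- The test is repeated for `a` random vertices with `l` samples each. Higher levels are rarer but
  -- easier to recognise, so the exponents j + 1 and 5 - j always add up to 6.
  set a := ⌈8 * θ ^ (j + 1) / ρ⌉₊ with ha
  set l := ⌈K * θ ^ (5 - j)⌉₊ with hl
  have ha1 : 8 * θ ^ (j + 1) / ρ ≤ a := Nat.le_ceil _
  have ha2 : (a : ℝ) ≤ 9 * θ ^ (j + 1) / ρ := by
    have h1 := Nat.ceil_lt_add_one (by positivity : 0 ≤ 8 * θ ^ (j + 1) / ρ)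
    have h2 : 1 ≤ θ ^ (j + 1) / ρ := by
      rw [le_div_iff₀ hρ, one_mul]
      exact hρ1.trans (hθj _)
    have h3 : 9 * θ ^ (j + 1) / ρ = 8 * θ ^ (j + 1) / ρ + θ ^ (j + 1) / ρ := by ring
    linarith
  have hl1 : K * θ ^ (5 - j) ≤ l := Nat.le_ceil _
  have hl2 : (l : ℝ) ≤ 2 * (K * θ ^ (5 - j)) := by
    have h1 := Nat.ceil_lt_add_one (by positivity : 0 ≤ K * θ ^ (5 - j))
    have h2 : 1 ≤ K * θ ^ (5 - j) := one_le_mul_of_one_le_of_one_le hK1 (hθj _)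
    linarith
  have hl0 : 0 < l := Nat.ceil_pos.2 (by positivity)
  have ha0 : 0 < a := Nat.ceil_pos.2 (by positivity)
  have ha0' : (0 : ℝ) < a := by exact_mod_cast ha0
  refine ⟨a * l, ?_, fun N hN => ?_⟩
  · rw [Nat.cast_mul]
    calc (a : ℝ) * l ≤ (9 * θ ^ (j + 1) / ρ) * (2 * (K * θ ^ (5 - j))) :=
          mul_le_mul ha2 hl2 (by positivity) (by positivity)
      _ = 18 * K / ρ * (θ ^ (j + 1) * θ ^ (5 - j)) := by ring
      _ = _ := by
          rw [← pow_add]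
          congr 2
          omega
  set d := c * ε * N with hd
  have hN0 : (0 : ℝ) < N := by exact_mod_cast hN
  have hd0 : 0 < d := by positivity
  have hDd : (⌊d⌋₊ : ℝ) ≤ d := Nat.floor_le hd0.le
  have hNd : (N : ℝ) ≤ d * θ ^ 4 := by
    have : d * θ ^ 4 = c * N * (θ ^ 4 * ε) := by rw [hd]; ring
    rw [this, hθε, mul_one]
    nlinarith
  have hlg : 3600 * θ ^ (j + 5) * d ^ 2 / ρ ≤ l * (δ * d * θ ^ j) ^ 2 := by
    have h1 := mul_le_mul_of_nonneg_right hl1 (by positivity : 0 ≤ (δ * d * θ ^ j) ^ 2)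
    refine le_trans (le_of_eq ?_) h1
    have h2 : θ ^ (j + 5) = θ ^ (5 - j) * θ ^ j * θ ^ j := by
      rw [← pow_add, ← pow_add]
      congr 1
      omega
    rw [h2, hK]
    field_simp
  have htest := hasTest_degree (N := N) (l := l) (D := ⌊d⌋₊) (d := d) (g := δ * d * θ ^ j)
    (α := 1 / (100 * a)) (ρ := ρ / θ ^ (j + 1)) (by omega) hl0 (by positivity) hDd (by
      have h1 : 1 / (100 * (a : ℝ)) * l * (δ * d * θ ^ j) ^ 2 =
          l * (δ * d * θ ^ j) ^ 2 / (100 * a) := by ring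
      rw [h1, le_div_iff₀ (by positivity)]
      refine le_trans ?_ hlg
      calc 4 * d * N * (100 * a) ≤ 4 * d * (d * θ ^ 4) * (100 * (9 * θ ^ (j + 1) / ρ)) := by
            gcongr
        _ = _ := by
            rw [show θ ^ (j + 5) = θ ^ (j + 1) * θ ^ 4 by rw [← pow_add]]
            ring) (by
      refine le_trans ?_ hlg
      have h1 : (⌊d⌋₊ : ℝ) + δ * d * θ ^ j ≤ 2 * d * θ ^ j := by
        have h2 : d ≤ d * θ ^ j := le_mul_of_one_le_right hd0.le (hθj j)
        have h3 : δ * (d * θ ^ j) ≤ d * θ ^ j := mul_le_of_le_one_left (by positivity) hδ1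
        linarith
      calc 8 * N * (⌊d⌋₊ + δ * d * θ ^ j) ≤ 8 * (d * θ ^ 4) * (2 * d * θ ^ j) := by gcongr
        _ = 16 * θ ^ (j + 4) * d ^ 2 := by rw [pow_add]; ring
        _ ≤ 3600 * θ ^ (j + 5) * d ^ 2 := by
            have : θ ^ (j + 4) ≤ θ ^ (j + 5) := pow_le_pow_right₀ hθ (by omega)
            gcongr
            norm_num
        _ ≤ _ := by
            rw [le_div_iff₀ hρ]
            exact mul_le_of_le_one_right (by positivity) hρ1)
  refine (htest.pow a).mono (le_of_eq (by field_simp)) fun G => ?_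
  split_ifs with hG
  · have hx : ρ / θ ^ (j + 1) / 2 ≤ 1 := by
      rw [div_div, div_le_one (by positivity)]
      have := hθj (j + 1)
      linarith
    refine one_sub_pow_le (by positivity) hx ?_
    have h1 := mul_le_mul_of_nonneg_right ha1 (by positivity : 0 ≤ ρ / θ ^ (j + 1) / 2)
    refine le_trans (le_of_eq ?_) h1
    field_simp
    ring
  · rw [one_pow]

end

/-! ### Second moment method for block samples. -/

section

section SecondMoment

variable {V : Type*} [Fintype V]

theorem card_agree {J : Type*} [Fintype J] [DecidableEq J] (F : Finset J) (g : J → V)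
    [DecidablePred fun ω : J → V => ∀ j ∈ F, ω j = g j]
    (hV : 0 < Fintype.card V) : ((Finset.univ.filter fun ω : J → V => ∀ j ∈ F, ω j = g j).card : ℝ) =
      (Fintype.card V : ℝ) ^ Fintype.card J / (Fintype.card V : ℝ) ^ F.card := by
  have hN : (0 : ℝ) < Fintype.card V := by exact_mod_cast hV
  have h1 : (Finset.univ.filter fun ω : J → V => ∀ j ∈ F, ω j = g j) =
      Fintype.piFinset fun j => if j ∈ F then {g j} else Finset.univ := by
    ext ω
    simp only [Finset.mem_filter, Finset.mem_univ, true_and, Fintype.mem_piFinset]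
    refine forall_congr' fun j => ?_
    split_ifs with h <;> simp [h]
  have h2 : ∀ j, (if j ∈ F then ({g j} : Finset V) else Finset.univ).card =
      if j ∈ F then 1 else Fintype.card V := fun j => by split_ifs <;> simp
  have h3 : Fᶜ.card + F.card = Fintype.card J := Finset.card_compl_add_card F
  rw [h1, Fintype.card_piFinset, eq_div_iff (by positivity)]
  simp_rw [h2]
  rw [Finset.prod_ite, Finset.prod_const_one, Finset.prod_const, one_mul, ← h3]
  have h4 : (Finset.univ.filter fun j => j ∉ F) = Fᶜ := by
    ext
    simp
  rw [h4, pow_add]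
  push_cast
  ring

variable [DecidableEq V] {u W m : ℕ}

/-- The positions of a block sample that are selected by `a`. -/
def slot (hu : u ≤ W) (a : Fin u → Fin m) (k : Fin u) : Fin W × Fin m := (Fin.castLE hu k, a k)

theorem slot_eq_iff (hu : u ≤ W) (a a' : Fin u → Fin m) (k k' : Fin u) :
    slot hu a k = slot hu a' k' ↔ k = k' ∧ a k = a' k' := by
  simp [slot, Prod.ext_iff, Fin.ext_iff]

theorem card_slot_eq (hu : u ≤ W) (a : Fin u → Fin m) (b : Fin u → V) (hV : 0 < Fintype.card V) :
    ((Finset.univ.filter fun ω : Fin W × Fin m → V => ω ∘ slot hu a = b).card : ℝ) =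
      (Fintype.card V : ℝ) ^ (W * m) / (Fintype.card V : ℝ) ^ u := by
  have : Nonempty V := Fintype.card_pos_iff.1 hV
  have hinj : Function.Injective (slot hu a) := fun k k' h => ((slot_eq_iff hu a a k k').1 h).1
  have h := card_agree (Finset.univ.image (slot hu a))
    (Function.extend (slot hu a) b fun _ => Classical.arbitrary V) hV
  rw [Finset.card_image_of_injective _ hinj, Finset.card_univ, Fintype.card_fin, Fintype.card_prod,
    Fintype.card_fin, Fintype.card_fin] at h
  rw [← h]
  congr 2
  ext ω
  simp [funext_iff, hinj.extend_apply]

/-- Slots with different coordinates lie in different blocks, so two selections share exactly the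
slots where they agree. Two hits therefore fix 2u - |K| sample positions and coincide on `K`. -/
theorem card_slot_slot_le (hu : u ≤ W) (a a' : Fin u → Fin m) (B : Finset (Fin u → V))
    (hV : 0 < Fintype.card V) {b : Fin u → V} :
    ((Finset.univ.filter fun ω : Fin W × Fin m → V =>
      ω ∘ slot hu a = b ∧ ω ∘ slot hu a' ∈ B).card : ℝ) ≤
      (B.filter fun b' => ∀ k ∈ Finset.univ.filter (fun k => a k = a' k), b' k = b k).card *
      ((Fintype.card V : ℝ) ^ (W * m) * (Fintype.card V : ℝ) ^
        (Finset.univ.filter fun k => a k = a' k).card / (Fintype.card V : ℝ) ^ (2 * u)) := by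
  set K := Finset.univ.filter fun k => a k = a' k with hK
  set N : ℝ := (Fintype.card V : ℝ) with hN
  have hN0 : 0 < N := by rw [hN]; exact_mod_cast hV
  have hinj : ∀ a : Fin u → Fin m, Function.Injective (slot hu a) := fun a k k' h =>
    ((slot_eq_iff hu a a k k').1 h).1
  have hsub : (Finset.univ.filter fun ω : Fin W × Fin m → V =>
      ω ∘ slot hu a = b ∧ ω ∘ slot hu a' ∈ B) ⊆
      (B.filter fun b' => ∀ k ∈ K, b' k = b k).biUnion fun b' =>
        Finset.univ.filter fun ω => ω ∘ slot hu a = b ∧ ω ∘ slot hu a' = b' := by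
    intro ω hω
    simp only [Finset.mem_filter, Finset.mem_univ, true_and] at hω
    simp only [Finset.mem_biUnion, Finset.mem_filter, Finset.mem_univ, true_and]
    refine ⟨_, ⟨hω.2, fun k hk => ?_⟩, hω.1, rfl⟩
    have hk' : a k = a' k := by simpa [hK] using hk
    rw [← hω.1]
    simp [slot, hk']
  refine (Nat.cast_le.2 ((Finset.card_le_card hsub).trans Finset.card_biUnion_le)).trans ?_
  rw [Nat.cast_sum, ← nsmul_eq_mul]
  refine Finset.sum_le_card_nsmul _ _ _ fun b' _ => ?_
  rcases (Finset.univ.filter fun ω : Fin W × Fin m → V =>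
    ω ∘ slot hu a = b ∧ ω ∘ slot hu a' = b').eq_empty_or_nonempty with he | ⟨ω₀, hω₀⟩
  · rw [he, Finset.card_empty, Nat.cast_zero]
    positivity
  simp only [Finset.mem_filter, Finset.mem_univ, true_and] at hω₀
  set F := Finset.univ.image (slot hu a) ∪ Finset.univ.image (slot hu a') with hF
  have hFc : F.card + K.card = 2 * u := by
    have h1 : Finset.univ.image (slot hu a) ∩ Finset.univ.image (slot hu a') =
        K.image (slot hu a) := by
      ext j
      simp only [Finset.mem_inter, Finset.mem_image, Finset.mem_univ, true_and, hK,
        Finset.mem_filter]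
      constructor
      · rintro ⟨⟨k, rfl⟩, k', h⟩
        obtain ⟨rfl, h⟩ := (slot_eq_iff _ _ _ _ _).1 h
        exact ⟨k', h.symm, rfl⟩
      · rintro ⟨k, h, rfl⟩
        exact ⟨⟨k, rfl⟩, k, (slot_eq_iff _ _ _ _ _).2 ⟨rfl, h.symm⟩⟩
    have h2 := Finset.card_union_add_card_inter (Finset.univ.image (slot hu a))
      (Finset.univ.image (slot hu a'))
    rw [h1, Finset.card_image_of_injective _ (hinj a), Finset.card_image_of_injective _ (hinj a),
      Finset.card_image_of_injective _ (hinj a'), Finset.card_univ, Fintype.card_fin, ← hF] at h2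
    omega
  refine (Nat.cast_le.2 (Finset.card_le_card (t := Finset.univ.filter fun ω =>
    ∀ j ∈ F, ω j = ω₀ j) fun ω hω => ?_)).trans ?_
  · simp only [Finset.mem_filter, Finset.mem_univ, true_and] at hω ⊢
    intro j hj
    rcases Finset.mem_union.1 hj with hj | hj
    · obtain ⟨k, -, rfl⟩ := Finset.mem_image.1 hj
      exact (congrFun hω.1 k).trans (congrFun hω₀.1 k).symm
    · obtain ⟨k, -, rfl⟩ := Finset.mem_image.1 hj
      exact (congrFun hω.2 k).trans (congrFun hω₀.2 k).symm
  · rw [card_agree F ω₀ hV, Fintype.card_prod, Fintype.card_fin, Fintype.card_fin, ← hN,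
      div_le_div_iff₀ (by positivity) (by positivity), ← hFc, pow_add]
    exact le_of_eq (by ring)

theorem card_agreement_pairs (u m : ℕ) (K : Finset (Fin u)) (hm : 0 < m) :
    ((Finset.univ.filter fun q : (Fin u → Fin m) × (Fin u → Fin m) =>
      (Finset.univ.filter fun k => q.1 k = q.2 k) = K).card : ℝ) ≤
      (m : ℝ) ^ (2 * u) / (m : ℝ) ^ K.card := by
  have h1 : (Finset.univ.filter fun q : (Fin u → Fin m) × (Fin u → Fin m) =>
      (Finset.univ.filter fun k => q.1 k = q.2 k) = K).card ≤
      (Finset.univ.filter fun q : (Fin u → Fin m) × (Fin u → Fin m) =>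
        ∀ k ∈ K, q.2 k = q.1 k).card := by
    refine Finset.card_le_card fun q hq => ?_
    simp only [Finset.mem_filter, Finset.mem_univ, true_and] at hq ⊢
    intro k hk
    rw [← hq] at hk
    exact (Finset.mem_filter.1 hk).2.symm
  refine (Nat.cast_le.2 h1).trans (le_of_eq ?_)
  rw [card_filter_prod, Nat.cast_sum]
  have h2 : ∀ a : Fin u → Fin m, ((Finset.univ.filter fun b : Fin u → Fin m =>
      ∀ k ∈ K, b k = a k).card : ℝ) = (m : ℝ) ^ u / (m : ℝ) ^ K.card := fun a => by
    have := card_agree K a (by simpa using hm)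
    simpa using this
  rw [Finset.sum_congr rfl fun a _ => h2 a, Finset.sum_const, Finset.card_univ,
    Fintype.card_pi_const, Fintype.card_fin, nsmul_eq_mul]
  push_cast
  ring

/-- The second moment method for hitting a set of tuples by a random block sample. -/
theorem card_missing_le (hu : u ≤ W) (hm : 0 < m) (hV : 0 < Fintype.card V)
    {B : Finset (Fin u → V)} (hB : B.Nonempty) {E : ℕ → ℝ}
    (hE : ∀ K : Finset (Fin u), K.Nonempty → ∀ b ∈ B,
      ((B.filter fun b' => ∀ k ∈ K, b' k = b k).card : ℝ) ≤ E K.card) :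
    ((Finset.univ.filter fun ω : Fin W × Fin m → V => ∀ a, ω ∘ slot hu a ∉ B).card : ℝ) ≤
      (∑ K : Finset (Fin u) with K.Nonempty,
        E K.card * ((Fintype.card V : ℝ) / m) ^ K.card / B.card) *
          (Fintype.card V : ℝ) ^ (W * m) := by
  set N : ℝ := (Fintype.card V : ℝ) with hN
  have hN0 : 0 < N := by rw [hN]; exact_mod_cast hV
  have hm0 : (0 : ℝ) < m := by exact_mod_cast hm
  have hB0 : (0 : ℝ) < B.card := by exact_mod_cast hB.card_pos
  set T := N ^ (W * m) with hT
  have hT0 : 0 < T := by positivity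
  set Z : (Fin W × Fin m → V) → ℝ := fun ω => ∑ a, if ω ∘ slot hu a ∈ B then 1 else 0 with hZ
  set μ := (m : ℝ) ^ u * B.card / N ^ u with hμ
  have hμ0 : 0 < μ := by positivity
  have hfirst : ∑ ω, Z ω = μ * T := by
    simp only [hZ]
    rw [Finset.sum_comm]
    have h1 : ∀ a : Fin u → Fin m, ∑ ω : Fin W × Fin m → V,
        (if ω ∘ slot hu a ∈ B then (1 : ℝ) else 0) = B.card * (T / N ^ u) := by
      intro a
      rw [← Finset.sum_filter, Finset.sum_const, nsmul_eq_mul, mul_one]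
      have h2 : (Finset.univ.filter fun ω : Fin W × Fin m → V => ω ∘ slot hu a ∈ B) =
          B.biUnion fun b => Finset.univ.filter fun ω => ω ∘ slot hu a = b := by
        ext ω
        simp
      rw [h2, Finset.card_biUnion, Nat.cast_sum, Finset.sum_congr rfl fun b _ =>
        card_slot_eq hu a b hV, Finset.sum_const, nsmul_eq_mul]
      intro b _ b' _ hbb'
      rw [Function.onFun, Finset.disjoint_filter]
      rintro ω - h h'
      exact hbb' (h.symm.trans h')
    rw [Finset.sum_congr rfl fun a _ => h1 a, Finset.sum_const, Finset.card_univ,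
      Fintype.card_pi_const, Fintype.card_fin, nsmul_eq_mul, hμ]
    push_cast
    ring
  -- The sum over `K` has a single nonzero term, the agreement set; written this way, pairs of
  -- selections can be grouped by it.
  have hpair : ∀ a a' : Fin u → Fin m, ((Finset.univ.filter fun ω : Fin W × Fin m → V =>
      ω ∘ slot hu a ∈ B ∧ ω ∘ slot hu a' ∈ B).card : ℝ) ≤
      ∑ K : Finset (Fin u), if (Finset.univ.filter fun k => a k = a' k) = K then
        B.card * (if K.Nonempty then E K.card else B.card) * (T * N ^ K.card / N ^ (2 * u))
        else 0 := by
    intro a a'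
    rw [Finset.sum_ite_eq, if_pos (Finset.mem_univ _)]
    set K := Finset.univ.filter fun k => a k = a' k with hK
    have h2 : (Finset.univ.filter fun ω : Fin W × Fin m → V =>
        ω ∘ slot hu a ∈ B ∧ ω ∘ slot hu a' ∈ B) ⊆
        B.biUnion fun b => Finset.univ.filter fun ω =>
          ω ∘ slot hu a = b ∧ ω ∘ slot hu a' ∈ B := by
      intro ω
      simp
    refine (Nat.cast_le.2 ((Finset.card_le_card h2).trans Finset.card_biUnion_le)).trans ?_
    rw [Nat.cast_sum, mul_assoc, ← nsmul_eq_mul]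
    refine Finset.sum_le_card_nsmul _ _ _ fun b hb => ?_
    refine (card_slot_slot_le hu a a' B hV).trans ?_
    refine mul_le_mul_of_nonneg_right ?_ (by positivity)
    split_ifs with hKn
    · exact hE K hKn b hb
    · exact Nat.cast_le.2 (Finset.card_le_card (Finset.filter_subset _ _))
  have hsecond : ∑ ω, Z ω ^ 2 ≤ ∑ K : Finset (Fin u), (m : ℝ) ^ (2 * u) / (m : ℝ) ^ K.card *
      (B.card * (if K.Nonempty then E K.card else B.card) * (T * N ^ K.card / N ^ (2 * u))) := by
    have h1 : ∀ ω, Z ω ^ 2 = ∑ q : (Fin u → Fin m) × (Fin u → Fin m),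
        if ω ∘ slot hu q.1 ∈ B ∧ ω ∘ slot hu q.2 ∈ B then (1 : ℝ) else 0 := by
      intro ω
      rw [sq, hZ, Finset.sum_mul_sum, Fintype.sum_prod_type]
      refine Finset.sum_congr rfl fun a _ => Finset.sum_congr rfl fun a' _ => ?_
      by_cases h1 : ω ∘ slot hu a ∈ B <;> by_cases h2 : ω ∘ slot hu a' ∈ B <;> simp [h1, h2]
    rw [Finset.sum_congr rfl fun ω _ => h1 ω, Finset.sum_comm]
    calc _ ≤ ∑ q : (Fin u → Fin m) × (Fin u → Fin m), ∑ K : Finset (Fin u),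
          if (Finset.univ.filter fun k => q.1 k = q.2 k) = K then
            B.card * (if K.Nonempty then E K.card else B.card) * (T * N ^ K.card / N ^ (2 * u))
            else 0 := by
          refine Finset.sum_le_sum fun q _ => ?_
          refine le_trans (le_of_eq ?_) (hpair q.1 q.2)
          rw [← Finset.sum_filter, Finset.sum_const, nsmul_eq_mul, mul_one]
      _ = ∑ K : Finset (Fin u), ((Finset.univ.filter fun q : (Fin u → Fin m) × (Fin u → Fin m) =>
          (Finset.univ.filter fun k => q.1 k = q.2 k) = K).card : ℝ) *
          (B.card * (if K.Nonempty then E K.card else B.card) *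
            (T * N ^ K.card / N ^ (2 * u))) := by
          rw [Finset.sum_comm]
          refine Finset.sum_congr rfl fun K _ => ?_
          rw [← Finset.sum_filter, Finset.sum_const, nsmul_eq_mul]
      _ ≤ _ := by
          refine Finset.sum_le_sum fun K _ => ?_
          refine mul_le_mul_of_nonneg_right (card_agreement_pairs u m K hm) ?_
          refine mul_nonneg (mul_nonneg hB0.le ?_) (by positivity)
          split_ifs with hK
          · obtain ⟨b, hb⟩ := hB
            exact (Nat.cast_nonneg _).trans (hE K hK b hb)
          · exact hB0.le
  set R := ∑ K : Finset (Fin u) with K.Nonempty, E K.card * (N / m) ^ K.card / B.card with hR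
  -- The empty agreement set contributes the squared mean, which cancels in the variance; nonempty
  -- sets contribute the error `R`.
  have hsplit : ∑ K : Finset (Fin u), (m : ℝ) ^ (2 * u) / (m : ℝ) ^ K.card *
      (B.card * (if K.Nonempty then E K.card else B.card) * (T * N ^ K.card / N ^ (2 * u))) =
      μ ^ 2 * T + μ ^ 2 * (R * T) := by
    rw [← Finset.sum_filter_add_sum_filter_not Finset.univ fun K : Finset (Fin u) => K.Nonempty,
      add_comm]
    congr 1
    · have : (Finset.univ.filter fun K : Finset (Fin u) => ¬ K.Nonempty) = {∅} := by
        ext K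
        simp
      rw [this, Finset.sum_singleton]
      simp only [Finset.card_empty, pow_zero, div_one, Finset.not_nonempty_empty, if_false, hμ]
      rw [mul_comm 2 u, pow_mul, pow_mul]
      field_simp
    · rw [hR, Finset.sum_mul, Finset.mul_sum]
      refine Finset.sum_congr rfl fun K hK => ?_
      rw [if_pos (Finset.mem_filter.1 hK).2, hμ, mul_comm 2 u, pow_mul, pow_mul, div_pow, div_pow N]
      field_simp
  have hvar : ∑ ω, (Z ω - μ) ^ 2 ≤ μ ^ 2 * (R * T) := by
    have h1 : ∑ ω, (Z ω - μ) ^ 2 = ∑ ω, Z ω ^ 2 - 2 * μ * ∑ ω, Z ω + T * μ ^ 2 := by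
      simp only [sub_sq, Finset.sum_add_distrib, Finset.sum_sub_distrib, Finset.mul_sum,
        Finset.sum_const, Finset.card_univ, nsmul_eq_mul,
        Fintype.card_prod, Fintype.card_fin, Fintype.card_fun]
      push_cast
      rw [← hN, ← hT]
      congr 2
      exact Finset.sum_congr rfl fun _ _ => by ring
    rw [h1, hfirst]
    rw [hsplit] at hsecond
    linarith
  have hmiss : ((Finset.univ.filter fun ω : Fin W × Fin m → V =>
      ∀ a, ω ∘ slot hu a ∉ B).card : ℝ) * μ ^ 2 ≤ ∑ ω, (Z ω - μ) ^ 2 := by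
    rw [← nsmul_eq_mul]
    refine (Finset.card_nsmul_le_sum _ _ _ fun ω hω => ?_).trans
      (Finset.sum_le_sum_of_subset_of_nonneg (Finset.subset_univ _) fun _ _ _ => by positivity)
    have hω' : ∀ a, ω ∘ slot hu a ∉ B := by simpa using hω
    have : Z ω = 0 := Finset.sum_eq_zero fun a _ => if_neg (hω' a)
    rw [this, zero_sub, neg_sq]
  have := hmiss.trans hvar
  rw [mul_comm] at this
  exact le_of_mul_le_mul_left this (by positivity)

end SecondMoment

end

/-! ### Random samples detect witnesses. -/

section

section WitnessTest

variable {U : Type*}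

theorem HasTest.mono_set {N q : ℕ} {Y Y' : Set (SimpleGraph (Fin N))} {α : ℝ}
    {β : SimpleGraph (Fin N) → ℝ} (h : HasTest N q Y α β) (hY : Y' ⊆ Y) : HasTest N q Y' α β := by
  obtain ⟨Ω, i, j, query, acc, hloc, h1, h2⟩ := h
  exact ⟨Ω, i, j, query, acc, hloc, fun G hG => h1 G (hY hG), h2⟩

/-- Querying all pairs of the vertices of a random sample. -/
theorem hasTest_sample (H : SimpleGraph U) {N : ℕ} (hN : 0 < N) (W m : ℕ) :
    HasTest N (W * m * (W * m)) {G | CollectionOn H G Finset.univ} 0 fun G =>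
      ((Finset.univ.filter fun ω : Fin W × Fin m → Fin N =>
        CollectionOn H G (Finset.univ.image ω)).card : ℝ) / (N : ℝ) ^ (W * m) := by
  have : Nonempty (Fin N) := ⟨⟨0, hN⟩⟩
  let e : Fin (W * m * (W * m)) ≃ (Fin W × Fin m) × (Fin W × Fin m) :=
    finProdFinEquiv.symm.trans (finProdFinEquiv.symm.prodCongr finProdFinEquiv.symm)
  refine ⟨Fin W × Fin m → Fin N, inferInstance, inferInstance,
    fun ω i => (ω (e i).1, ω (e i).2), fun ω G => CollectionOn H G (Finset.univ.image ω),
    fun ω G G' h => ?_, fun G hG => ?_, fun G => ?_⟩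
  · refine CollectionOn.congr fun u hu v hv => ?_
    obtain ⟨j, -, rfl⟩ := Finset.mem_image.1 hu
    obtain ⟨j', -, rfl⟩ := Finset.mem_image.1 hv
    simpa using h (e.symm (j, j'))
  · rw [zero_mul, Finset.filter_false_of_mem, Finset.card_empty, Nat.cast_zero]
    intro ω _ h
    exact h (CollectionOn.mono hG (Finset.subset_univ _))
  · have hN' : (0 : ℝ) < N := by exact_mod_cast hN
    have : (Fintype.card (Fin W × Fin m → Fin N) : ℝ) = (N : ℝ) ^ (W * m) := by simp
    rw [this, div_mul_cancel₀ _ (by positivity)]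

/-- Many minimal witnesses of low degree are likely to be detected by a random sample. -/
theorem card_collectionOn_image_le {V : Type*} [Fintype V] [Nonempty U]
    {H : SimpleGraph U} {G : SimpleGraph V} {Z : Finset V} {u W m : ℕ} {d γ ε x A : ℝ} (hu : u ≤ W) (hu2 : 2 ≤ u) (hm : 0 < m)
    (hV : 0 < Fintype.card V) (hd : 0 < d) (hγ : 0 < γ) (hε : 0 < ε)
    (hεd : ε * Fintype.card V ≤ d) (hx : 0 < x) (hx1 : x ≤ 1) (hxε : x ^ W = ε) (hA1 : 1 ≤ A)
    (hA : 4 * (4 * (W : ℝ) ^ 2) ^ W / γ ≤ A) (hmA : A ≤ m * x ^ (W - 1))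
    (hdeg : ∀ v, (deg (isolate G Z) v : ℝ) ≤ 2 * d)
    (hmany : γ * Fintype.card V * d ^ (u - 1) < ((minimalTuples H (isolate G Z) u).card : ℝ)) :
    ((Finset.univ.filter fun ω : Fin W × Fin m → V =>
      CollectionOn H G (Finset.univ.image ω)).card : ℝ) ≤
        1 / 4 * (Fintype.card V : ℝ) ^ (W * m) := by
  set B := minimalTuples H (isolate G Z) u with hB
  set N : ℝ := (Fintype.card V : ℝ) with hN
  have hN0 : 0 < N := by rw [hN]; exact_mod_cast hV
  have hm0 : (0 : ℝ) < m := by exact_mod_cast hm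
  have hB0 : (0 : ℝ) < B.card := lt_of_le_of_lt (by positivity) hmany
  have hBne : B.Nonempty := Finset.card_pos.1 (by exact_mod_cast hB0)
  have hmem : ∀ b ∈ B, IsConnectedTuple (isolate G Z) b ∧
      MinimalOn H (isolate G Z) (Finset.univ.image b) := fun b hb => by
    have := (Finset.mem_filter.1 hb).2
    exact ⟨⟨this.1, this.2.connectedOn⟩, this.2⟩
  have hnot : ∀ b ∈ B, ¬ CollectionOn H G (Finset.univ.image b) := by
    intro b hb hcol
    obtain ⟨⟨hinj, hcon⟩, hmin⟩ := hmem b hb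
    have h2 : 2 ≤ (Finset.univ.image b).card := by
      rw [Finset.card_image_of_injective _ hinj]
      simpa using hu2
    -- A connected set with at least two vertices avoids the isolated set `Z`, so it is a witness in
    -- `G` itself, which is what the sample shows.
    have hZ : ∀ v ∈ Finset.univ.image b, v ∉ Z := fun v hv => by
      obtain ⟨z, -, hz⟩ := hcon.exists_adj h2 hv
      exact hz.1
    refine hmin.1 (CollectionOn.congr (fun v hv w hw => ?_) hcol)
    refine ⟨fun h => ⟨hZ v hv, hZ w hw, h⟩, fun h => h.2.2⟩
  have hE : ∀ K : Finset (Fin u), K.Nonempty → ∀ b ∈ B,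
      ((B.filter fun b' => ∀ k ∈ K, b' k = b k).card : ℝ) ≤
        ((u : ℝ) ^ 2 * (2 * d)) ^ (u - K.card) := by
    intro K hK b _
    refine le_trans (Nat.cast_le.2 (Finset.card_le_card fun b' hb' => ?_))
      (card_connectedTuple_le (G := isolate G Z) (by positivity) hdeg hK b)
    have h := Finset.mem_filter.1 hb'
    exact Finset.mem_filter.2 ⟨Finset.mem_univ _, (hmem b' h.1).1, h.2⟩
  have hmiss := card_missing_le (W := W) (m := m)
    (E := fun k => ((u : ℝ) ^ 2 * (2 * d)) ^ (u - k)) hu hm hV hBne hE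
  refine (Nat.cast_le.2 (Finset.card_le_card (t := Finset.univ.filter fun ω :
    Fin W × Fin m → V => ∀ a, ω ∘ slot hu a ∉ B) fun ω hω => ?_)).trans (hmiss.trans ?_)
  · refine Finset.mem_filter.2 ⟨Finset.mem_univ _, fun a ha => hnot _ ha ?_⟩
    refine CollectionOn.mono (Finset.mem_filter.1 hω).2 fun v hv => ?_
    obtain ⟨k, -, rfl⟩ := Finset.mem_image.1 hv
    exact Finset.mem_image_of_mem _ (Finset.mem_univ _)
  · refine mul_le_mul_of_nonneg_right ?_ (by positivity)
    have hW1 : (1 : ℝ) ≤ W := by exact_mod_cast (by omega : 1 ≤ W)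
    have huW : (u : ℝ) ≤ W := by exact_mod_cast hu
    set M := (2 * (W : ℝ) ^ 2) ^ W with hM
    have hM0 : 0 < M := by positivity
    have hMA : 4 * (2 ^ W * M) ≤ γ * A := by
      rw [div_le_iff₀ hγ] at hA
      have : (4 * (W : ℝ) ^ 2) ^ W = 2 ^ W * M := by rw [hM, ← mul_pow]; ring
      rw [this] at hA
      linarith
    have hterm : ∀ K : Finset (Fin u), K.Nonempty →
        ((u : ℝ) ^ 2 * (2 * d)) ^ (u - K.card) * (N / m) ^ K.card / B.card ≤ 1 / (4 * 2 ^ W) := by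
      intro K hK
      obtain ⟨k, hk⟩ : ∃ k, K.card = k + 1 := ⟨K.card - 1, by have := hK.card_pos; omega⟩
      have hku : k + 1 ≤ u := by
        rw [← hk]
        simpa using Finset.card_le_univ K
      rw [hk]
      have h1 : ((u : ℝ) ^ 2 * (2 * d)) ^ (u - (k + 1)) ≤ M * d ^ (u - (k + 1)) := by
        calc ((u : ℝ) ^ 2 * (2 * d)) ^ (u - (k + 1)) =
              (2 * (u : ℝ) ^ 2) ^ (u - (k + 1)) * d ^ (u - (k + 1)) := by
                rw [← mul_pow]
                ring
          _ ≤ (2 * (W : ℝ) ^ 2) ^ (u - (k + 1)) * d ^ (u - (k + 1)) := by gcongr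
          _ ≤ _ := by
              refine mul_le_mul_of_nonneg_right ?_ (by positivity)
              exact pow_le_pow_right₀ (by nlinarith) (by omega)
      -- With x = ε^(1/W), the exponents compare as Wk ≤ (W - 1)(k + 1) because k + 1 ≤ W. This is
      -- where the maximal witness size determines the sample size.
      have h2 : A ≤ (m : ℝ) ^ (k + 1) * ε ^ k := by
        calc A ≤ A ^ (k + 1) := le_self_pow₀ hA1 (by omega)
          _ ≤ (m * x ^ (W - 1)) ^ (k + 1) := by gcongr
          _ = (m : ℝ) ^ (k + 1) * x ^ ((W - 1) * (k + 1)) := by rw [mul_pow, pow_mul]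
          _ ≤ (m : ℝ) ^ (k + 1) * x ^ (W * k) := by
              refine mul_le_mul_of_nonneg_left ?_ (by positivity)
              refine pow_le_pow_of_le_one hx.le hx1 ?_
              obtain ⟨w, rfl⟩ : ∃ w, W = w + 1 := ⟨W - 1, by omega⟩
              have : k ≤ w := by omega
              simp only [Nat.add_sub_cancel]
              nlinarith
          _ = _ := by rw [pow_mul, hxε]
      have h3 : ε ^ k * N ^ (k + 1) * d ^ (u - (k + 1)) ≤ N * d ^ (u - 1) := by
        calc ε ^ k * N ^ (k + 1) * d ^ (u - (k + 1)) = (ε * N) ^ k * (N * d ^ (u - (k + 1))) := by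
              rw [mul_pow, pow_succ]
              ring
          _ ≤ d ^ k * (N * d ^ (u - (k + 1))) := by gcongr
          _ = N * d ^ (k + (u - (k + 1))) := by rw [pow_add]; ring
          _ = _ := by
              congr 2
              omega
      rw [div_le_div_iff₀ hB0 (by positivity), div_pow, one_mul]
      refine le_trans ?_ hmany.le
      have h4 : ((u : ℝ) ^ 2 * (2 * d)) ^ (u - (k + 1)) * (N ^ (k + 1) / m ^ (k + 1)) *
          (4 * 2 ^ W) = ((u : ℝ) ^ 2 * (2 * d)) ^ (u - (k + 1)) * N ^ (k + 1) *
          (4 * 2 ^ W) / m ^ (k + 1) := by ring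
      rw [h4, div_le_iff₀ (by positivity)]
      refine le_of_mul_le_mul_right ?_ (pow_pos hε k)
      calc ((u : ℝ) ^ 2 * (2 * d)) ^ (u - (k + 1)) * N ^ (k + 1) * (4 * 2 ^ W) * ε ^ k
          ≤ M * d ^ (u - (k + 1)) * N ^ (k + 1) * (4 * 2 ^ W) * ε ^ k := by gcongr
        _ = 4 * (2 ^ W * M) * (ε ^ k * N ^ (k + 1) * d ^ (u - (k + 1))) := by ring
        _ ≤ γ * A * (N * d ^ (u - 1)) := mul_le_mul hMA h3 (by positivity) (by positivity)
        _ ≤ γ * ((m : ℝ) ^ (k + 1) * ε ^ k) * (N * d ^ (u - 1)) := by gcongr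
        _ = _ := by ring
    refine (Finset.sum_le_card_nsmul _ _ _ fun K hK => hterm K (Finset.mem_filter.1 hK).2).trans ?_
    rw [nsmul_eq_mul]
    have hcard : ((Finset.univ.filter fun K : Finset (Fin u) => K.Nonempty).card : ℝ) ≤ 2 ^ W := by
      have h1 : (Finset.univ.filter fun K : Finset (Fin u) => K.Nonempty).card ≤ 2 ^ u := by
        refine (Finset.card_le_univ _).trans (by simp)
      have h2 : 2 ^ u ≤ 2 ^ W := Nat.pow_le_pow_right (by norm_num) hu
      exact_mod_cast h1.trans h2
    calc _ ≤ (2 : ℝ) ^ W * (1 / (4 * 2 ^ W)) := by gcongr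
      _ = 1 / 4 := by field_simp

end WitnessTest

end

/-! ### Combining the degree tests and the witness test. -/

section

section Tester

variable {U : Type*}

/-- Each changed edge comes from an ordered mismatched pair; the factor 2 lost is harmless. -/
theorem editDistance_le_mismatch {N : ℕ} (G G' : SimpleGraph (Fin N)) :
    editDistance G G' ≤ mismatch G G' := by
  unfold editDistance mismatch
  refine le_trans ?_ (Finset.card_image_le (f := fun q : Fin N × Fin N => s(q.1, q.2)))
  rw [← Set.ncard_coe_finset]
  refine Set.ncard_le_ncard (fun e => ?_) (Finset.finite_toSet _)
  induction e using Sym2.ind with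
  | _ a b =>
    intro he
    refine Finset.mem_coe.2 (Finset.mem_image.2 ⟨(a, b), Finset.mem_filter.2
      ⟨Finset.mem_univ _, ?_⟩, rfl⟩)
    simp only [Set.mem_symmDiff, SimpleGraph.mem_edgeSet] at he
    tauto

theorem ncard_neighborSet {V : Type*} [Fintype V] (G : SimpleGraph V) (v : V) :
    (G.neighborSet v).ncard = deg G v := by
  rw [deg, ← Set.ncard_coe_finset]
  congr 1
  ext
  simp

theorem mem_lowDegreeBlowUpCollections {H : SimpleGraph U} {N : ℕ} {d : ℝ} (hd : 0 ≤ d)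
    {G : SimpleGraph (Fin N)} : G ∈ lowDegreeBlowUpCollections H N d ↔
      (∀ v, deg G v ≤ ⌊d⌋₊) ∧ IsBlowUpCollection H G := by
  simp_rw [Nat.le_floor_iff hd, ← ncard_neighborSet]
  rfl

theorem exists_minimalOn_of_mem_minimalTuples {V : Type*} [Fintype V] {H : SimpleGraph U}
    {G : SimpleGraph V} {u : ℕ} {b : Fin u → V} (hb : b ∈ minimalTuples H G u) :
    ∃ S : Finset V, MinimalOn H G S ∧ S.card = u := by
  have hb : Function.Injective b ∧ MinimalOn H G (Finset.univ.image b) := (Finset.mem_filter.1 hb).2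
  refine ⟨_, hb.2, ?_⟩
  rw [Finset.card_image_of_injective _ hb.1, Finset.card_univ, Fintype.card_fin]

theorem MinimalOn.two_le_card [Nonempty U] {V : Type*} {H : SimpleGraph U} {G : SimpleGraph V}
    {S : Finset V} (h : MinimalOn H G S) : 2 ≤ S.card := by
  have h0 := h.nonempty.card_pos
  by_contra! h1
  obtain ⟨v, rfl⟩ := Finset.card_eq_one.1 (by omega : S.card = 1)
  exact h.1 ⟨fun _ => 0, fun _ => Classical.arbitrary U, by simp⟩

/-- The vertices whose degree exceeds `D` by at least a constant fraction of `d` are detected, or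
contribute few edges. -/
theorem sum_deg_le_of_levels {V : Type*} [Fintype V] (G : SimpleGraph V) {D d δ θ ρ : ℝ}
    (hd : 0 < d) (hDd : D ≤ d) (hδ1 : δ ≤ 1) (hθ : 1 ≤ θ) (hVd : (Fintype.card V : ℝ) ≤ d * θ ^ 4)
    (h : ∀ j < 5, ((Finset.univ.filter fun v => D + δ * d * θ ^ j ≤ deg G v).card : ℝ) ≤
      ρ / θ ^ (j + 1) * Fintype.card V) :
    ∑ v with D + δ * d ≤ deg G v, (deg G v : ℝ) ≤ 10 * ρ * (d * Fintype.card V) := by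
  have hθ0 : 0 < θ := by linarith
  -- A degree too large for level j reaches level j + 1, and level 4 is the last because degrees are
  -- at most N ≤ d θ^4.
  have hlevel : ∀ v, D + δ * d ≤ deg G v →
      ∃ j < 5, D + δ * d * θ ^ j ≤ deg G v ∧ (deg G v : ℝ) ≤ 2 * d * θ ^ (j + 1) := by
    intro v hv
    by_contra! hcon
    have hall : ∀ j < 5, D + δ * d * θ ^ j ≤ deg G v := by
      intro j
      induction j with
      | zero => exact fun _ => by simpa using hv
      | succ j ih =>
        intro hj
        refine le_trans ?_ (hcon j (by omega) (ih (by omega))).le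
        have h1 : 1 ≤ θ ^ (j + 1) := one_le_pow₀ hθ
        have h2 : d ≤ d * θ ^ (j + 1) := le_mul_of_one_le_right hd.le h1
        have h3 : δ * (d * θ ^ (j + 1)) ≤ d * θ ^ (j + 1) := mul_le_of_le_one_left (by positivity) hδ1
        linarith
    have h1 := hcon 4 (by omega) (hall 4 (by omega))
    have h2 : (deg G v : ℝ) ≤ Fintype.card V := by
      exact_mod_cast Finset.card_le_univ _
    have h3 : d * θ ^ 4 ≤ d * θ ^ 5 :=
      mul_le_mul_of_nonneg_left (pow_le_pow_right₀ hθ (by omega)) hd.le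
    have h4 : 0 < d * θ ^ 5 := by positivity
    norm_num at h1
    linarith
  calc ∑ v with D + δ * d ≤ deg G v, (deg G v : ℝ)
      ≤ ∑ v with D + δ * d ≤ deg G v, ∑ j ∈ Finset.range 5,
        if D + δ * d * θ ^ j ≤ deg G v then 2 * d * θ ^ (j + 1) else 0 := by
        refine Finset.sum_le_sum fun v hv => ?_
        obtain ⟨j, hj, h1, h2⟩ := hlevel v (Finset.mem_filter.1 hv).2
        refine h2.trans (le_trans (le_of_eq (if_pos h1).symm) (Finset.single_le_sum
          (f := fun j => if D + δ * d * θ ^ j ≤ deg G v then 2 * d * θ ^ (j + 1) else 0)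
          (fun i _ => ?_) (Finset.mem_range.2 hj)))
        split_ifs <;> positivity
    _ ≤ ∑ v, ∑ j ∈ Finset.range 5,
        if D + δ * d * θ ^ j ≤ deg G v then 2 * d * θ ^ (j + 1) else 0 := by
        refine Finset.sum_le_sum_of_subset_of_nonneg (Finset.subset_univ _) fun v _ _ => ?_
        refine Finset.sum_nonneg fun j _ => ?_
        split_ifs <;> positivity
    _ = ∑ j ∈ Finset.range 5, ((Finset.univ.filter fun v =>
        D + δ * d * θ ^ j ≤ deg G v).card : ℝ) * (2 * d * θ ^ (j + 1)) := by
        rw [Finset.sum_comm]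
        refine Finset.sum_congr rfl fun j _ => ?_
        rw [← Finset.sum_filter, Finset.sum_const, nsmul_eq_mul]
    _ ≤ ∑ j ∈ Finset.range 5, 2 * ρ * (d * Fintype.card V) := by
        refine Finset.sum_le_sum fun j hj => ?_
        refine (mul_le_mul_of_nonneg_right (h j (Finset.mem_range.1 hj)) (by positivity)).trans
          (le_of_eq ?_)
        field_simp
    _ = _ := by
        rw [Finset.sum_const, Finset.card_range, nsmul_eq_mul]
        push_cast
        ring

/-- The combination of the degree tests and the witness test. -/
theorem exists_isTester [Nonempty U] [Fintype U] (H : SimpleGraph U) {W : ℕ} (hW1 : 1 ≤ W)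
    (hW : ∀ n ∈ minimalWitnessSizes H, n ≤ W) {c : ℝ} (hc : 1 < c) :
    ∃ C : ℝ, 0 ≤ C ∧ ∀ ε θ x : ℝ, 0 < ε → 1 ≤ θ → θ ^ 4 * ε = 1 → 0 < x → x ≤ 1 → x ^ W = ε →
      ∃ q : ℕ, (q : ℝ) ≤ C * (θ ^ 6 + 1 / (x ^ (W - 1)) ^ 2) ∧ ∀ N : ℕ, 1 ≤ N →
        ∃ A : NonAdaptiveAlgorithm N q,
          A.IsTester ε (lowDegreeBlowUpCollections H N (c * ε * N)) := by
  have hc0 : 0 < c := by linarith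
  obtain ⟨δ, γ, hδ, hδ1, hγ, hclose⟩ := exists_close_lowDegree_collection H
    (η := 1 / (4 * c)) (by positivity) (by rw [div_le_one (by positivity)]; linarith)
  obtain ⟨C₁, hC₁, hlev⟩ := exists_hasTest_level hc hδ hδ1 (ρ := 1 / (100 * c)) (by positivity)
    (by rw [div_le_one (by positivity)]; linarith)
  set A := max 1 (4 * (4 * (W : ℝ) ^ 2) ^ W / γ) with hA
  have hA1 : 1 ≤ A := le_max_left _ _
  refine ⟨5 * C₁ + 4 * W ^ 2 * A ^ 2, by positivity, fun ε θ x hε hθ hθε hx hx1 hxε => ?_⟩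
  have hθ0 : 0 < θ := by linarith
  choose! q hq hT using hlev ε θ hε hθ hθε
  set m := ⌈A / x ^ (W - 1)⌉₊ with hm
  have hm0 : 0 < m := Nat.ceil_pos.2 (by positivity)
  have hmA : A ≤ m * x ^ (W - 1) := by
    rw [← div_le_iff₀ (by positivity)]
    exact Nat.le_ceil _
  have hm2 : (m : ℝ) ≤ 2 * (A / x ^ (W - 1)) := by
    have h1 := Nat.ceil_lt_add_one (by positivity : 0 ≤ A / x ^ (W - 1))
    have h2 : 1 ≤ A / x ^ (W - 1) := by
      rw [le_div_iff₀ (by positivity), one_mul]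
      exact (pow_le_one₀ hx.le hx1).trans hA1
    linarith
  refine ⟨∑ j ∈ Finset.range 5, q j + W * m * (W * m), ?_, fun N hN => ?_⟩
  · have h1 : ((∑ j ∈ Finset.range 5, q j : ℕ) : ℝ) ≤ 5 * (C₁ * θ ^ 6) := by
      rw [Nat.cast_sum]
      refine (Finset.sum_le_card_nsmul _ _ (C₁ * θ ^ 6) fun j hj => ?_).trans ?_
      · exact hq j (by have := Finset.mem_range.1 hj; omega)
      · rw [Finset.card_range, nsmul_eq_mul]
        norm_num
    have h2 : ((W * m * (W * m) : ℕ) : ℝ) ≤ 4 * W ^ 2 * A ^ 2 * (1 / (x ^ (W - 1)) ^ 2) := by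
      have h3 : (m : ℝ) ^ 2 ≤ (2 * (A / x ^ (W - 1))) ^ 2 := by gcongr
      calc ((W * m * (W * m) : ℕ) : ℝ) = W ^ 2 * (m : ℝ) ^ 2 := by push_cast; ring
        _ ≤ W ^ 2 * (2 * (A / x ^ (W - 1))) ^ 2 := by gcongr
        _ = _ := by
            field_simp
            ring
    have h3 : 0 ≤ 5 * C₁ * (1 / (x ^ (W - 1)) ^ 2) := by positivity
    have h4 : 0 ≤ 4 * W ^ 2 * A ^ 2 * θ ^ 6 := by positivity
    rw [Nat.cast_add]
    linarith
  set d := c * ε * N with hd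
  have hN0 : (0 : ℝ) < N := by exact_mod_cast hN
  have hd0 : 0 < d := by positivity
  have hDd : (⌊d⌋₊ : ℝ) ≤ d := Nat.floor_le hd0.le
  set P := lowDegreeBlowUpCollections H N d with hP
  have hlow : P ⊆ lowDegreeGraphs N ⌊d⌋₊ := fun G hG =>
    ((mem_lowDegreeBlowUpCollections hd0.le).1 hG).1
  have hcol : P ⊆ {G | CollectionOn H G Finset.univ} := fun G hG => by
    obtain ⟨p, f, h⟩ := isBlowUpCollection_iff.1 ((mem_lowDegreeBlowUpCollections hd0.le).1 hG).2
    exact ⟨p, f, fun u _ v _ => h u v⟩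
  have htest := (HasTest.prod (n := 5) fun j hj => (hT j (by omega) N hN).mono_set hlow).and
    ((hasTest_sample H hN W m).mono_set hcol)
  refine htest.exists_isTester (ε := ε) ?_ fun G hG => ?_
  · rw [Finset.sum_const, Finset.card_range, nsmul_eq_mul]
    norm_num
  set L : ℕ → Finset (Fin N) := fun j => Finset.univ.filter fun v =>
    (⌊d⌋₊ : ℝ) + δ * d * θ ^ j ≤ deg G v with hL
  set s : ℝ := ((Finset.univ.filter fun ω : Fin W × Fin m → Fin N =>
    CollectionOn H G (Finset.univ.image ω)).card : ℝ) / (N : ℝ) ^ (W * m) with hs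
  set β : ℕ → ℝ := fun j => if 1 / (100 * c) / θ ^ (j + 1) * N ≤ ((L j).card : ℝ) then 1 / 4 else 1
    with hβ
  change (∏ j ∈ Finset.range 5, β j) * s < 1 / 3
  have hs0 : 0 ≤ s := by positivity
  have hs1 : s ≤ 1 := by
    rw [hs, div_le_one (by positivity)]
    have h1 : (Finset.univ.filter fun ω : Fin W × Fin m → Fin N =>
      CollectionOn H G (Finset.univ.image ω)).card ≤ N ^ (W * m) :=
        (Finset.card_le_univ _).trans (by simp)
    exact_mod_cast h1
  have hβ0 : ∀ j, 0 ≤ β j := fun j => by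
    simp only [hβ]
    split_ifs <;> norm_num
  have hβ1 : ∀ j, β j ≤ 1 := fun j => by
    simp only [hβ]
    split_ifs <;> norm_num
  by_cases hlevels : ∃ j < 5, 1 / (100 * c) / θ ^ (j + 1) * N ≤ ((L j).card : ℝ)
  · obtain ⟨j, hj, hjL⟩ := hlevels
    have h1 : ∏ j ∈ Finset.range 5, β j ≤ 1 / 4 := by
      rw [← Finset.mul_prod_erase _ _ (Finset.mem_range.2 hj)]
      have h2 : β j = 1 / 4 := if_pos hjL
      rw [h2]
      have h3 := Finset.prod_le_one (s := (Finset.range 5).erase j) (fun i _ => hβ0 i)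
        fun i _ => hβ1 i
      linarith
    nlinarith
  push Not at hlevels
  have hprod0 : 0 ≤ ∏ j ∈ Finset.range 5, β j := Finset.prod_nonneg fun i _ => hβ0 i
  have hprod1 : ∏ j ∈ Finset.range 5, β j ≤ 1 :=
    Finset.prod_le_one (fun i _ => hβ0 i) fun i _ => hβ1 i
  suffices hs4 : s ≤ 1 / 4 by nlinarith
  have hcN : Fintype.card (Fin N) = N := Fintype.card_fin N
  -- No level is crowded, so isolating all vertices of excessive degree is cheap, and the witness
  -- test has to do the work.
  set Z : Finset (Fin N) := Finset.univ.filter fun v => (⌊d⌋₊ : ℝ) + δ * d ≤ deg G v with hZ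
  have hdegZ : ∀ v, (deg (isolate G Z) v : ℝ) ≤ ⌊d⌋₊ + δ * d := by
    intro v
    by_cases hv : v ∈ Z
    · rw [deg_isolate_eq_zero G hv, Nat.cast_zero]
      positivity
    · have h1 : deg (isolate G Z) v ≤ deg G v := by
        have := deg_isolate_le G Z ∅ (Finset.empty_subset _) v
        simpa using this
      have h2 : (deg G v : ℝ) < ⌊d⌋₊ + δ * d := by simpa [hZ] using hv
      exact (Nat.cast_le.2 h1).trans h2.le
  have hsumZ : ∑ v ∈ Z, (deg G v : ℝ) ≤ 10 * (1 / (100 * c)) * (d * N) := by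
    have h1 := sum_deg_le_of_levels G (ρ := 1 / (100 * c)) hd0 hDd hδ1 hθ (by
      rw [hcN]
      have : d * θ ^ 4 = c * N * (θ ^ 4 * ε) := by rw [hd]; ring
      rw [this, hθε, mul_one]
      nlinarith) fun j hj => by
        rw [hcN]
        exact (hlevels j hj).le
    rwa [hcN] at h1
  have hmany : ∃ u, 1 ≤ u ∧ γ * Fintype.card (Fin N) * d ^ (u - 1) <
      ((minimalTuples H (isolate G Z) u).card : ℝ) := by
    -- With few witnesses, isolating `Z` costs at most εN²/5 and the repair at most εN²/4, less than
    -- the distance of a far graph.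
    by_contra! hfew
    obtain ⟨G', h1, h2, h3⟩ := hclose (isolate G Z) d hd0 hdegZ hfew
    have h4 := hG G' ((mem_lowDegreeBlowUpCollections hd0.le).2 ⟨h2, h1⟩)
    have h5 : (editDistance G G' : ℝ) ≤ mismatch G (isolate G Z) + mismatch (isolate G Z) G' := by
      exact_mod_cast (editDistance_le_mismatch G G').trans (mismatch_triangle _ _ _)
    have h6 : (mismatch G (isolate G Z) : ℝ) ≤ 2 * ∑ v ∈ Z, (deg G v : ℝ) := by
      exact_mod_cast mismatch_isolate_le G Z
    rw [hcN] at h3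
    have h7 : d * N = c * (ε * N ^ 2) := by rw [hd]; ring
    have h8 : 10 * (1 / (100 * c)) * (d * N) = 1 / 10 * (ε * N ^ 2) := by
      rw [h7]
      field_simp
      norm_num
    have h9 : 1 / (4 * c) * d * N = 1 / 4 * (ε * N ^ 2) := by
      rw [mul_assoc, h7]
      field_simp
    have h10 : 0 < ε * (N : ℝ) ^ 2 := by positivity
    linarith
  obtain ⟨u, -, hu⟩ := hmany
  obtain ⟨b, hb⟩ : (minimalTuples H (isolate G Z) u).Nonempty := by
    rw [← Finset.card_pos]
    have : (0 : ℝ) < (minimalTuples H (isolate G Z) u).card := lt_of_le_of_lt (by positivity) hu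
    exact_mod_cast this
  obtain ⟨S, hS, rfl⟩ := exists_minimalOn_of_mem_minimalTuples hb
  have huW : S.card ≤ W :=
    hW _ ⟨N, isolate G Z, S, isMinimalWitness_coe_iff.2 hS, Set.ncard_coe_finset S⟩
  rw [hs, div_le_iff₀ (by positivity)]
  have hdeg2 : ∀ v, (deg (isolate G Z) v : ℝ) ≤ 2 * d := fun v => by
    have h1 : δ * d ≤ d := mul_le_of_le_one_left hd0.le hδ1
    linarith [hdegZ v]
  have hfin := card_collectionOn_image_le huW hS.two_le_card hm0
    (by rw [hcN]; omega) hd0 hγ hε (by rw [hcN, hd]; nlinarith [mul_pos hε hN0]) hx hx1 hxε hA1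
    (le_max_right _ _) hmA hdeg2 hu
  rw [hcN] at hfin
  refine le_trans (le_of_eq ?_) hfin
  congr!

end Tester

end

/-! ### Degenerate cases and exponents. -/

section

section Bounds

variable {U : Type*}

theorem hasTest_reject (N : ℕ) : HasTest N 0 ∅ 0 fun _ => 0 :=
  ⟨Unit, inferInstance, inferInstance, fun _ i => i.elim0, fun _ _ => False,
    fun _ _ _ _ h => h, fun _ h => h.elim, fun _ => by simp⟩

/-- The empty graph has the property and is within N² edits of everything, so no graph is far. -/
theorem exists_isTester_of_one_lt [Nonempty U] (H : SimpleGraph U) {N : ℕ} (hN : 1 ≤ N) {ε d : ℝ}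
    (hε : 1 < ε) (hd : 0 ≤ d) :
    ∃ A : NonAdaptiveAlgorithm N 0, A.IsTester ε (lowDegreeBlowUpCollections H N d) := by
  refine (hasTest_trivial N _).exists_isTester (by norm_num) fun G hG => ?_
  exfalso
  have hbot : (⊥ : SimpleGraph (Fin N)) ∈ lowDegreeBlowUpCollections H N d := by
    rw [mem_lowDegreeBlowUpCollections hd]
    refine ⟨fun v => by simp [deg], isBlowUpCollection_iff.2
      ⟨fun _ => 0, fun _ => Classical.arbitrary U, by simp⟩⟩
  have h1 := hG ⊥ hbot
  have h2 : mismatch G ⊥ ≤ N ^ 2 := (Finset.card_le_univ _).trans (by simp [sq])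
  have h3 : (editDistance G ⊥ : ℝ) ≤ N ^ 2 := by
    exact_mod_cast (editDistance_le_mismatch G ⊥).trans h2
  have hN0 : (0 : ℝ) < N := by exact_mod_cast hN
  nlinarith [pow_pos hN0 2]

/-- Takes θ = ε^(-1/4) and x = ε^(1/W). The bound on `Q` is needed only for ε ≤ 1, where decreasing
an exponent increases the power. -/
theorem exists_hasNonAdaptiveTesters [Nonempty U] [Fintype U] (H : SimpleGraph U) {W : ℕ}
    (hW1 : 1 ≤ W) (hW : ∀ n ∈ minimalWitnessSizes H, n ≤ W) {c : ℝ} (hc : 1 < c) :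
    ∃ C : ℝ, 0 ≤ C ∧ ∀ Q : ℝ → ℝ, (∀ ε, 0 < ε → 0 ≤ Q ε) →
      (∀ ε, 0 < ε → ε ≤ 1 → C * (ε ^ (-(3 / 2) : ℝ) + ε ^ (-2 + 2 / (W : ℝ))) ≤ Q ε) →
        HasNonAdaptiveTesters H c Q := by
  obtain ⟨C, hC, h⟩ := exists_isTester H hW1 hW hc
  refine ⟨C, hC, fun Q hQ0 hQ ε hε => ?_⟩
  rcases lt_or_ge 1 ε with hε1 | hε1
  · exact ⟨0, by simpa using hQ0 ε hε, fun N hN =>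
      exists_isTester_of_one_lt H hN hε1 (by positivity)⟩
  have hW0 : (0 : ℝ) < W := by exact_mod_cast hW1
  obtain ⟨q, hq, htest⟩ := h ε (ε ^ (-(1 / 4) : ℝ)) (ε ^ (1 / (W : ℝ))) hε
    (Real.one_le_rpow_of_pos_of_le_one_of_nonpos hε hε1 (by norm_num))
    (by
      rw [← Real.rpow_natCast, ← Real.rpow_mul hε.le]
      norm_num
      rw [Real.rpow_neg_one, inv_mul_cancel₀ hε.ne'])
    (by positivity) (Real.rpow_le_one hε.le hε1 (by positivity))
    (by rw [← Real.rpow_natCast, ← Real.rpow_mul hε.le, one_div_mul_cancel hW0.ne', Real.rpow_one])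
  refine ⟨q, hq.trans (le_trans (le_of_eq ?_) (hQ ε hε hε1)), htest⟩
  congr 2
  · rw [← Real.rpow_natCast, ← Real.rpow_mul hε.le]
    norm_num
  · rw [← Real.rpow_natCast, ← Real.rpow_natCast, ← Real.rpow_mul hε.le, ← Real.rpow_mul hε.le,
      one_div, ← Real.rpow_neg hε.le, Nat.cast_sub hW1]
    congr 1
    push_cast
    field_simp
    ring

theorem isBlowUpCollection_iff_isEmpty [IsEmpty U] {V : Type*} {H : SimpleGraph U}
    {G : SimpleGraph V} : IsBlowUpCollection H G ↔ IsEmpty V := by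
  refine ⟨fun ⟨k, p, h, _⟩ => ⟨fun v => ?_⟩, fun _ =>
    ⟨0, isEmptyElim, fun i => i.elim0, isEmptyElim⟩⟩
  obtain ⟨f, -⟩ := h (p v)
  exact isEmptyElim (f ⟨v, rfl⟩)

/-- Only the graph without vertices is a collection here, so the minimal witnesses are the single
vertices. -/
theorem minimalWitnessSizes_of_isEmpty [IsEmpty U] (H : SimpleGraph U) :
    minimalWitnessSizes H = {1} := by
  ext n
  constructor
  · rintro ⟨N, G, S, ⟨h1, h2⟩, rfl⟩
    simp only [isBlowUpCollection_iff_isEmpty, Set.isEmpty_coe_sort] at h1 h2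
    obtain ⟨v, hv⟩ := Set.nonempty_iff_ne_empty.2 h1
    rcases (Set.singleton_subset_iff.2 hv).eq_or_ssubset with h | h
    · simp [← h]
    · exact absurd (h2 _ h) (Set.singleton_ne_empty v)
  · rintro rfl
    refine ⟨1, ⊥, {0}, ⟨?_, fun S' hS' => ?_⟩, Set.ncard_singleton _⟩
    · simp [isBlowUpCollection_iff_isEmpty]
    · rw [isBlowUpCollection_iff_isEmpty, Set.isEmpty_coe_sort]
      exact Set.ssubset_singleton_iff.1 hS'

theorem hasNonAdaptiveTesters_of_isEmpty [IsEmpty U] (H : SimpleGraph U) (c : ℝ) {Q : ℝ → ℝ}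
    (hQ : ∀ ε, 0 < ε → 0 ≤ Q ε) : HasNonAdaptiveTesters H c Q := by
  refine fun ε hε => ⟨0, by simpa using hQ ε hε, fun N hN => ?_⟩
  have hP : lowDegreeBlowUpCollections H N (c * ε * N) = ∅ := by
    refine Set.eq_empty_of_forall_notMem fun G hG => ?_
    exact (isBlowUpCollection_iff_isEmpty.1 hG.2).false ⟨0, hN⟩
  rw [hP]
  exact (hasTest_reject N).exists_isTester (by norm_num) fun _ _ => by norm_num

end Bounds

end

end BlowUp

theorem mainTheorem3 :
    (∀ (h : ℕ) (H : SimpleGraph (Fin h)) [DecidableRel H.Adj],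
      ∃ W : ℕ, IsGreatest (minimalWitnessSizes H) W ∧ (3 ≤ h → W < h ^ 2) ∧
        ∀ c : ℝ, 1 < c → ∃ C : ℝ, HasNonAdaptiveTesters H c fun ε =>
          C * (ε ^ (-2 + 1 / ((H.maxDegree : ℝ) + 2)) + ε ^ (-2 + 2 / (W : ℝ)))) ∧
    (∀ t : ℕ, 8 ≤ t → ∀ c : ℝ, 1 < c → ∃ C : ℝ,
      HasNonAdaptiveTesters (SimpleGraph.cycleGraph t) c fun ε =>
        C * ε ^ (-2 + 2 / (t : ℝ))) := by
  refine ⟨fun h H _ => ?_, fun t ht c hc => ?_⟩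
  · rcases Nat.eq_zero_or_pos h with rfl | hh
    · refine ⟨1, by simp [BlowUp.minimalWitnessSizes_of_isEmpty, isGreatest_singleton], by simp,
        fun c _ => ⟨0, BlowUp.hasNonAdaptiveTesters_of_isEmpty H c fun ε _ => by simp⟩⟩
    · have : Nonempty (Fin h) := ⟨⟨0, hh⟩⟩
      obtain ⟨W, hWle, hW⟩ := BlowUp.exists_isGreatest_minimalWitnessSizes H
      rw [Fintype.card_fin] at hWle
      refine ⟨W, hW, fun h3 => by nlinarith, fun c hc => ?_⟩
      have hW1 : 1 ≤ W := by
        obtain ⟨N, G, S, hS, rfl⟩ := BlowUp.exists_minimalOn_of_mem hW.1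
        exact hS.nonempty.card_pos
      obtain ⟨C, hC, hQ⟩ := BlowUp.exists_hasNonAdaptiveTesters H hW1 (fun n hn => hW.2 hn) hc
      refine ⟨C, hQ _ (fun ε hε => by positivity) fun ε hε hε1 => ?_⟩
      refine mul_le_mul_of_nonneg_left (add_le_add ?_ le_rfl) hC
      refine Real.rpow_le_rpow_of_exponent_ge hε hε1 ?_
      -- The degree tests cost only ε^(-3/2), the value of the first term at maximum degree 0, hence
      -- at most that term for every maximum degree.
      have : 1 / ((H.maxDegree : ℝ) + 2) ≤ 1 / 2 := by
        gcongr
        exact le_add_of_nonneg_left (Nat.cast_nonneg _)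
      linarith
  · have : Nonempty (Fin t) := ⟨⟨0, by omega⟩⟩
    obtain ⟨C, hC, hQ⟩ := BlowUp.exists_hasNonAdaptiveTesters (SimpleGraph.cycleGraph t) (W := t)
      (by omega) (fun n hn => by
        obtain ⟨N, G, S, hS, rfl⟩ := BlowUp.exists_minimalOn_of_mem hn
        exact hS.card_le_of_cycleGraph ht) hc
    refine ⟨2 * C, hQ _ (fun ε hε => by positivity) fun ε hε hε1 => ?_⟩
    have ht' : (8 : ℝ) ≤ t := by exact_mod_cast ht
    have h1 : ε ^ (-(3 / 2) : ℝ) ≤ ε ^ (-2 + 2 / (t : ℝ)) := by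
      refine Real.rpow_le_rpow_of_exponent_ge hε hε1 ?_
      -- For t ≥ 8 the exponent -2 + 2/t is at most -7/4, so the witness test dominates the degree
      -- tests.
      have : 2 / (t : ℝ) ≤ 2 / 8 := by gcongr
      linarith
    have h2 := mul_le_mul_of_nonneg_left h1 hC
    linarith
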